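/- **Conventions.** An automaton $\Pi=(A,Q,\sigma,\tau)$ consists of a finite alphabet $A$, a set of states $Q$ and maps $\sigma:A\times Q\to A$ (output), $\tau:A\times Q\to Q$ (transition); it is assumed invertible, i.e. $\sigma(\cdot,q)$ is a bijection of $A$ for every $q$. A state $q$ induces a transformation $\Pi_q$ of the tree $A^*$ by $\Pi_q(a_1a_2\cdots a_n)=\sigma(a_1,q)\,\Pi_{\tau(a_1,q)}(a_2\cdots a_n)$, and $\langle\Pi\rangle$ is the group generated by the $\Pi_q$. For $g\in\langle\Pi\rangle$ and $v\in A^*$ write $\sigma(v,g)=g(v)$ and let $\tau(v,g)\in\langle\Pi\rangle$ be defined by $g(vw)=g(v)\,\tau(v,g)(w)$. $\Pi$ is *contracting* if there is a finite $N\subset\langle\Pi\rangle$ such that for each $g\in\langle\Pi\rangle$ there is $n\ge1$ with $\tau(A^n,g)\subset N$; its *nucleus* is $\bigcup_{g}\bigcap_{n_0}\bigcup_{n\ge n_0}\tau(A^n,g)$. $\Pi$ is *nuclear* if it is contracting, distinct states induce distinct transformations, and the set $\{\Pi_q: q\in Q\}$ is the nucleus. $\Pi$ is *smooth* if $\tau$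 is surjective, there is a state $\varepsilon$ inducing the identity, and the directed graph on $A$ with an edge from $a$ to $\sigma(a,q)$ whenever $\tau(a,q)=\varepsilon$ is strongly connected. The *limit orbispace* $L(\Pi)$ is the topological groupoid with objects $A^{-\mathbb N}$ ($\mathbb N=\{1,2,\dots\}$) and with arrows the pairs $(\alpha,\phi)\in A^{-\mathbb N}\times\langle\Pi\rangle^{-\mathbb N}$ such that $\phi(n+1)=\tau(\alpha(n),\phi(n))$ for all $n<-1$ and $\phi$ takes finitely many values; the source of $(\alpha,\phi)$ is $\alpha$, its target is $n\mapsto\sigma(\alpha(n),\phi(n))$, arrows are multiplied by composing the $\phi(n)$, and the topologies are induced by the product topologies with $A$ and $\langle\Pi\rangle$ discrete. The shift $f(\alpha,\phi)(n)=(\alpha(n-1),\phi(n-1))$ is a morphism $f:L(\Pi)\to L(\Pi)$ and induces $|f|:|L(\Pi)|\to|L(\Pi)|$ on the geometric realization of the nerve. For a space $X$ with a covering $f:X\to X$ with finite fibres, *monodromy data* consist of a base point $x$, a path $\ell_a$ from $x$ to $a$ for each $a\in f^{-1}(x)$, a set $\tilde Q\subset\pi_1(X,x)$ whose image generates $\pi_1(X,x)/K$,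 where $K$ is the subgroup of the loops acting trivially on $f^{-n}(x)$ for all $n$, and for each $a\in f^{-1}(x)$, $q\in\tilde Q$ an element $\tilde\tau(a,q)\in\tilde Q$ congruent modulo $K$ to $\ell_a\gamma\ell_{\gamma(1)}^{-1}$, where $\gamma$ is the lift of $q$ through $f$ with $\gamma(0)=a$ (paths are composed from left to right). The resulting *iterated-monodromy automaton* $\Pi(X)$ has alphabet $f^{-1}(x)$, states $\tilde Q$, output $\tilde\sigma(a,q)=\gamma(1)$ and transition $\tilde\tau$. Write $\Pi(L(\Pi))$ for $\Pi(X)$ with $X=|L(\Pi)|$ and the map $|f|$. Automata $\Pi,\Pi'$ on alphabets $A,A'$ are *equivalent* if $\#A=\#A'$ and there is a tree isomorphism $\varphi:A^*\to(A')^*$ induced by a state of a finite invertible automaton with input alphabet $A$ and output alphabet $A'$, such that every restriction of $\varphi$ to a subtree $vA^*$ (i.e. the map $\psi$ with $\varphi(vw)=\varphi(v)\psi(w)$) is of the form $\varphi\circ g$ with $g\in\langle\Pi\rangle$, and $\varphi\langle\Pi\rangle\varphi^{-1}=\langle\Pi'\rangle$. **Theorem.** Let $\Pi$ be an invertible automaton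 on a finite alphabet $A$ that is nuclear and smooth. Then $|L(\Pi)|$ is path connected and $|f|:|L(\Pi)|\to|L(\Pi)|$ is a $\#A$-to-one covering map, so that $\Pi(L(\Pi))$ is defined, and: 1. for every choice of monodromy data for $(|L(\Pi)|,|f|)$, $\Pi$ is equivalent to the resulting automaton $\Pi(L(\Pi))$; 2. the monodromy data $(x,(\ell_a)_a,\tilde Q,\tilde\tau)$ can be chosen so that $\Pi(L(\Pi))=\Pi$, i.e. there are bijections $A\to f^{-1}(x)$ and $Q\to\tilde Q$ carrying $\sigma,\tau$ to $\tilde\sigma,\tilde\tau$. -/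

import Mathlib

universe u v w

namespace AutLim

/-! ### Automata -/

/-- An automaton (transducer) with input alphabet `A`, output alphabet `B` and set of states `Q`. -/
structure Transducer (A : Type u) (B : Type v) (Q : Type w) where
  /-- the output function `σ` -/
  out : A → Q → B
  /-- the transition function `τ` -/
  next : A → Q → Q

/-- An automaton on the alphabet `A` with set of states `Q`. -/
abbrev Automaton (A : Type u) (Q : Type v) := Transducer A A Q

namespace Transducer

variable {A : Type u} {B : Type v} {Q : Type w}

/-- The map `A^* → B^*` induced by the state `q`:
`a₁a₂⋯aₙ ↦ σ(a₁,q) · (image of a₂⋯aₙ under the state τ(a₁,q))`. -/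
def act (M : Transducer A B Q) : Q → List A → List B
  | _, [] => []
  | q, a :: w => M.out a q :: M.act (M.next a q) w

/-- The output function `σ(-,q)` is a bijection for every state `q`. -/
def Invertible (M : Transducer A B Q) : Prop :=
  ∀ q, Function.Bijective fun a => M.out a q

theorem length_act (M : Transducer A B Q) (q : Q) (w : List A) :
    (M.act q w).length = w.length := by
  induction w generalizing q with
  | nil => rfl
  | cons a w ih => simp [act, ih]

end Transducer

/-- `IsSection g v h`: the map `h` is the restriction of the tree map `g` to the subtree hanging
from the vertex `v`, i.e. `g (v w) = g (v) h (w)` for all words `w`.  For `g` in the group of an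
automaton this says `h = τ(v, g)`. -/
def IsSection {A : Type u} {B : Type v} (g : List A → List B) (v : List A)
    (h : List A → List B) : Prop :=
  ∀ w, g (v ++ w) = g v ++ h w

/-- The letter `σ(a, g)`: the image of the one-letter word `a` under a length-preserving `g`. -/
def letter {A : Type u} (g : Equiv.Perm (List A)) (a : A) : A :=
  (g [a]).headD a

namespace Transducer

variable {A : Type u} {Q : Type v}

/-- The group `⟨M⟩` of an (invertible) automaton: the group of transformations of `A^*` generated
by the transformations induced by the states. -/
def group (M : Automaton A Q) : Subgroup (Equiv.Perm (List A)) :=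
  Subgroup.closure {g | ∃ q, ⇑g = M.act q}

/-- The automaton is contracting: there is a finite `N ⊆ ⟨M⟩` such that for each `g ∈ ⟨M⟩` there is
`n ≥ 1` with `τ(A^n, g) ⊆ N`. -/
def Contracting (M : Automaton A Q) : Prop :=
  ∃ N : Set (Equiv.Perm (List A)), N.Finite ∧ N ⊆ M.group ∧
    ∀ g ∈ M.group, ∃ n : ℕ, 1 ≤ n ∧
      ∀ v : List A, v.length = n → ∃ h ∈ N, IsSection g v h

/-- The nucleus `⋃_{g ∈ ⟨M⟩} ⋂_{n₀} ⋃_{n ≥ n₀} τ(A^n, g)`. -/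
def nucleus (M : Automaton A Q) : Set (Equiv.Perm (List A)) :=
  {h | ∃ g ∈ M.group, ∀ n₀ : ℕ, ∃ n, n₀ ≤ n ∧ ∃ v : List A, v.length = n ∧ IsSection g v h}

/-- The automaton is nuclear: it is contracting and its nucleus is equal to its set of states, a
state being identified with the transformation that it induces. -/
def Nuclear (M : Automaton A Q) : Prop :=
  M.Contracting ∧ Function.Injective M.act ∧ ∀ g, g ∈ M.nucleus ↔ ∃ q, ⇑g = M.act q

/-- The automaton is smooth: `τ` is onto, and, `ε` denoting the identity state, the graph on `A`
with an edge from `a` to `σ(a,q)` for all `a, q` with `τ(a,q) = ε` is strongly connected. -/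
def Smooth (M : Automaton A Q) : Prop :=
  (Function.Surjective fun p : A × Q => M.next p.1 p.2) ∧
    ∃ ε : Q, M.act ε = id ∧
      ∀ a b : A, Relation.ReflTransGen (fun a b => ∃ q, M.out a q = b ∧ M.next a q = ε) a b

/-- Two automata coincide up to renaming of letters and states. -/
def SameAs {A' : Type*} {Q' : Type*} (M : Automaton A Q) (M' : Automaton A' Q') : Prop :=
  ∃ (eA : A ≃ A') (eQ : Q ≃ Q'), ∀ a q,
    M'.out (eA a) (eQ q) = eA (M.out a q) ∧ M'.next (eA a) (eQ q) = eQ (M.next a q)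

/-- Two (invertible) automata are equivalent: there is a tree isomorphism `φ : A^* → A'^*`
induced by a state of a finite invertible automaton, all of whose states (restrictions) are of the
form `φ ∘ g` with `g ∈ ⟨M⟩`, and such that `φ ⟨M⟩ φ⁻¹ = ⟨M'⟩`. -/
def Equivalent {A' : Type*} {Q' : Type*} (M : Automaton A Q) (M' : Automaton A' Q') : Prop :=
  M.Invertible ∧ M'.Invertible ∧ Nonempty (A ≃ A') ∧
    ∃ φ : List A ≃ List A',
      (∃ (S : Type) (_ : Finite S) (F : Transducer A A' S) (s : S), F.Invertible ∧ ⇑φ = F.act s) ∧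
      (∀ (v : List A) (ψ : List A → List A'), IsSection φ v ψ →
        ∃ g ∈ M.group, ψ = fun w => φ (g w)) ∧
      M.group.map φ.permCongrHom.toMonoidHom = M'.group

theorem length_of_mem_group {M : Automaton A Q} {g : Equiv.Perm (List A)} (hg : g ∈ M.group)
    (w : List A) : (g w).length = w.length := by
  induction hg using Subgroup.closure_induction generalizing w with
  | mem g h => obtain ⟨q, hq⟩ := h; rw [hq, M.length_act]
  | one => rfl
  | mul g h _ _ ihg ihh => rw [Equiv.Perm.mul_apply, ihg, ihh]
  | inv g _ ih =>
    have := ih (g⁻¹ w)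
    rw [← Equiv.Perm.mul_apply, mul_inv_cancel] at this
    exact this.symm

theorem apply_singleton {M : Automaton A Q} {g : Equiv.Perm (List A)} (hg : g ∈ M.group)
    (a : A) : g [a] = [letter g a] := by
  obtain ⟨b, hb⟩ := List.length_eq_one_iff.1 (length_of_mem_group hg [a])
  simp [letter, hb]

theorem letter_mul {M : Automaton A Q} {g h : Equiv.Perm (List A)} (hg : g ∈ M.group)
    (hh : h ∈ M.group) (a : A) : letter (g * h) a = letter g (letter h a) := by
  have := apply_singleton (M.group.mul_mem hg hh) a
  rw [Equiv.Perm.mul_apply, apply_singleton hh, apply_singleton hg] at this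
  exact (List.singleton_inj.1 this).symm

theorem isSection_mul {g h g' h' : Equiv.Perm (List A)} {v : List A}
    (H : IsSection h v h') (G : IsSection g (h v) g') :
    IsSection ⇑(g * h) v ⇑(g' * h') := by
  intro w
  simp only [Equiv.Perm.mul_apply]
  rw [H, G]

theorem isSection_inv {g g' : Equiv.Perm (List A)} {v : List A} (G : IsSection g v g') :
    IsSection ⇑g⁻¹ (g v) ⇑g'⁻¹ := by
  intro w
  have h1 : g⁻¹ (g v) = v := g.symm_apply_apply v
  have h2 : g' (g'⁻¹ w) = w := g'.apply_symm_apply w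
  rw [Equiv.Perm.inv_eq_iff_eq, h1, G, h2]

end Transducer

/-! ### Topological groupoids and their geometric realization -/

/-- A topological groupoid; `mul g h` is defined when `tgt g = src h`. -/
structure TopGroupoid where
  Obj : Type u
  Mor : Type u
  [topObj : TopologicalSpace Obj]
  [topMor : TopologicalSpace Mor]
  src : Mor → Obj
  tgt : Mor → Obj
  one : Obj → Mor
  inv : Mor → Mor
  mul : ∀ g h : Mor, tgt g = src h → Mor
  src_one : ∀ x, src (one x) = x
  tgt_one : ∀ x, tgt (one x) = x
  src_inv : ∀ g, src (inv g) = tgt g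
  tgt_inv : ∀ g, tgt (inv g) = src g
  src_mul : ∀ g h e, src (mul g h e) = src g
  tgt_mul : ∀ g h e, tgt (mul g h e) = tgt h
  mul_assoc : ∀ g h k e e', mul (mul g h e) k ((tgt_mul g h e).trans e') =
    mul g (mul h k e') (e.trans (src_mul h k e').symm)
  one_mul : ∀ g, mul (one (src g)) g (tgt_one _) = g
  mul_one : ∀ g, mul g (one (tgt g)) (src_one _).symm = g
  mul_inv : ∀ g, mul g (inv g) (src_inv g).symm = one (src g)
  inv_mul : ∀ g, mul (inv g) g (tgt_inv g) = one (tgt g)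
  continuous_src : Continuous src
  continuous_tgt : Continuous tgt
  continuous_one : Continuous one
  continuous_inv : Continuous inv
  continuous_mul : Continuous fun p : {p : Mor × Mor // tgt p.1 = src p.2} =>
    mul p.1.1 p.1.2 p.2

attribute [instance] TopGroupoid.topObj TopGroupoid.topMor

namespace TopGroupoid

/-- A morphism of topological groupoids. -/
structure Hom (G H : TopGroupoid.{u}) where
  obj : G.Obj → H.Obj
  mor : G.Mor → H.Mor
  continuous_obj : Continuous obj
  continuous_mor : Continuous mor
  src_mor : ∀ g, H.src (mor g) = obj (G.src g)
  tgt_mor : ∀ g, H.tgt (mor g) = obj (G.tgt g)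
  map_one : ∀ x, mor (G.one x) = H.one (obj x)
  map_inv : ∀ g, mor (G.inv g) = H.inv (mor g)
  map_mul : ∀ g h e, mor (G.mul g h e) =
    H.mul (mor g) (mor h) ((tgt_mor g).trans ((congrArg obj e).trans (src_mor h).symm))

/-- An `n`-simplex of the nerve of `G`: a functor from the poset `{0 < ⋯ < n}` to `G`, i.e. objects
`x₀, …, xₙ` with arrows `g_{ij} : x_i → x_j` for `i ≤ j` satisfying `g_{ij} g_{jk} = g_{ik}`.  It is
the same thing as a composable sequence `(x₀, g₁, x₁, …, gₙ, xₙ)` of `n` arrows, where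
`g_i = g_{i-1,i}`. -/
@[ext]
structure Simplex (G : TopGroupoid.{u}) (n : ℕ) where
  vert : Fin (n + 1) → G.Obj
  edge : ∀ i j : Fin (n + 1), i ≤ j → G.Mor
  src_edge : ∀ i j h, G.src (edge i j h) = vert i
  tgt_edge : ∀ i j h, G.tgt (edge i j h) = vert j
  edge_self : ∀ i, edge i i le_rfl = G.one (vert i)
  edge_mul : ∀ i j k h h', G.mul (edge i j h) (edge j k h')
    ((tgt_edge i j h).trans (src_edge j k h').symm) = edge i k (h.trans h')

/-- The set of `n`-simplices is topologized as a subspace of a product of copies of the spaces of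
objects and of arrows. -/
instance (G : TopGroupoid.{u}) (n : ℕ) : TopologicalSpace (G.Simplex n) :=
  TopologicalSpace.induced
    (fun x => ((x.vert, fun p => x.edge p.1.1 p.1.2 p.2) :
      (Fin (n + 1) → G.Obj) × ({p : Fin (n + 1) × Fin (n + 1) // p.1 ≤ p.2} → G.Mor)))
    inferInstance

/-- The simplicial operator `θ^* : G_n → G_m` of a monotone map `θ : {0,…,m} → {0,…,n}`; the face
maps omit a vertex, the degeneracy maps repeat a vertex. -/
def Simplex.pull {G : TopGroupoid.{u}} {m n : ℕ} (θ : Fin (m + 1) →o Fin (n + 1))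
    (x : G.Simplex n) : G.Simplex m where
  vert i := x.vert (θ i)
  edge i j h := x.edge (θ i) (θ j) (θ.monotone h)
  src_edge _ _ _ := x.src_edge _ _ _
  tgt_edge _ _ _ := x.tgt_edge _ _ _
  edge_self _ := x.edge_self _
  edge_mul _ _ _ _ _ := x.edge_mul _ _ _ _ _

/-- The image of a simplex under a morphism of groupoids. -/
def Simplex.map {G H : TopGroupoid.{u}} (F : Hom G H) {n : ℕ} (x : G.Simplex n) : H.Simplex n where
  vert i := F.obj (x.vert i)
  edge i j h := F.mor (x.edge i j h)
  src_edge i j h := by rw [F.src_mor, x.src_edge]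
  tgt_edge i j h := by rw [F.tgt_mor, x.tgt_edge]
  edge_self i := by rw [x.edge_self, F.map_one]
  edge_mul i j k h h' := by
    rw [← F.map_mul _ _ ((x.tgt_edge i j h).trans (x.src_edge j k h').symm), x.edge_mul]

/-- The disjoint union `∐ₙ G_n × Δ^n`. -/
abbrev Cells (G : TopGroupoid.{u}) := Σ n : ℕ, G.Simplex n × stdSimplex ℝ (Fin (n + 1))

/-- The gluing relation `(θ^* x, t) ∼ (x, θ_* t)` for all monotone `θ : {0,…,m} → {0,…,n}`,
`x ∈ G_n`, `t ∈ Δ^m`.  As every monotone map is a composition of cofaces and codegeneracies, it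
generates the same equivalence relation as `(d_i x, t) ∼ (x, δ_i t)` and
`(s_i x, t) ∼ (x, σ_i t)`. -/
inductive Glue (G : TopGroupoid.{u}) : G.Cells → G.Cells → Prop
  | intro {m n : ℕ} (θ : Fin (m + 1) →o Fin (n + 1)) (x : G.Simplex n)
      (t : stdSimplex ℝ (Fin (m + 1))) :
      Glue G ⟨m, x.pull θ, t⟩ ⟨n, x, stdSimplex.map θ t⟩

/-- The geometric realization `|G|`, with the quotient topology. -/
def Realization (G : TopGroupoid.{u}) : Type u := Quot (Glue G)

instance (G : TopGroupoid.{u}) : TopologicalSpace G.Realization :=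
  inferInstanceAs (TopologicalSpace (Quot (Glue G)))

/-- The map `|F| : |G| → |H|` induced by a morphism `F : G → H`. -/
def Hom.realize {G H : TopGroupoid.{u}} (F : Hom G H) : G.Realization → H.Realization :=
  Quot.map (fun c => ⟨c.1, c.2.1.map F, c.2.2⟩) (by
    rintro _ _ ⟨θ, x, t⟩
    exact Glue.intro θ (x.map F) t)

end TopGroupoid

/-! ### The limit space of an automaton

Sequences indexed by `-ℕ = {…, -3, -2, -1}` are written as functions on `ℕ = {0, 1, 2, …}`: the value
at `k : ℕ` is the entry with index `-(k+1)`. -/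

/-- The space `A^{-ℕ}` of left-infinite sequences. -/
def LimObj (A : Type u) : Type u := ℕ → A

/-- The product topology, for the discrete topology on `A`. -/
instance (A : Type u) : TopologicalSpace (LimObj A) :=
  @Pi.topologicalSpace ℕ (fun _ => A) (fun _ => ⊥)

/-- The arrows of the limit space: pairs `(α, φ) ∈ A^{-ℕ} × ⟨M⟩^{-ℕ}` such that
`φ(n+1) = τ(α(n), φ(n))` for all `n < -1`, and such that `φ` takes finitely many values. -/
def LimMor {A : Type u} {Q : Type v} (M : Automaton A Q) : Type u :=
  {p : (ℕ → A) × (ℕ → M.group) // (Set.range p.2).Finite ∧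
    ∀ k, IsSection (p.2 (k + 1)).1 [p.1 (k + 1)] (p.2 k).1}

/-- The restriction of the product topology, for the discrete topologies on `A` and `⟨M⟩`. -/
instance {A : Type u} {Q : Type v} (M : Automaton A Q) : TopologicalSpace (LimMor M) :=
  TopologicalSpace.induced Subtype.val
    (@instTopologicalSpaceProd (ℕ → A) (ℕ → M.group)
      (@Pi.topologicalSpace ℕ (fun _ => A) (fun _ => ⊥))
      (@Pi.topologicalSpace ℕ (fun _ => M.group) (fun _ => ⊥)))

namespace LimMor

variable {A : Type u} {Q : Type v} {M : Automaton A Q}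

/-- The source `α` of `(α, φ)`. -/
def src (g : LimMor M) : LimObj A := g.1.1

/-- The target `n ↦ σ(α(n), φ(n))` of `(α, φ)`. -/
def tgt (g : LimMor M) : LimObj A := fun k => letter (g.1.2 k).1 (g.1.1 k)

theorem ext {g h : LimMor M} (h1 : ∀ k, g.1.1 k = h.1.1 k) (h2 : ∀ k, g.1.2 k = h.1.2 k) :
    g = h :=
  Subtype.ext (Prod.ext (funext h1) (funext h2))

theorem apply_src (g : LimMor M) (k : ℕ) : (g.1.2 k).1 [g.1.1 k] = [g.tgt k] :=
  Transducer.apply_singleton (g.1.2 k).2 _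

/-- The identity arrow at `α`. -/
def one (α : LimObj A) : LimMor M :=
  ⟨(α, fun _ => 1), (Set.finite_singleton (1 : M.group)).subset (by rintro _ ⟨_, rfl⟩; rfl),
    fun _ _ => rfl⟩

/-- The inverse of `(α, φ)`: the sequence of the inverses, starting at the target. -/
def inv (g : LimMor M) : LimMor M :=
  ⟨(g.tgt, fun k => (g.1.2 k)⁻¹),
    (g.2.1.image (·⁻¹)).subset (by rintro _ ⟨k, rfl⟩; exact ⟨_, ⟨k, rfl⟩, rfl⟩), fun k => by
      have := Transducer.isSection_inv (g.2.2 k)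
      rwa [apply_src] at this⟩

/-- The product `(α, φ)(β, ψ) = (α, φψ)`, where in `φψ` one acts first by `φ`, then by `ψ`. -/
def mul (g h : LimMor M) (e : g.tgt = h.src) : LimMor M :=
  ⟨(g.1.1, fun k => h.1.2 k * g.1.2 k),
    (g.2.1.image2 (fun x y => y * x) h.2.1).subset (by
      rintro _ ⟨k, rfl⟩
      exact ⟨_, ⟨k, rfl⟩, _, ⟨k, rfl⟩, rfl⟩), fun k => by
      refine Transducer.isSection_mul (g.2.2 k) ?_
      rw [apply_src, e]
      exact h.2.2 k⟩

theorem tgt_one (α : LimObj A) : (one α : LimMor M).tgt = α := funext fun _ => rfl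

theorem tgt_inv (g : LimMor M) : g.inv.tgt = g.src := by
  funext k
  have h := apply_src g.inv k
  have h' : (g.inv.1.2 k).1 [g.inv.1.1 k] = [g.1.1 k] := by
    change (g.1.2 k).1⁻¹ [g.tgt k] = _
    rw [Equiv.Perm.inv_eq_iff_eq, apply_src]
  rw [h'] at h
  exact (List.singleton_inj.1 h).symm

theorem tgt_mul (g h : LimMor M) (e : g.tgt = h.src) : (g.mul h e).tgt = h.tgt := by
  funext k
  refine (Transducer.letter_mul (h.1.2 k).2 (g.1.2 k).2 _).trans ?_
  change letter _ (g.tgt k) = _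
  rw [e]
  rfl

/-- The shift on arrows, deleting the last entries. -/
def shift (g : LimMor M) : LimMor M :=
  ⟨(fun k => g.1.1 (k + 1), fun k => g.1.2 (k + 1)),
    g.2.1.subset (by rintro _ ⟨k, rfl⟩; exact ⟨k + 1, rfl⟩), fun k => g.2.2 (k + 1)⟩

theorem continuous_iff {X : Type*} [TopologicalSpace X] {f : X → LimMor M} :
    Continuous f ↔ (∀ k, @Continuous X A _ ⊥ fun x => (f x).1.1 k) ∧
      (∀ k, @Continuous X M.group _ ⊥ fun x => (f x).1.2 k) := by
  let _ : TopologicalSpace A := ⊥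
  let _ : TopologicalSpace M.group := ⊥
  rw [← continuous_pi_iff, ← continuous_pi_iff]
  refine continuous_induced_rng.trans ⟨fun h => ⟨continuous_fst.comp h, continuous_snd.comp h⟩,
    fun h => h.1.prodMk h.2⟩

theorem continuous_src : Continuous (src : LimMor M → LimObj A) := by
  let _ : TopologicalSpace A := ⊥
  exact continuous_pi (continuous_iff.1 continuous_id).1

theorem continuous_tgt : Continuous (tgt : LimMor M → LimObj A) := by
  let _ : TopologicalSpace A := ⊥
  let _ : TopologicalSpace M.group := ⊥
  have : DiscreteTopology A := ⟨rfl⟩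
  have : DiscreteTopology M.group := ⟨rfl⟩
  refine continuous_pi fun k => ?_
  have h := continuous_iff.1 (continuous_id (X := LimMor M))
  exact (continuous_of_discreteTopology (f := fun p : M.group × A => letter p.1.1 p.2)).comp
    ((h.2 k).prodMk (h.1 k))

theorem continuous_one : Continuous (one : LimObj A → LimMor M) := by
  let _ : TopologicalSpace A := ⊥
  let _ : TopologicalSpace M.group := ⊥
  exact continuous_iff.2 ⟨fun k => continuous_apply (A := fun _ : ℕ => A) k,
    fun _ => continuous_const⟩

theorem continuous_inv : Continuous (inv : LimMor M → LimMor M) := by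
  let _ : TopologicalSpace A := ⊥
  let _ : TopologicalSpace M.group := ⊥
  have : DiscreteTopology M.group := ⟨rfl⟩
  have h := continuous_iff.1 (continuous_id (X := LimMor M))
  exact continuous_iff.2
    ⟨fun k => (continuous_apply (A := fun _ : ℕ => A) k).comp continuous_tgt,
      fun k => (continuous_of_discreteTopology (f := fun p : M.group => p⁻¹)).comp (h.2 k)⟩

theorem continuous_mul : Continuous fun p : {p : LimMor M × LimMor M // p.1.tgt = p.2.src} =>
    mul p.1.1 p.1.2 p.2 := by
  let _ : TopologicalSpace A := ⊥
  let _ : TopologicalSpace M.group := ⊥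
  have : DiscreteTopology M.group := ⟨rfl⟩
  have h := continuous_iff.1 (continuous_id (X := LimMor M))
  have c1 : Continuous fun p : {p : LimMor M × LimMor M // p.1.tgt = p.2.src} => p.1.1 :=
    continuous_fst.comp continuous_subtype_val
  have c2 : Continuous fun p : {p : LimMor M × LimMor M // p.1.tgt = p.2.src} => p.1.2 :=
    continuous_snd.comp continuous_subtype_val
  refine continuous_iff.2 ⟨fun k => ?_, fun k => ?_⟩
  · have := (h.1 k).comp c1
    exact this
  · have := (continuous_of_discreteTopology (f := fun p : M.group × M.group => p.1 * p.2)).comp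
      (((h.2 k).comp c2).prodMk ((h.2 k).comp c1))
    exact this

theorem continuous_shift : Continuous (shift : LimMor M → LimMor M) := by
  have h := continuous_iff.1 (continuous_id (X := LimMor M))
  exact continuous_iff.2 ⟨fun k => h.1 (k + 1), fun k => h.2 (k + 1)⟩

end LimMor

section Limit

variable {A : Type u} {Q : Type v} (M : Automaton A Q)

/-- The limit space `L(M)` of the automaton `M`, a topological groupoid. -/
def limitSpace : TopGroupoid.{u} where
  Obj := LimObj A
  Mor := LimMor M
  src := LimMor.src
  tgt := LimMor.tgt
  one := LimMor.one
  inv := LimMor.inv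
  mul := LimMor.mul
  src_one _ := rfl
  tgt_one := LimMor.tgt_one
  src_inv _ := rfl
  tgt_inv := LimMor.tgt_inv
  src_mul _ _ _ := rfl
  tgt_mul := LimMor.tgt_mul
  mul_assoc _ _ _ _ _ := LimMor.ext (fun _ => rfl) fun _ => (_root_.mul_assoc _ _ _).symm
  one_mul _ := LimMor.ext (fun _ => rfl) fun _ => _root_.mul_one _
  mul_one _ := LimMor.ext (fun _ => rfl) fun _ => _root_.one_mul _
  mul_inv _ := LimMor.ext (fun _ => rfl) fun _ => inv_mul_cancel _
  inv_mul _ := LimMor.ext (fun _ => rfl) fun _ => mul_inv_cancel _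
  continuous_src := LimMor.continuous_src
  continuous_tgt := LimMor.continuous_tgt
  continuous_one := LimMor.continuous_one
  continuous_inv := LimMor.continuous_inv
  continuous_mul := LimMor.continuous_mul

/-- The shift `f : L(M) → L(M)`, `f(α, φ)(n) = (α(n-1), φ(n-1))`. -/
def limitShift : TopGroupoid.Hom (limitSpace M) (limitSpace M) where
  obj := fun (α : LimObj A) k => α (k + 1)
  mor := LimMor.shift
  continuous_obj := by
    let _ : TopologicalSpace A := ⊥
    exact continuous_pi fun k => continuous_apply (A := fun _ : ℕ => A) (k + 1)
  continuous_mor := LimMor.continuous_shift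
  src_mor _ := rfl
  tgt_mor _ := rfl
  map_one _ := rfl
  map_inv _ := rfl
  map_mul _ _ _ := rfl

end Limit

/-! ### Iterated monodromy automata of self-coverings -/

theorem isCoveringMap_fst (W I : Type*) [TopologicalSpace W] [TopologicalSpace I]
    [DiscreteTopology I] : IsCoveringMap (Prod.fst : W × I → W) := fun _ =>
  IsEvenlyCovered.to_isEvenlyCovered_preimage (I := I)
    ⟨inferInstance, Set.univ, trivial, isOpen_univ, isOpen_univ,
      (Homeomorph.Set.univ (W × I)).trans
        ((Homeomorph.Set.univ W).symm.prodCongr (Homeomorph.refl I)), fun _ => rfl⟩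

theorem isCoveringMap_comp {X Y Z : Type*} [TopologicalSpace X] [TopologicalSpace Y]
    [TopologicalSpace Z] {f : X → Y} {g : Y → Z} (hf : IsCoveringMap f) (hg : IsCoveringMap g)
    (fin : ∀ z, (g ⁻¹' {z}).Finite) : IsCoveringMap (g ∘ f) := by
  intro z
  obtain ⟨_, U, hzU, hU, hgU, H, hH⟩ := hg z
  have : Finite (g ⁻¹' {z}) := fin z
  let s : g ⁻¹' {z} → U → Y := fun i u => (H.symm (u, i)).1
  have hs : ∀ i, Continuous (s i) := fun i => by
    exact continuous_subtype_val.comp (H.symm.continuous.comp (by fun_prop))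
  choose hd V hyV hV hfV K hK using fun i : g ⁻¹' {z} => hf (s i ⟨z, hzU⟩)
  let W : Set Z := Subtype.val '' (⋂ i, s i ⁻¹' V i)
  have hWo : IsOpen W :=
    hU.isOpenMap_subtype_val _ (isOpen_iInter_of_finite fun i => (hV i).preimage (hs i))
  have hWU : W ⊆ U := by rintro _ ⟨u, _, rfl⟩; exact u.2
  have hsV : ∀ w (hw : w ∈ W) i, s i ⟨w, hWU hw⟩ ∈ V i := by
    rintro _ ⟨u, hu, rfl⟩ i
    exact Set.mem_iInter.1 hu i
  have hgs : ∀ i u, g (s i u) = u := fun i u => by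
    rw [← hH]; simp
  have hsH : ∀ y (hy : g y ∈ U), s (H ⟨y, hy⟩).2 ⟨g y, hy⟩ = y := fun y hy => by
    have : ((⟨g y, hy⟩ : U), (H ⟨y, hy⟩).2) = H ⟨y, hy⟩ :=
      Prod.ext (Subtype.ext (hH ⟨y, hy⟩).symm) rfl
    simp only [s, this, Homeomorph.symm_apply_apply]
  have hHs : ∀ i u (h : g (s i u) ∈ U), (H ⟨s i u, h⟩).2 = i := fun i u h => by
    have : (⟨s i u, h⟩ : g ⁻¹' U) = H.symm (u, i) := Subtype.ext rfl
    rw [this]; simp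
  let I := Σ i : g ⁻¹' {z}, f ⁻¹' {s i ⟨z, hzU⟩}
  let φ : W × I → X := fun p =>
    ((K p.2.1).symm (⟨s p.2.1 ⟨p.1, hWU p.1.2⟩, hsV _ p.1.2 _⟩, p.2.2)).1
  have hfφ : ∀ p, f (φ p) = s p.2.1 ⟨p.1, hWU p.1.2⟩ := fun p => by
    rw [← hK]; simp
  have hφc : Continuous φ := by
    rw [continuous_prod_of_discrete_right]
    rintro ⟨i, j⟩
    have h1 : Continuous fun w : W => (⟨w, hWU w.2⟩ : U) :=
      continuous_subtype_val.subtype_mk _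
    have h2 : Continuous fun w : W => (⟨s i ⟨w, hWU w.2⟩, hsV _ w.2 i⟩ : V i) :=
      ((hs i).comp h1).subtype_mk _
    have h3 : Continuous fun w : W =>
        ((⟨s i ⟨w, hWU w.2⟩, hsV _ w.2 i⟩, j) : V i × (f ⁻¹' {s i ⟨z, hzU⟩} : Set X)) :=
      h2.prodMk continuous_const
    exact continuous_subtype_val.comp ((K i).symm.continuous.comp h3)
  have hpr : IsLocalHomeomorph (Prod.fst : W × I → W) :=
    (isCoveringMap_fst W I).isLocalHomeomorph
  have hφl : IsLocalHomeomorph φ := by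
    have hgf : IsLocalHomeomorph (g ∘ f) := hg.isLocalHomeomorph.comp hf.isLocalHomeomorph
    refine IsLocalHomeomorph.of_comp (g := g ∘ f) ?_ hgf hφc
    have : (g ∘ f) ∘ φ = Subtype.val ∘ (Prod.fst : W × I → W) := by
      funext p
      simp [hfφ, hgs]
    rw [this]
    exact hWo.isOpenEmbedding_subtypeVal.isLocalHomeomorph.comp hpr
  have hφi : Function.Injective φ := by
    rintro ⟨w, i, j⟩ ⟨w', i', j'⟩ h
    have h1 : s i ⟨w, hWU w.2⟩ = s i' ⟨w', hWU w'.2⟩ := by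
      rw [← hfφ ⟨w, i, j⟩, ← hfφ ⟨w', i', j'⟩, h]
    have h2 : w = w' := Subtype.ext (by rw [← hgs i ⟨w, hWU w.2⟩, h1, hgs])
    subst h2
    have h3 : i = i' := by
      have e : ∀ i, g (s i ⟨w, hWU w.2⟩) ∈ U := fun i => by rw [hgs]; exact hWU w.2
      rw [← hHs i ⟨w, hWU w.2⟩ (e i), ← hHs i' ⟨w, hWU w.2⟩ (e i')]
      congr 2
      exact Subtype.ext h1
    subst h3
    have h4 := (K i).symm.injective (Subtype.ext h)
    simp only [Prod.mk.injEq, true_and] at h4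
    rw [h4]
  have hφr : Set.range φ = (g ∘ f) ⁻¹' W := by
    ext x
    constructor
    · rintro ⟨p, rfl⟩
      simp only [Set.mem_preimage, Function.comp, hfφ, hgs]
      exact p.1.2
    · intro hx
      have hx' : g (f x) ∈ W := hx
      let i := (H ⟨f x, hWU hx'⟩).2
      have hi : s i ⟨g (f x), hWU hx'⟩ = f x := hsH _ _
      have hV' : f x ∈ V i := hi ▸ hsV _ hx' i
      refine ⟨⟨⟨g (f x), hx'⟩, i, (K i ⟨x, hV'⟩).2⟩, ?_⟩
      have : ((⟨s i ⟨g (f x), hWU hx'⟩, hsV _ hx' _⟩ : V i), (K i ⟨x, hV'⟩).2) =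
          K i ⟨x, hV'⟩ := Prod.ext (Subtype.ext (hi.trans (hK i ⟨x, hV'⟩).symm)) rfl
      simp only [φ]
      rw [this]
      simp
  have hφe : Topology.IsOpenEmbedding φ := .of_continuous_injective_isOpenMap hφc hφi hφl.isOpenMap
  have hzW : z ∈ W := ⟨⟨z, hzU⟩, Set.mem_iInter.2 fun i => hyV i, rfl⟩
  refine IsEvenlyCovered.to_isEvenlyCovered_preimage (I := I)
    ⟨inferInstance, W, hzW, hWo, by rw [← hφr]; exact hφl.isOpenMap.isOpen_range,
      (Homeomorph.setCongr hφr.symm).trans hφe.toIsEmbedding.toHomeomorph.symm, fun x => ?_⟩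
  obtain ⟨p, hp⟩ : x.1 ∈ Set.range φ := by rw [hφr]; exact x.2
  have : (Homeomorph.setCongr hφr.symm).trans hφe.toIsEmbedding.toHomeomorph.symm x = p := by
    simp only [Homeomorph.trans_apply]
    rw [Homeomorph.symm_apply_eq]
    exact Subtype.ext hp.symm
  rw [this, ← hp]
  simp [hfφ, hgs]

theorem isCoveringMap_id (X : Type*) [TopologicalSpace X] : IsCoveringMap (id : X → X) := by
  intro x
  refine IsEvenlyCovered.to_isEvenlyCovered_preimage (I := Unit)
    ⟨inferInstance, Set.univ, trivial, isOpen_univ, isOpen_univ,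
      (Homeomorph.prodPUnit _).symm, fun _ => rfl⟩

theorem isCoveringMap_iterate {X : Type*} [TopologicalSpace X] {f : X → X} (hf : IsCoveringMap f)
    (fin : ∀ x, (f ⁻¹' {x}).Finite) (n : ℕ) : IsCoveringMap (f^[n]) := by
  induction n with
  | zero => exact isCoveringMap_id X
  | succ n ih => rw [Function.iterate_succ']; exact isCoveringMap_comp ih hf fin

section Monodromy

variable {X : Type u} [TopologicalSpace X] {f : X → X}

/-- The subgroup `K ⊴ π₁(X, x)` of the classes of loops that induce the identity permutation on
`f^{-n}(x)` for all `n`. -/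
noncomputable def monodromyKernel (cov : IsCoveringMap f) (fin : ∀ x, (f ⁻¹' {x}).Finite) (x : X) :
    Subgroup (FundamentalGroup X x) :=
  ⨅ n : ℕ, ((isCoveringMap_iterate cov fin n).monodromyPerm x).ker

instance (cov : IsCoveringMap f) (fin : ∀ x, (f ⁻¹' {x}).Finite) (x : X) :
    (monodromyKernel cov fin x).Normal :=
  Subgroup.normal_iInf_normal fun _ => inferInstance

/-- For a loop class `q` at `x` and a point `a` of `f^{-1}(x)`, the class of the loop
`ℓ_a γ ℓ_b^{-1}` at `x`, where `γ` is the lift of `q` through `f` starting at `a`, `b` is the end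
of `γ`, and paths are composed from left to right. -/
noncomputable def transfer (cov : IsCoveringMap f) {x : X} (ℓ : ∀ a : f ⁻¹' {x}, Path x a.1)
    (a : f ⁻¹' {x}) (q : FundamentalGroup X x) : FundamentalGroup X x :=
  FundamentalGroup.fromPath
    (((Path.Homotopic.Quotient.mk (ℓ a)).trans (cov.liftPathQuotient q.toPath a)).trans
      (Path.Homotopic.Quotient.mk (ℓ (cov.monodromy q.toPath a))).symm)

/-- The data from which an iterated monodromy automaton of a covering `f : X → X` with finite
fibres is constructed: a base point `x`, paths `ℓ_a` from `x` to the points `a` of `f^{-1}(x)`, a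
set of states `Q ⊆ π₁(X, x)` whose image generates `π₁(X, x) / K`, and for all `a`, `q` a choice of
an element `τ(a,q)` of `Q` that is congruent modulo `K` to `ℓ_a γ ℓ_b^{-1}`, where `γ` is the lift of
`q` starting at `a` and `b` is its end. -/
structure MonodromyData (cov : IsCoveringMap f) (fin : ∀ x, (f ⁻¹' {x}).Finite) where
  base : X
  path : ∀ a : f ⁻¹' {base}, Path base a.1
  states : Set (FundamentalGroup X base)
  next : f ⁻¹' {base} → states → states
  generates : Subgroup.closure
    ((QuotientGroup.mk : _ → FundamentalGroup X base ⧸ monodromyKernel cov fin base) '' states) = ⊤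
  next_spec : ∀ a q, (QuotientGroup.mk (next a q).1 :
    FundamentalGroup X base ⧸ monodromyKernel cov fin base) =
      QuotientGroup.mk (transfer cov path a q.1)

/-- The iterated monodromy automaton `Π(X)`: its alphabet is `f^{-1}(x)`, its set of states is `Q`,
and `σ(a,q)` is the end of the lift of `q` starting at `a`. -/
noncomputable def MonodromyData.automaton {cov : IsCoveringMap f}
    {fin : ∀ x, (f ⁻¹' {x}).Finite} (D : MonodromyData cov fin) :
    Automaton (f ⁻¹' {D.base}) D.states where
  out a q := cov.monodromy q.1.toPath a
  next := D.next

end Monodromy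

end AutLim

set_option linter.unusedSectionVars false

namespace AutLim

open scoped Pointwise

/-! ### Sections of the elements of the group of an automaton -/

/-! Write G for the group of the automaton. The proof rests on one covering of the realization |L|
of the limit space. For an arrow (α, φ), the section `hol` of the last entry of φ at the last letter
of α is a locally constant cocycle with values in G. The skew product of L with G defined by it
(`frames`) realizes to a covering of |L|, the frame space, on which G acts freely on the right and
transitively on fibres. Appending a letter a by (α, g) ↦ (α g(a), τ(a,g)) defines a self-map `extend
a` of the frame space, and the points obtained from a frame e over x by appending words project to
the iterated preimages of x under the shift. So e identifies the tree of preimages with A^*, and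
translating e by g changes the identification by g (`extend_translate`,
`frameProj_extendWord_translate`). Hence a loop acts on the preimages as its holonomy in G acts on
words, and since G acts faithfully on words, K is the kernel of the holonomy
(`mem_monodromyKernel_iff`).

Smoothness makes the frame space path connected, so |L| is path connected and the holonomy maps π₁
onto G. Two sequences are joined without holonomy as follows (`ChainSystem.joined`): strong
connectedness gives a chain of arrows of trivial holonomy leading from one last letter to the other;
each gap of the chain is a pair of sequences with a common last letter, and is filled by the same
construction with that letter removed. The resulting self-similar path is parametrized by expansions
of reals. Surjectivity of τ makes every state the holonomy of an arrow, which joins the different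
sheets.

If the lift of ℓ_a from e ends at the translate of `extend a e` by k(a), and γ has holonomy g, the
loop ℓ_a γ ℓ_b⁻¹ has holonomy k(b)⁻¹ τ(a,g) k(a) with b = g(a) (`holonomy_transfer`). Any monodromy
automaton is thus the recursion of the given automaton twisted by k; the twist is undone by a tree
isomorphism φ whose restrictions are of the form φ ∘ g, and contraction leaves only finitely many of
them (`equivalent_of_twist`, `finite_range_run`). Choosing ℓ with k = 1, and loops whose holonomies
are the states, recovers the automaton itself.

The shift and the frame projection are coverings because both come from discrete fibrations of
groupoids: sheets are separated by which label holds the majority of the weight in an initial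
interval [0, d] (`isCoveringMap_of_sheets`). -/

theorem IsSection.unique {A : Type u} {B : Type v} {g : List A → List B} {v : List A}
    {h h' : List A → List B} (H : IsSection g v h) (H' : IsSection g v h') : h = h' :=
  funext fun w => List.append_cancel_left ((H w).symm.trans (H' w))

namespace Transducer

variable {A : Type u} {Q : Type v}

theorem act_bijective {B : Type w} {M : Transducer A B Q} (hM : M.Invertible) (q : Q) :
    Function.Bijective (M.act q) := by
  constructor
  · intro v
    induction v generalizing q with
    | nil =>
      intro w h
      have := congrArg List.length h
      rw [length_act, length_act] at this
      exact (List.length_eq_zero_iff.1 this.symm).symm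
    | cons a v ih =>
      intro w h
      cases w with
      | nil => simp [act] at h
      | cons b w =>
        simp only [act, List.cons.injEq] at h
        obtain rfl := (hM q).1 h.1
        rw [ih _ h.2]
  · intro w
    induction w generalizing q with
    | nil => exact ⟨[], rfl⟩
    | cons b w ih =>
      obtain ⟨a, rfl⟩ := (hM q).2 b
      obtain ⟨v, rfl⟩ := ih (M.next a q)
      exact ⟨a :: v, rfl⟩

variable {M : Automaton A Q} [hM : Fact M.Invertible]

variable (M) in
/-- The transformation induced by a state, as an element of the group of the automaton. -/
noncomputable def gen (q : Q) : M.group :=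
  ⟨Equiv.ofBijective (M.act q) (act_bijective hM.out q), Subgroup.subset_closure ⟨q, rfl⟩⟩

@[simp] theorem coe_gen (q : Q) : ⇑(M.gen q).1 = M.act q := rfl

theorem gen_injective (h : Function.Injective M.act) : Function.Injective M.gen := fun p q e =>
  h (by rw [← coe_gen, e, coe_gen])

theorem closure_range_gen : Subgroup.closure (Set.range M.gen) = ⊤ := by
  have : {g : Equiv.Perm (List A) | ∃ q, ⇑g = M.act q} = M.group.subtype '' Set.range M.gen := by
    ext g
    constructor
    · rintro ⟨q, hq⟩
      exact ⟨_, ⟨q, rfl⟩, DFunLike.coe_injective hq.symm⟩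
    · rintro ⟨_, ⟨q, rfl⟩, rfl⟩
      exact ⟨q, rfl⟩
  apply Subgroup.map_injective M.group.subtype_injective
  rw [MonoidHom.map_closure, ← this, ← MonoidHom.range_eq_map, Subgroup.range_subtype]
  rfl

theorem apply_nil (g : M.group) : g.1 [] = [] :=
  List.length_eq_zero_iff.1 (length_of_mem_group g.2 [])

theorem exists_isSection (g : M.group) (a : A) : ∃ h : M.group, IsSection g.1 [a] h.1 := by
  obtain ⟨g, hg⟩ := g
  induction hg using Subgroup.closure_induction generalizing a with
  | mem g h =>
    obtain ⟨q, hq⟩ := h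
    refine ⟨M.gen (M.next a q), fun w => ?_⟩
    simp only [hq]
    rfl
  | one => exact ⟨1, fun w => rfl⟩
  | mul g h hg hh ihg ihh =>
    obtain ⟨h', H⟩ := ihh a
    obtain ⟨g', G⟩ := ihg (letter h a)
    refine ⟨g' * h', isSection_mul H ?_⟩
    rw [apply_singleton hh]
    exact G
  | inv g hg ih =>
    obtain ⟨h, H⟩ := ih (letter g⁻¹ a)
    have := isSection_inv H
    rw [← apply_singleton (M.group.inv_mem hg)] at this
    refine ⟨h⁻¹, ?_⟩
    rw [← Equiv.Perm.mul_apply, mul_inv_cancel] at this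
    exact this

/-- The section `τ(a, g)` of an element of the group at a letter. -/
noncomputable def sec (g : M.group) (a : A) : M.group :=
  Classical.epsilon fun h : M.group => IsSection g.1 [a] h.1

theorem isSection_sec (g : M.group) (a : A) : IsSection g.1 [a] (sec g a).1 :=
  Classical.epsilon_spec (exists_isSection g a)

theorem sec_eq {g h : M.group} {a : A} (H : IsSection g.1 [a] h.1) : sec g a = h :=
  Subtype.ext (DFunLike.coe_injective ((isSection_sec g a).unique H))

theorem apply_cons (g : M.group) (a : A) (w : List A) :
    g.1 (a :: w) = letter g.1 a :: (sec g a).1 w := by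
  have := isSection_sec g a w
  rwa [apply_singleton g.2] at this

@[simp] theorem sec_one (a : A) : sec (1 : M.group) a = 1 := sec_eq fun _ => rfl

theorem letter_mul' (g h : M.group) (a : A) : letter (g * h).1 a = letter g.1 (letter h.1 a) :=
  letter_mul g.2 h.2 a

theorem sec_mul (g h : M.group) (a : A) :
    sec (g * h) a = sec g (letter h.1 a) * sec h a := by
  refine sec_eq (isSection_mul (isSection_sec h a) ?_)
  rw [apply_singleton h.2]
  exact isSection_sec _ _

theorem letter_inv_letter (g : M.group) (a : A) : letter g⁻¹.1 (letter g.1 a) = a := by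
  rw [← letter_mul', inv_mul_cancel]
  rfl

theorem letter_letter_inv (g : M.group) (a : A) : letter g.1 (letter g⁻¹.1 a) = a := by
  rw [← letter_mul', mul_inv_cancel]
  rfl

theorem letter_bijective (g : M.group) : Function.Bijective (letter g.1) :=
  Function.bijective_iff_has_inverse.2 ⟨letter g⁻¹.1, letter_inv_letter g, letter_letter_inv g⟩

@[simp] theorem letter_gen (q : Q) (a : A) : letter (M.gen q).1 a = M.out a q := by
  simp [letter, act]

@[simp] theorem sec_gen (q : Q) (a : A) : sec (M.gen q) a = M.gen (M.next a q) :=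
  sec_eq fun _ => rfl

/-- The section of an element of the group at a word. -/
noncomputable def wsec : M.group → List A → M.group
  | g, [] => g
  | g, a :: w => wsec (sec g a) w

theorem isSection_wsec (g : M.group) (v : List A) : IsSection g.1 v (wsec g v).1 := by
  induction v generalizing g with
  | nil => intro w; rw [apply_nil]; rfl
  | cons a v ih =>
    intro w
    rw [List.cons_append, apply_cons, ih, apply_cons]
    rfl

theorem wsec_append (g : M.group) (v w : List A) : wsec g (v ++ w) = wsec (wsec g v) w := by
  induction v generalizing g with
  | nil => rfl
  | cons a v ih => exact ih _

theorem wsec_mul (g h : M.group) (v : List A) :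
    wsec (g * h) v = wsec g (h.1 v) * wsec h v := by
  induction v generalizing g h with
  | nil => rw [apply_nil]; rfl
  | cons a v ih => rw [wsec, sec_mul, ih, apply_cons]; rfl

theorem wsec_mem {N : Set M.group} (hN : ∀ g ∈ N, ∀ a, sec g a ∈ N) {g : M.group} (hg : g ∈ N)
    (v : List A) : wsec g v ∈ N := by
  induction v generalizing g with
  | nil => exact hg
  | cons a v ih => exact ih (hN _ hg a)

/-! ### Contraction -/

/-- In a contracting automaton the sections of all elements of the group eventually lie in a finite
set that is closed under sections. -/
theorem Contracting.exists_finite_core [Finite A] (hc : M.Contracting) :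
    ∃ N : Set M.group, N.Finite ∧ (∀ g ∈ N, ∀ a, sec g a ∈ N) ∧
      ∀ g, ∃ n, ∀ v : List A, n ≤ v.length → wsec g v ∈ N := by
  obtain ⟨N₀, hfin, hsub, hN⟩ := hc
  let N₁ : Set M.group := {g | g.1 ∈ N₀}
  have hN₁ : N₁.Finite := hfin.preimage Subtype.val_injective.injOn
  have key : ∀ g : M.group, ∃ n : ℕ, 1 ≤ n ∧ ∀ v : List A, v.length = n → wsec g v ∈ N₁ := by
    intro g
    obtain ⟨n, hn, H⟩ := hN g.1 g.2
    refine ⟨n, hn, fun v hv => ?_⟩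
    obtain ⟨h, hh, hs⟩ := H v hv
    have : (wsec g v).1 = h := DFunLike.coe_injective ((isSection_wsec g v).unique hs)
    change (wsec g v).1 ∈ N₀
    rwa [this]
  choose n hn1 hn using key
  -- The sections of elements of N₁ at words too short to lead back to N₁. Since `n g ≥ 1`, a longer
  -- word can be cut after `n g` letters and the rest treated by induction on length.
  let N : Set M.group := ⋃ g ∈ N₁, wsec g '' {v | v.length < n g}
  have hsec : ∀ k (g : M.group), g ∈ N₁ → ∀ v : List A, v.length = k → wsec g v ∈ N := by
    intro k
    induction k using Nat.strong_induction_on with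
    | _ k ih =>
      intro g hg v hv
      by_cases h : v.length < n g
      · exact Set.mem_biUnion hg ⟨v, h, rfl⟩
      · rw [← List.take_append_drop (n g) v, wsec_append]
        refine ih (v.drop (n g)).length ?_ _ (hn g _ ?_) _ rfl
        · have := hn1 g
          simp only [List.length_drop]; omega
        · simp only [List.length_take]; omega
  refine ⟨N, hN₁.biUnion fun g _ => (List.finite_length_lt A _).image _, ?_, fun g => ⟨n g, ?_⟩⟩
  · rintro _ hx a
    obtain ⟨g, hg, v, hv, rfl⟩ := Set.mem_iUnion₂.1 hx
    have : sec (wsec g v) a = wsec g (v ++ [a]) := by rw [wsec_append]; rfl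
    rw [this]
    exact hsec _ g hg _ rfl
  · intro v hv
    rw [← List.take_append_drop (n g) v, wsec_append]
    refine hsec _ _ (hn g _ ?_) _ rfl
    simp only [List.length_take]; omega

/-- A state lies in the nucleus, so it is a section of some element at arbitrarily long words and
falls into the finite core; distinct states give distinct elements of it. -/
theorem Nuclear.finite_states [Finite A] (hn : M.Nuclear) : Finite Q := by
  obtain ⟨hc, hinj, hnuc⟩ := hn
  obtain ⟨N, hfin, hcl, hN⟩ := hc.exists_finite_core
  have : Finite N := hfin
  refine Finite.of_injective (fun q => (⟨M.gen q, ?_⟩ : N)) fun p q h =>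
    gen_injective hinj (congrArg Subtype.val h)
  obtain ⟨g, hg, H⟩ := (hnuc (M.gen q).1).2 ⟨q, rfl⟩
  obtain ⟨n, hn⟩ := hN ⟨g, hg⟩
  obtain ⟨k, hk, v, rfl, hs⟩ := H n
  have : wsec ⟨g, hg⟩ v = M.gen q :=
    Subtype.ext (DFunLike.coe_injective ((isSection_wsec ⟨g, hg⟩ v).unique hs))
  rw [← this]
  exact hn v hk

theorem finite_range_wsec [Finite A] (hc : M.Contracting) (g : M.group) :
    (Set.range (wsec g)).Finite := by
  obtain ⟨N, hfin, -, hN⟩ := hc.exists_finite_core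
  obtain ⟨n, hn⟩ := hN g
  refine (((List.finite_length_lt A n).image (wsec g)).union hfin).subset ?_
  rintro _ ⟨v, rfl⟩
  by_cases h : v.length < n
  · exact .inl ⟨v, h, rfl⟩
  · exact .inr (hn v (not_lt.1 h))

/-- The state reached from `g` by reading a word, when the section of `g` at each letter is
multiplied on the left by the element that `h` attaches to the image of that letter. -/
noncomputable def run (h : A → M.group) : M.group → List A → M.group
  | g, [] => g
  | g, a :: w => run h (h (letter g.1 a) * sec g a) w

theorem run_append (h : A → M.group) (g : M.group) (v w : List A) :
    run h g (v ++ w) = run h (run h g v) w := by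
  induction v generalizing g with
  | nil => rfl
  | cons a v ih => exact ih _

/-- Each letter read contributes one factor from E on the left. The sections of this factor at later
letters stay in E, so the factors pile up to one for each letter. -/
theorem run_eq_mul_wsec {E : Set M.group} {h : A → M.group} (hE : ∀ g ∈ E, ∀ a, sec g a ∈ E)
    (hh : ∀ a, h a ∈ E) (g : M.group) (v : List A) :
    ∃ p ∈ E ^ v.length, run h g v = p * wsec g v := by
  induction v generalizing g with
  | nil => exact ⟨1, by simp, by simp [run, wsec]⟩
  | cons a v ih =>
    obtain ⟨p, hp, e⟩ := ih (h (letter g.1 a) * sec g a)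
    refine ⟨p * wsec (h (letter g.1 a)) ((sec g a).1 v), ?_, ?_⟩
    · rw [List.length_cons, pow_succ]
      exact Set.mul_mem_mul hp (wsec_mem hE (hh _) _)
    · rw [run, e, wsec_mul, mul_assoc]
      rfl

theorem wsec_mem_pow {E : Set M.group} (hE : ∀ g ∈ E, ∀ a, sec g a ∈ E) (n : ℕ) {g : M.group}
    (hg : g ∈ E ^ n) (v : List A) : wsec g v ∈ E ^ n := by
  induction n generalizing g v with
  | zero =>
    rw [pow_zero, Set.mem_one] at hg ⊢
    rw [hg]
    induction v with
    | nil => rfl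
    | cons a v ih => rw [wsec, sec_one, ih]
  | succ n ih =>
    rw [pow_succ] at hg ⊢
    obtain ⟨x, hx, y, hy, rfl⟩ := hg
    rw [wsec_mul]
    exact Set.mul_mem_mul (ih hx _) (wsec_mem hE hy _)

/-- The section of a product is the product of the sections at images of v, which are as long as v,
so each of the n pairs shrinks to a single element of E. -/
theorem wsec_mem_pow_half {E : Set M.group} {m : ℕ}
    (hm : ∀ g ∈ E * E, ∀ v : List A, m ≤ v.length → wsec g v ∈ E) (n : ℕ) {g : M.group}
    (hg : g ∈ (E * E) ^ n) (v : List A) (hv : m ≤ v.length) : wsec g v ∈ E ^ n := by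
  induction n generalizing g v with
  | zero =>
    rw [pow_zero, Set.mem_one] at hg ⊢
    rw [hg]
    clear hv
    induction v with
    | nil => rfl
    | cons a v ih => rw [wsec, sec_one, ih]
  | succ n ih =>
    rw [pow_succ] at hg ⊢
    obtain ⟨x, hx, y, hy, rfl⟩ := hg
    rw [wsec_mul]
    exact Set.mul_mem_mul (ih hx _ (by rwa [length_of_mem_group y.2])) (hm _ hy _ hv)

/-- In a contracting automaton only finitely many states are reached by `run`. -/
theorem finite_range_run [Finite A] (hc : M.Contracting) (h : A → M.group) :
    (Set.range (run h 1)).Finite := by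
  obtain ⟨N, hfin, hcl, hN⟩ := hc.exists_finite_core
  -- A finite set closed under sections that contains the multipliers `h a`. It contains 1 so that
  -- its powers increase.
  let E : Set M.group := {1} ∪ N ∪ ⋃ a, Set.range (wsec (h a))
  have hEfin : E.Finite := ((Set.finite_singleton 1).union hfin).union
    (Set.finite_iUnion fun a => finite_range_wsec hc _)
  have h1 : (1 : M.group) ∈ E := .inl (.inl rfl)
  have hNE : N ⊆ E := fun g hg => .inl (.inr hg)
  have hhE : ∀ a, h a ∈ E := fun a => .inr (Set.mem_iUnion.2 ⟨a, [], rfl⟩)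
  have hE : ∀ g ∈ E, ∀ a, sec g a ∈ E := by
    rintro g ((rfl | hg) | hg) a
    · rw [sec_one]; exact h1
    · exact hNE (hcl g hg a)
    · obtain ⟨b, v, rfl⟩ := Set.mem_iUnion.1 hg
      refine .inr (Set.mem_iUnion.2 ⟨b, v ++ [a], ?_⟩)
      rw [wsec_append]; rfl
  choose n hn using hN
  obtain ⟨m₀, hm₀⟩ := ((hEfin.mul hEfin).image n).bddAbove
  have hm : ∀ g ∈ E * E, ∀ v : List A, m₀ + 1 ≤ v.length → wsec g v ∈ E := fun g hg v hv =>
    hNE (hn g v ((hm₀ ⟨g, hg, rfl⟩).trans (by omega)))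
  set m := m₀ + 1 with hmdef
  -- Equilibrium of growth and contraction: reading m letters halves an element of `E ^ (2 * m)` to
  -- `E ^ m`, while the multipliers contribute another factor from `E ^ m`.
  have block : ∀ k (v : List A), v.length = k * m → run h 1 v ∈ E ^ (2 * m) := by
    intro k
    induction k with
    | zero =>
      intro v hv
      rw [zero_mul, List.length_eq_zero_iff] at hv
      subst hv
      exact Set.one_mem_pow h1
    | succ k ih =>
      intro v hv
      have hl : v.length = k * m + m := by rw [hv, add_mul, one_mul]
      rw [← List.take_append_drop (k * m) v, run_append]
      have := ih (v.take (k * m)) (by simp only [List.length_take]; omega)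
      have hd : (v.drop (k * m)).length = m := by simp only [List.length_drop]; omega
      obtain ⟨p, hp, e⟩ := run_eq_mul_wsec hE hhE (run h 1 (v.take (k * m))) (v.drop (k * m))
      rw [e, two_mul, pow_add]
      rw [pow_mul, pow_two] at this
      rw [hd] at hp
      exact Set.mul_mem_mul hp (wsec_mem_pow_half hm m this _ hd.ge)
  have hpf : ∀ n, (E ^ n).Finite := fun n => by
    induction n with
    | zero => rw [pow_zero]; exact Set.finite_one
    | succ n ih => rw [pow_succ]; exact ih.mul hEfin
  -- The last, incomplete block adds fewer than m factors.
  refine (hpf (m + 2 * m)).subset ?_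
  rintro _ ⟨v, rfl⟩
  have hdm := Nat.div_add_mod v.length m
  have hlt := Nat.mod_lt v.length (show 0 < m by omega)
  have hle : v.length / m * m ≤ v.length := Nat.div_mul_le_self _ _
  rw [← List.take_append_drop (v.length / m * m) v, run_append]
  have := block (v.length / m) (v.take (v.length / m * m)) (by
    simp only [List.length_take]; omega)
  obtain ⟨p, hp, e⟩ := run_eq_mul_wsec hE hhE (run h 1 (v.take (v.length / m * m)))
    (v.drop (v.length / m * m))
  rw [e, pow_add]
  refine Set.mul_mem_mul (Set.pow_subset_pow_right h1 ?_ hp) (wsec_mem_pow hE _ this _)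
  simp only [List.length_drop]
  rw [mul_comm] at hdm
  omega

end Transducer

namespace Transducer

/-! ### A criterion for equivalence -/

theorem isSection_act {A B Q : Type*} (F : Transducer A B Q) (q : Q) (v : List A) :
    IsSection (F.act q) v (F.act (v.foldl (fun s a => F.next a s) q)) := by
  intro w
  induction v generalizing q with
  | nil => rfl
  | cons a v ih => simp only [List.cons_append, act, List.foldl_cons, ih]

theorem act_comap {A B Q Q' : Type*} (F : Transducer A B Q) (F' : Transducer A B Q') (e : Q' → Q)
    (ho : ∀ a q, F'.out a q = F.out a (e q)) (hn : ∀ a q, e (F'.next a q) = F.next a (e q)) (q : Q')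
    (w : List A) : F'.act q w = F.act (e q) w := by
  induction w generalizing q with
  | nil => rfl
  | cons a w ih => rw [act, act, ho, ih, hn]

variable {A : Type u} {Q : Type v} {M : Automaton A Q} [hM : Fact M.Invertible]

/-- The transducer with set of states `⟨M⟩`, whose state `g` sends `a` to `β (g a)` and leads to the
product of `h (g a)` with the section of `g`. -/
noncomputable def twist {B : Type*} (β : A ≃ B) (h : A → M.group) : Transducer A B M.group where
  out a g := β (letter g.1 a)
  next a g := h (letter g.1 a) * sec g a

theorem twist_invertible {B : Type*} (β : A ≃ B) (h : A → M.group) :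
    (twist β h).Invertible := fun g => β.bijective.comp (letter_bijective g)

/-- For k = 1 this says that the state g acts as φ ∘ g, where φ is the map of the state 1; so all
restrictions of φ have the form required for equivalence. -/
theorem twist_act_mul {B : Type*} (β : A ≃ B) (h : A → M.group) (k g : M.group) (w : List A) :
    (twist β h).act (k * g) w = (twist β h).act k (g.1 w) := by
  induction w generalizing k g with
  | nil => rw [apply_nil]; rfl
  | cons a w ih =>
    rw [apply_cons, act, act, ← ih]
    simp only [twist, letter_mul', sec_mul, mul_assoc]

theorem foldl_twist {B : Type*} (β : A ≃ B) (h : A → M.group) (g : M.group) (v : List A) :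
    v.foldl (fun s a => (twist β h).next a s) g = run h g v := by
  induction v generalizing g with
  | nil => rfl
  | cons a v ih => exact ih _

/-- In `hnext` the factor `(h a)⁻¹` cancels the multiplier that the twist has inserted at a, leaving
the recursion of the product `H s * g`. With g = 1 this makes φ intertwine `H s` and the state s. -/
theorem act_twist_act {B S : Type*} (D : Automaton B S) (β : A ≃ B) (h : A → M.group)
    (H : S → M.group) (hout : ∀ a s, D.out (β a) s = β (letter (H s).1 a))
    (hnext : ∀ a s, H (D.next (β a) s) = h (letter (H s).1 a) * sec (H s) a * (h a)⁻¹)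
    (s : S) (g : M.group) (w : List A) :
    D.act s ((twist β h).act g w) = (twist β h).act (H s * g) w := by
  induction w generalizing s g with
  | nil => rfl
  | cons a w ih =>
    simp only [act]
    rw [ih]
    simp only [twist, hout, hnext, letter_mul', sec_mul, mul_assoc, inv_mul_cancel_left]

/-- The isomorphism φ is the state 1 of the twist. It conjugates `H s` to the transformation of s,
hence generators to generators; contraction serves only to find φ in a finite automaton. -/
theorem equivalent_of_twist [Finite A] (hc : M.Contracting) {B S : Type*} (D : Automaton B S)
    (β : A ≃ B) (h : A → M.group) (H : S → M.group) (hgen : Subgroup.closure (Set.range H) = ⊤)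
    (hout : ∀ a s, D.out (β a) s = β (letter (H s).1 a))
    (hnext : ∀ a s, H (D.next (β a) s) = h (letter (H s).1 a) * sec (H s) a * (h a)⁻¹) :
    M.Equivalent D := by
  have hbij := act_bijective (twist_invertible β h) 1
  let φ : List A ≃ List B := Equiv.ofBijective _ hbij
  have hφ : ∀ w, φ w = (twist β h).act 1 w := fun w => rfl
  have hDφ : ∀ s w, D.act s (φ w) = φ ((H s).1 w) := fun s w => by
    rw [hφ, hφ, act_twist_act D β h H hout hnext, mul_one, ← twist_act_mul, one_mul]
  refine ⟨hM.out, fun s => ?_, ⟨β⟩, φ, ?_, ?_, ?_⟩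
  · have : (fun b => D.out b s) ∘ β = β ∘ letter (H s).1 := funext fun a => hout a s
    rw [← Function.Bijective.of_comp_iff _ β.bijective, this]
    exact β.bijective.comp (letter_bijective _)
  -- The states of the twist that are reachable from 1 form the finite automaton; they are
  -- renumbered by `Fin n` because the set of states has to live in `Type`.
  · have hfin : Finite (Set.range (run h (1 : M.group))) := finite_range_run hc h
    obtain ⟨n, ⟨e⟩⟩ := Finite.exists_equiv_fin (Set.range (run h (1 : M.group)))
    have hstep : ∀ (g : Set.range (run h (1 : M.group))) a,
        h (letter g.1.1 a) * sec g.1 a ∈ Set.range (run h (1 : M.group)) := by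
      rintro ⟨_, v, rfl⟩ a
      exact ⟨v ++ [a], by rw [run_append]; rfl⟩
    let F : Transducer A B (Fin n) :=
      { out := fun a i => β (letter (e.symm i).1.1 a)
        next := fun a i => e ⟨_, hstep (e.symm i) a⟩ }
    refine ⟨Fin n, inferInstance, F, e ⟨1, [], rfl⟩, fun i => twist_invertible β h _, ?_⟩
    funext w
    rw [act_comap (twist β h) F (fun i => (e.symm i).1) (fun _ _ => rfl)
      (fun a i => by simp [F, twist]), hφ, e.symm_apply_apply]
  · intro v ψ hψ
    refine ⟨(run h 1 v).1, (run h 1 v).2, ?_⟩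
    rw [hψ.unique (isSection_act _ _ v), foldl_twist]
    funext w
    rw [hφ, ← twist_act_mul, one_mul]
  · have h1 : M.group = (Subgroup.closure (Set.range H)).map M.group.subtype := by
      rw [hgen, ← MonoidHom.range_eq_map, Subgroup.range_subtype]
    rw [h1, MonoidHom.map_closure, MonoidHom.map_closure]
    refine congrArg Subgroup.closure ?_
    have key : ∀ s, ⇑(φ.permCongrHom.toMonoidHom (M.group.subtype (H s))) = D.act s := fun s => by
      funext w
      obtain ⟨w, rfl⟩ := φ.surjective w
      rw [hDφ]
      simp [Equiv.permCongrHom]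
    ext g
    constructor
    · rintro ⟨_, ⟨_, ⟨s, rfl⟩, rfl⟩, rfl⟩
      exact ⟨s, key s⟩
    · rintro ⟨s, hs⟩
      exact ⟨_, ⟨_, ⟨s, rfl⟩, rfl⟩, DFunLike.coe_injective ((key s).trans hs.symm)⟩

end Transducer

/-! ### Simplices of a topological groupoid. -/

namespace TopGroupoid

open unitInterval

variable {G H K : TopGroupoid.{u}}

theorem mul_congr {g g' h h' : G.Mor} (hg : g = g') (hh : h = h') (e : G.tgt g = G.src h)
    (e' : G.tgt g' = G.src h') : G.mul g h e = G.mul g' h' e' := by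
  subst hg hh
  rfl

theorem one_mul' (x : G.Obj) (g : G.Mor) (h : G.src g = x) (e : G.tgt (G.one x) = G.src g) :
    G.mul (G.one x) g e = g := by
  subst h
  exact G.one_mul g

theorem mul_one' (x : G.Obj) (g : G.Mor) (h : G.tgt g = x) (e : G.tgt g = G.src (G.one x)) :
    G.mul g (G.one x) e = g := by
  subst h
  exact G.mul_one g

namespace Simplex

theorem continuous_toProd {n : ℕ} : Continuous fun x : G.Simplex n =>
    ((x.vert, fun p => x.edge p.1.1 p.1.2 p.2) :
      (Fin (n + 1) → G.Obj) × ({p : Fin (n + 1) × Fin (n + 1) // p.1 ≤ p.2} → G.Mor)) :=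
  continuous_induced_dom

theorem continuous_vert {n : ℕ} (i : Fin (n + 1)) :
    Continuous fun x : G.Simplex n => x.vert i :=
  (continuous_apply i).comp (continuous_fst.comp continuous_toProd)

theorem continuous_edge {n : ℕ} {i j : Fin (n + 1)} (h : i ≤ j) :
    Continuous fun x : G.Simplex n => x.edge i j h :=
  (continuous_apply (⟨(i, j), h⟩ : {p : Fin (n + 1) × Fin (n + 1) // p.1 ≤ p.2})).comp
    (continuous_snd.comp continuous_toProd)

theorem continuous_iff {X : Type*} [TopologicalSpace X] {n : ℕ} {f : X → G.Simplex n} :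
    Continuous f ↔ (∀ i, Continuous fun x => (f x).vert i) ∧
      ∀ i j h, Continuous fun x => (f x).edge i j h := by
  constructor
  · exact fun h => ⟨fun i => (continuous_vert i).comp h, fun i j hij => (continuous_edge hij).comp h⟩
  · rintro ⟨h1, h2⟩
    exact continuous_induced_rng.2
      ((continuous_pi h1).prodMk (continuous_pi fun p => h2 p.1.1 p.1.2 p.2))

theorem continuous_map (F : Hom G H) (n : ℕ) :
    Continuous fun x : G.Simplex n => x.map F :=
  continuous_iff.2 ⟨fun i => F.continuous_obj.comp (continuous_vert i),
    fun _ _ h => F.continuous_mor.comp (continuous_edge h)⟩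

/-- The degenerate simplex all of whose vertices are the object `x`. -/
def const (x : G.Obj) (n : ℕ) : G.Simplex n where
  vert _ := x
  edge _ _ _ := G.one x
  src_edge _ _ _ := G.src_one x
  tgt_edge _ _ _ := G.tgt_one x
  edge_self _ := rfl
  edge_mul _ _ _ _ _ := one_mul' x _ (G.src_one x) _

/-- An arrow, as a one-dimensional simplex. -/
def ofMor (g : G.Mor) : G.Simplex 1 where
  vert i := if i = 0 then G.src g else G.tgt g
  edge i j _ := if j = 0 then G.one (G.src g) else if i = 0 then g else G.one (G.tgt g)
  src_edge i j h := by
    fin_cases i <;> fin_cases j <;> simp_all [G.src_one]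
  tgt_edge i j h := by
    fin_cases i <;> fin_cases j <;> simp_all [G.tgt_one]
  edge_self i := by
    fin_cases i <;> rfl
  edge_mul i j k h h' := by
    fin_cases k
    · obtain rfl : j = 0 := Fin.le_zero_iff.1 h'
      obtain rfl : i = 0 := Fin.le_zero_iff.1 h
      exact one_mul' _ _ (G.src_one _) _
    · fin_cases j
      · obtain rfl : i = 0 := Fin.le_zero_iff.1 h
        exact one_mul' _ _ rfl _
      · fin_cases i
        · exact mul_one' _ _ rfl _
        · exact one_mul' _ _ (G.src_one _) _

theorem continuous_ofMor : Continuous (ofMor : G.Mor → G.Simplex 1) := by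
  refine continuous_iff.2 ⟨fun i => ?_, fun i j h => ?_⟩
  · fin_cases i
    · exact G.continuous_src
    · exact G.continuous_tgt
  · fin_cases j
    · exact G.continuous_one.comp G.continuous_src
    · fin_cases i
      · exact continuous_id
      · exact G.continuous_one.comp G.continuous_tgt

theorem map_ofMor (F : Hom G H) (g : G.Mor) : (ofMor g).map F = ofMor (F.mor g) := by
  refine Simplex.ext (funext fun i => ?_) (funext fun i => funext fun j => funext fun h => ?_)
  · fin_cases i
    · exact (F.src_mor g).symm
    · exact (F.tgt_mor g).symm
  · fin_cases j
    · exact (F.map_one _).trans (congrArg H.one (F.src_mor g).symm)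
    · fin_cases i
      · rfl
      · exact (F.map_one _).trans (congrArg H.one (F.tgt_mor g).symm)

theorem ofMor_one (x : G.Obj) : ofMor (G.one x) = const x 1 := by
  refine Simplex.ext (funext fun i => ?_) (funext fun i => funext fun j => funext fun h => ?_)
  · fin_cases i
    · exact G.src_one x
    · exact G.tgt_one x
  · fin_cases j
    · exact congrArg G.one (G.src_one x)
    · fin_cases i
      · rfl
      · exact congrArg G.one (G.tgt_one x)

end Simplex

/-! ### Points of the realization -/

/-- The point of the realization given by a simplex and barycentric coordinates. -/
def Realization.point (c : G.Cells) : G.Realization := Quot.mk _ c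

namespace Realization

theorem isQuotientMap_point : Topology.IsQuotientMap (point : G.Cells → G.Realization) :=
  isQuotientMap_quot_mk

theorem continuous_point : Continuous (point : G.Cells → G.Realization) := isQuotientMap_point.continuous

theorem continuous_point_fiber (n : ℕ) :
    Continuous fun p : G.Simplex n × stdSimplex ℝ (Fin (n + 1)) => point ⟨n, p⟩ :=
  continuous_point.comp continuous_sigmaMk

theorem exists_point (z : G.Realization) : ∃ c, point c = z := isQuotientMap_point.surjective z

theorem point_pull {m n : ℕ} (θ : Fin (m + 1) →o Fin (n + 1)) (x : G.Simplex n)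
    (t : stdSimplex ℝ (Fin (m + 1))) :
    point ⟨m, x.pull θ, t⟩ = point ⟨n, x, stdSimplex.map θ t⟩ :=
  Quot.sound (Glue.intro θ x t)

/-- The point of the realization defined by an object. -/
def vertex (x : G.Obj) : G.Realization := point ⟨0, Simplex.const x 0, stdSimplex.vertex 0⟩

theorem point_const (x : G.Obj) (n : ℕ) (t : stdSimplex ℝ (Fin (n + 1))) :
    point ⟨n, Simplex.const x n, t⟩ = vertex x := by
  refine (point_pull ⟨fun _ => 0, fun _ _ _ => le_rfl⟩ (Simplex.const x 0) t).trans ?_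
  exact congrArg (fun s => point ⟨0, Simplex.const x 0, s⟩) (Subsingleton.elim _ _)

theorem point_vertex {n : ℕ} (x : G.Simplex n) (i : Fin (n + 1)) :
    point ⟨n, x, stdSimplex.vertex i⟩ = vertex (x.vert i) := by
  let θ : Fin (0 + 1) →o Fin (n + 1) := ⟨fun _ => i, fun _ _ _ => le_rfl⟩
  have h := point_pull θ x (stdSimplex.vertex 0)
  rw [stdSimplex.map_vertex] at h
  refine h.symm.trans (congrArg (fun y => point ⟨0, y, stdSimplex.vertex 0⟩) ?_)
  exact Simplex.ext rfl (funext fun _ => funext fun _ => funext fun _ => x.edge_self i)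

/-- The point with coordinate `s` on the edge given by an arrow. -/
noncomputable def edge (p : G.Mor × I) : G.Realization :=
  point ⟨1, Simplex.ofMor p.1, stdSimplexHomeomorphUnitInterval.symm p.2⟩

theorem continuous_edge : Continuous (edge : G.Mor × I → G.Realization) := by
  exact (continuous_point_fiber 1).comp ((Simplex.continuous_ofMor.comp continuous_fst).prodMk
    (stdSimplexHomeomorphUnitInterval.symm.continuous.comp continuous_snd))

theorem edge_one (x : G.Obj) (s : I) : edge (G.one x, s) = vertex x := by
  rw [edge, Simplex.ofMor_one, point_const]

theorem edge_left (g : G.Mor) : edge (g, 0) = vertex (G.src g) := by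
  have : stdSimplexHomeomorphUnitInterval.symm 0 = stdSimplex.vertex (S := ℝ) 0 := by
    rw [Homeomorph.symm_apply_eq]
    exact stdSimplexHomeomorphUnitInterval_zero.symm
  rw [edge, this]
  exact point_vertex _ _

theorem edge_right (g : G.Mor) : edge (g, 1) = vertex (G.tgt g) := by
  have : stdSimplexHomeomorphUnitInterval.symm 1 = stdSimplex.vertex (S := ℝ) 1 := by
    rw [Homeomorph.symm_apply_eq]
    exact stdSimplexHomeomorphUnitInterval_one.symm
  rw [edge, this]
  exact point_vertex _ _

theorem joined_edge (g : G.Mor) : Joined (vertex (G.src g)) (vertex (G.tgt g)) :=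
  ⟨⟨⟨fun s => edge (g, s), continuous_edge.comp (Continuous.prodMk_right g)⟩,
    edge_left g, edge_right g⟩⟩

theorem exists_joined_vertex (z : G.Realization) : ∃ x, Joined z (vertex x) := by
  obtain ⟨⟨n, x, t⟩, rfl⟩ := exists_point z
  refine ⟨x.vert 0, ?_⟩
  rw [← point_vertex]
  have h : Continuous fun s : stdSimplex ℝ (Fin (n + 1)) => point ⟨n, x, s⟩ :=
    (continuous_point_fiber n).comp (Continuous.prodMk_right x)
  exact ⟨(PathConnectedSpace.somePath t (stdSimplex.vertex 0)).map h⟩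

/-! ### Induced maps -/

theorem realize_point (F : Hom G H) (c : G.Cells) :
    F.realize (point c) = point ⟨c.1, c.2.1.map F, c.2.2⟩ := rfl

theorem continuous_realize (F : Hom G H) : Continuous F.realize := by
  refine isQuotientMap_point.continuous_iff.2 (continuous_sigma fun n => ?_)
  exact (continuous_point_fiber n).comp
    (((Simplex.continuous_map F n).comp continuous_fst).prodMk continuous_snd)

theorem realize_vertex (F : Hom G H) (x : G.Obj) : F.realize (vertex x) = vertex (F.obj x) := by
  rw [vertex, realize_point]
  refine congrArg (fun y => point ⟨0, y, stdSimplex.vertex 0⟩) (Simplex.ext rfl ?_)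
  exact funext fun _ => funext fun _ => funext fun _ => F.map_one x

theorem realize_edge (F : Hom G H) (g : G.Mor) (s : I) :
    F.realize (edge (g, s)) = edge (F.mor g, s) := by
  rw [edge, realize_point, edge, ← Simplex.map_ofMor]

theorem realize_realize {F : Hom G H} {F' : Hom H K} {F'' : Hom G K}
    (ho : ∀ x, F'.obj (F.obj x) = F''.obj x) (hm : ∀ g, F'.mor (F.mor g) = F''.mor g)
    (z : G.Realization) : F'.realize (F.realize z) = F''.realize z := by
  obtain ⟨c, rfl⟩ := exists_point z
  rw [realize_point, realize_point, realize_point]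
  refine congrArg (fun y => point ⟨c.1, y, c.2.2⟩) (Simplex.ext (funext fun i => ho _) ?_)
  exact funext fun _ => funext fun _ => funext fun _ => hm _

/-! ### Weights -/

/-- The length of the intersection of `[0, d]` with the `j`-th of the consecutive intervals of
lengths `t 0, t 1, …`. -/
noncomputable def overlap (d : ℝ) {n : ℕ} (t : Fin (n + 1) → ℝ) (j : Fin (n + 1)) : ℝ :=
  min (∑ i ∈ Finset.Iic j, t i) d - min (∑ i ∈ Finset.Iio j, t i) d

theorem overlap_nonneg {d : ℝ} {n : ℕ} {t : Fin (n + 1) → ℝ} (ht : ∀ i, 0 ≤ t i)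
    (j : Fin (n + 1)) : 0 ≤ overlap d t j :=
  sub_nonneg.2 (min_le_min_right _ (Finset.sum_le_sum_of_subset_of_nonneg
    (Finset.Iio_subset_Iic_self) fun i _ _ => ht i))

/-- The sum telescopes, because the initial segment up to one index is the segment strictly below
the next. -/
theorem sum_overlap_lower (d : ℝ) {n : ℕ} (t : Fin (n + 1) → ℝ) (s : Finset (Fin (n + 1)))
    (hs : ∀ i j, i ≤ j → j ∈ s → i ∈ s) :
    ∑ j ∈ s, overlap d t j = min (∑ j ∈ s, t j) d - min 0 d := by
  induction s using Finset.induction_on_max with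
  | empty => simp
  | insert a s ha ih =>
    have has : a ∉ s := fun h => lt_irrefl _ (ha a h)
    have h1 : Finset.Iio a = s := by
      ext i
      rw [Finset.mem_Iio]
      refine ⟨fun h => ?_, ha i⟩
      exact (Finset.mem_insert.1 (hs i a h.le (Finset.mem_insert_self _ _))).resolve_left h.ne
    have h2 : Finset.Iic a = insert a s := by rw [← h1, Finset.Iio_insert]
    rw [Finset.sum_insert has, ih, overlap, h2, h1]
    · ring
    · intro i j hij hj
      refine (Finset.mem_insert.1 (hs i j hij (Finset.mem_insert_of_mem hj))).resolve_left ?_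
      exact (hij.trans_lt (ha j hj)).ne

theorem map_apply {m n : ℕ} (θ : Fin (m + 1) → Fin (n + 1)) (t : stdSimplex ℝ (Fin (m + 1)))
    (k : Fin (n + 1)) : stdSimplex.map θ t k = ∑ j with θ j = k, t j := by
  rw [stdSimplex.map_coe, FunOnFinite.linearMap_apply_apply]

/-- As θ is monotone, the indices sent to k are the difference of two initial segments, so their
intervals are consecutive and fill the k-th interval of the image. This compatibility with gluing
lets `weight` descend to the realization. -/
theorem sum_overlap_fiber (d : ℝ) {m n : ℕ} (θ : Fin (m + 1) →o Fin (n + 1))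
    (t : stdSimplex ℝ (Fin (m + 1))) (k : Fin (n + 1)) :
    ∑ j with θ j = k, overlap d t j = overlap d (stdSimplex.map θ t) k := by
  have h1 : ∀ s : Finset (Fin (n + 1)),
      ∑ i ∈ s, stdSimplex.map θ t i = ∑ j with θ j ∈ s, t j := fun s => by
    simp_rw [map_apply]
    rw [← Finset.sum_fiberwise_of_maps_to (s := Finset.univ.filter fun j => θ j ∈ s) (t := s)
      (g := θ) (by simp)]
    refine Finset.sum_congr rfl fun i hi => Finset.sum_congr ?_ fun _ _ => rfl
    ext j
    simp only [Finset.mem_filter, Finset.mem_univ, true_and]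
    exact ⟨fun h => ⟨h ▸ hi, h⟩, fun h => h.2⟩
  have h2 : (Finset.univ.filter fun j => θ j ∈ Finset.Iic k) =
      (Finset.univ.filter fun j => θ j ∈ Finset.Iio k) ∪ (Finset.univ.filter fun j => θ j = k) := by
    ext j
    simp [le_iff_lt_or_eq]
  have h3 : Disjoint (Finset.univ.filter fun j => θ j ∈ Finset.Iio k)
      (Finset.univ.filter fun j => θ j = k) := by
    rw [Finset.disjoint_filter]
    intro j _ hj h
    exact absurd h (Finset.mem_Iio.1 hj).ne
  have h4 := sum_overlap_lower d t (Finset.univ.filter fun j => θ j ∈ Finset.Iic k) (by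
    simp only [Finset.mem_filter, Finset.mem_univ, true_and, Finset.mem_Iic]
    exact fun i j hij hj => (θ.monotone hij).trans hj)
  have h5 := sum_overlap_lower d t (Finset.univ.filter fun j => θ j ∈ Finset.Iio k) (by
    simp only [Finset.mem_filter, Finset.mem_univ, true_and, Finset.mem_Iio]
    exact fun i j hij hj => (θ.monotone hij).trans_lt hj)
  rw [overlap, h1, h1]
  nth_rw 1 [h2] at h4
  rw [Finset.sum_union h3, h5] at h4
  linarith

open Classical in
/-- The total overlap with `[0, d]` of the vertices that lie in `B`. -/
noncomputable def weight (d : ℝ) (B : Set G.Obj) : G.Realization → ℝ :=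
  Quot.lift (fun c => ∑ j, if c.2.1.vert j ∈ B then overlap d c.2.2 j else 0) (by
    rintro _ _ ⟨θ, x, t⟩
    simp only
    rw [← Finset.sum_fiberwise Finset.univ θ]
    refine Finset.sum_congr rfl fun k _ => ?_
    rw [← sum_overlap_fiber]
    by_cases h : x.vert k ∈ B
    · rw [if_pos h]
      refine Finset.sum_congr rfl fun j hj => ?_
      rw [if_pos]
      rw [← (Finset.mem_filter.1 hj).2] at h
      exact h
    · rw [if_neg h]
      refine Finset.sum_eq_zero fun j hj => ?_
      rw [if_neg]
      rw [← (Finset.mem_filter.1 hj).2] at h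
      exact h)

open Classical in
theorem weight_point (d : ℝ) (B : Set G.Obj) (c : G.Cells) :
    weight d B (point c) = ∑ j, if c.2.1.vert j ∈ B then overlap d c.2.2 j else 0 := rfl

theorem continuous_overlap (d : ℝ) {n : ℕ} (j : Fin (n + 1)) :
    Continuous fun t : stdSimplex ℝ (Fin (n + 1)) => overlap d t j := by
  have : ∀ i : Fin (n + 1), Continuous fun t : stdSimplex ℝ (Fin (n + 1)) => t i := fun i =>
    (continuous_apply i).comp continuous_subtype_val
  unfold overlap
  fun_prop

theorem continuous_weight (d : ℝ) {B : Set G.Obj} (hB : IsClopen B) : Continuous (weight d B) := by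
  classical
  refine isQuotientMap_point.continuous_iff.2 (continuous_sigma fun n => ?_)
  change Continuous fun p : G.Simplex n × stdSimplex ℝ (Fin (n + 1)) =>
    ∑ j, if p.1.vert j ∈ B then overlap d p.2 j else 0
  refine continuous_finsetSum _ fun j _ => ?_
  refine continuous_if (fun p hp => ?_) ((continuous_overlap d j).comp continuous_snd).continuousOn
    continuous_const.continuousOn
  have : IsClopen {p : G.Simplex n × stdSimplex ℝ (Fin (n + 1)) | p.1.vert j ∈ B} :=
    hB.preimage ((Simplex.continuous_vert j).comp continuous_fst)
  rw [this.frontier_eq] at hp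
  exact hp.elim

end Realization

end TopGroupoid

namespace TopGroupoid

open Realization

variable {G H : TopGroupoid.{u}}

theorem inv_inv (g : G.Mor) : G.inv (G.inv g) = g := by
  have h1 := G.mul_inv (G.inv g)
  have e1 : G.tgt g = G.src (G.inv g) := (G.src_inv g).symm
  have e2 : G.tgt (G.inv g) = G.src (G.inv (G.inv g)) := (G.src_inv _).symm
  calc G.inv (G.inv g) = G.mul (G.one (G.src g)) (G.inv (G.inv g))
          ((G.tgt_one _).trans ((G.tgt_inv g).symm.trans e2)) :=
        (one_mul' _ _ (by rw [G.src_inv, G.tgt_inv]) _).symm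
    _ = G.mul (G.mul g (G.inv g) e1) (G.inv (G.inv g)) ((G.tgt_mul _ _ _).trans e2) :=
        mul_congr (G.mul_inv g).symm rfl _ _
    _ = G.mul g (G.mul (G.inv g) (G.inv (G.inv g)) e2) (e1.trans (G.src_mul _ _ _).symm) :=
        G.mul_assoc _ _ _ _ _
    _ = G.mul g (G.one (G.tgt g)) (G.src_one _).symm :=
        mul_congr rfl (by rw [h1, G.src_inv]) _ _
    _ = g := G.mul_one g

/-! ### Discrete fibrations of groupoids and coverings of realizations -/

/-- A discrete fibration `F : H → G` of topological groupoids, with trivializations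
`Obj H ≅ Obj G × I` and `Mor H ≅ Mor G × I` (an arrow being labelled by its source), where `I` is a
discrete set of labels. -/
structure Fibration (F : Hom H G) (I : Type v) where
  label : H.Obj → I
  obj : I → G.Obj → H.Obj
  mor : I → G.Mor → H.Mor
  isOpen_label : ∀ i, IsOpen (label ⁻¹' {i})
  continuous_mor : ∀ i, Continuous (mor i)
  F_obj : ∀ i x, F.obj (obj i x) = x
  label_obj : ∀ i x, label (obj i x) = i
  obj_label : ∀ y, obj (label y) (F.obj y) = y
  F_mor : ∀ i g, F.mor (mor i g) = g
  label_mor : ∀ i g, label (H.src (mor i g)) = i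
  mor_label : ∀ k, mor (label (H.src k)) (F.mor k) = k

namespace Fibration

variable {F : Hom H G} {I : Type v} (T : Fibration F I)

theorem obj_ext {y y' : H.Obj} (h : F.obj y = F.obj y') (hl : T.label y = T.label y') : y = y' := by
  rw [← T.obj_label y, h, hl, T.obj_label]

theorem mor_ext {k k' : H.Mor} (h : F.mor k = F.mor k')
    (hl : T.label (H.src k) = T.label (H.src k')) : k = k' := by
  rw [← T.mor_label k, h, hl, T.mor_label]

theorem mor_ext' {k k' : H.Mor} (h : F.mor k = F.mor k')
    (hl : T.label (H.tgt k) = T.label (H.tgt k')) : k = k' := by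
  have h1 : H.inv k = H.inv k' := by
    apply T.mor_ext
    · rw [F.map_inv, F.map_inv, h]
    · rw [H.src_inv, H.src_inv, hl]
  apply T.mor_ext h
  rw [← H.tgt_inv, h1, H.tgt_inv]

theorem isClopen_label (i : I) : IsClopen (T.label ⁻¹' {i}) := by
  refine ⟨⟨?_⟩, T.isOpen_label i⟩
  have : (T.label ⁻¹' {i})ᶜ = ⋃ j ∈ ({i}ᶜ : Set I), T.label ⁻¹' {j} := by
    ext x
    simp
  rw [this]
  exact isOpen_biUnion fun j _ => T.isOpen_label j

/-- The label of the target of the lift starting at the label `i`. -/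
def trans (i : I) (g : G.Mor) : I := T.label (H.tgt (T.mor i g))

theorem trans_one (i : I) (x : G.Obj) : T.trans i (G.one x) = i := by
  have h : T.mor i (G.one x) = H.one (T.obj i x) := by
    apply T.mor_ext
    · rw [T.F_mor, F.map_one, T.F_obj]
    · rw [T.label_mor, H.src_one, T.label_obj]
  rw [trans, h, H.tgt_one, T.label_obj]

/-- An arrow upstairs is determined by its image and the label of either end, so the label of one
vertex propagates along the edges to all the others. -/
theorem simplex_ext {n : ℕ} {x y : H.Simplex n} (h : x.map F = y.map F) (j : Fin (n + 1))
    (hl : T.label (x.vert j) = T.label (y.vert j)) : x = y := by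
  have he : ∀ i j h, F.mor (x.edge i j h) = F.mor (y.edge i j h) := fun i j hij => by
    have := congrArg (fun z => Simplex.edge z i j hij) h
    exact this
  have h0 : T.label (x.vert 0) = T.label (y.vert 0) := by
    have := T.mor_ext' (he 0 j (Fin.zero_le j)) (by rw [x.tgt_edge, y.tgt_edge, hl])
    rw [← x.src_edge 0 j (Fin.zero_le j), this, y.src_edge]
  have hv : ∀ i, x.vert i = y.vert i := fun i => by
    have := T.mor_ext (he 0 i (Fin.zero_le i)) (by rw [x.src_edge, y.src_edge, h0])
    rw [← x.tgt_edge 0 i (Fin.zero_le i), this, y.tgt_edge]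
  refine Simplex.ext (funext hv) (funext fun i => funext fun j => funext fun hij => ?_)
  exact T.mor_ext (he i j hij) (by rw [x.src_edge, y.src_edge, hv])

/-- The lift of a simplex whose first vertex has the label `i`. -/
def liftSimplex (i : I) {n : ℕ} (x : G.Simplex n) : H.Simplex n where
  vert j := H.tgt (T.mor i (x.edge 0 j (Fin.zero_le j)))
  edge j k h := T.mor (T.trans i (x.edge 0 j (Fin.zero_le j))) (x.edge j k h)
  src_edge j k h := by
    apply T.obj_ext
    · rw [← F.src_mor, T.F_mor, ← F.tgt_mor, T.F_mor, x.src_edge, x.tgt_edge]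
    · rw [T.label_mor, trans]
  tgt_edge j k h := by
    have hs : H.tgt (T.mor i (x.edge 0 j (Fin.zero_le j))) =
        H.src (T.mor (T.trans i (x.edge 0 j (Fin.zero_le j))) (x.edge j k h)) := by
      apply T.obj_ext
      · rw [← F.src_mor, T.F_mor, ← F.tgt_mor, T.F_mor, x.src_edge, x.tgt_edge]
      · rw [T.label_mor, trans]
    have : H.mul _ _ hs = T.mor i (x.edge 0 k (Fin.zero_le k)) := by
      apply T.mor_ext
      · rw [F.map_mul _ _ hs, T.F_mor i (x.edge 0 k _), ← x.edge_mul 0 j k (Fin.zero_le j) h]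
        exact mul_congr (T.F_mor _ _) (T.F_mor _ _) _ _
      · rw [H.src_mul, T.label_mor, T.label_mor]
    rw [← this, H.tgt_mul]
  edge_self j := by
    apply T.mor_ext
    · rw [T.F_mor, F.map_one, ← F.tgt_mor, T.F_mor, x.tgt_edge, x.edge_self]
    · rw [T.label_mor, H.src_one, trans]
  edge_mul j k l h h' := by
    apply T.mor_ext
    · rw [F.map_mul, T.F_mor _ (x.edge j l _), ← x.edge_mul j k l h h']
      exact mul_congr (T.F_mor _ _) (T.F_mor _ _) _ _
    · rw [H.src_mul, T.label_mor, T.label_mor]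

theorem map_liftSimplex (i : I) {n : ℕ} (x : G.Simplex n) : (T.liftSimplex i x).map F = x := by
  refine Simplex.ext (funext fun j => ?_) (funext fun i => funext fun j => funext fun hij => ?_)
  · change F.obj (H.tgt _) = _
    rw [← F.tgt_mor, T.F_mor, x.tgt_edge]
  · exact T.F_mor _ _

theorem label_liftSimplex_zero (i : I) {n : ℕ} (x : G.Simplex n) :
    T.label ((T.liftSimplex i x).vert 0) = i := by
  change T.trans i (x.edge 0 0 _) = i
  rw [x.edge_self, T.trans_one]

/-- The initial label is found by lifting the inverse of the edge from vertex 0 to vertex j,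
starting at the prescribed label. -/
theorem exists_label_liftSimplex (i : I) {n : ℕ} (x : G.Simplex n) (j : Fin (n + 1)) :
    ∃ i', T.label ((T.liftSimplex i' x).vert j) = i := by
  let k := T.mor i (G.inv (x.edge 0 j (Fin.zero_le j)))
  refine ⟨T.label (H.tgt k), ?_⟩
  change T.label (H.tgt (T.mor _ _)) = i
  have : T.mor (T.label (H.tgt k)) (x.edge 0 j (Fin.zero_le j)) = H.inv k := by
    apply T.mor_ext
    · rw [T.F_mor, F.map_inv, T.F_mor, inv_inv]
    · rw [T.label_mor, H.src_inv]
  rw [this, H.tgt_inv, T.label_mor]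

theorem continuous_liftSimplex (i : I) (n : ℕ) :
    Continuous (T.liftSimplex i : G.Simplex n → H.Simplex n) := by
  have hv : ∀ j, Continuous fun x : G.Simplex n => (T.liftSimplex i x).vert j := fun j =>
    H.continuous_tgt.comp ((T.continuous_mor i).comp (Simplex.continuous_edge (Fin.zero_le j)))
  refine Simplex.continuous_iff.2 ⟨hv, fun j k h => ?_⟩
  refine continuous_iff_continuousAt.2 fun x₀ => ?_
  -- The label of the j-th vertex of the lift is locally constant, so near x₀ this edge is lifted by
  -- one fixed continuous section.
  have hev : ∀ᶠ x in nhds x₀, (T.liftSimplex i x).edge j k h =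
      T.mor (T.label ((T.liftSimplex i x₀).vert j)) (x.edge j k h) := by
    filter_upwards [((T.isOpen_label _).preimage (hv j)).mem_nhds
      (show x₀ ∈ _ from (rfl : T.label ((T.liftSimplex i x₀).vert j) = _))] with x hx
    have hx' : T.label ((T.liftSimplex i x).vert j) = _ := hx
    rw [← hx']
    rfl
  exact ContinuousAt.congr
    ((T.continuous_mor _).comp (Simplex.continuous_edge h)).continuousAt
    (hev.mono fun _ h => h.symm)

theorem pull_liftSimplex {m n : ℕ} (θ : Fin (m + 1) →o Fin (n + 1)) (i : I) (x : G.Simplex n) :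
    (T.liftSimplex i x).pull θ =
      T.liftSimplex (T.label ((T.liftSimplex i x).vert (θ 0))) (x.pull θ) := by
  apply T.simplex_ext _ 0
  · rw [T.label_liftSimplex_zero]
    rfl
  · rw [T.map_liftSimplex]
    exact congrArg (Simplex.pull θ) (T.map_liftSimplex i x)

/-! #### The fibres -/

/-- The fibre of the map of realizations. -/
def fiber : G.Realization → Set H.Realization :=
  Quot.lift (fun c => Set.range fun i => point ⟨c.1, T.liftSimplex i c.2.1, c.2.2⟩) (by
    rintro _ _ ⟨θ, x, t⟩
    simp only
    ext z
    constructor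
    · rintro ⟨i, rfl⟩
      obtain ⟨i', rfl⟩ := T.exists_label_liftSimplex i x (θ 0)
      refine ⟨i', ?_⟩
      beta_reduce
      rw [← pull_liftSimplex, point_pull]
    · rintro ⟨i, rfl⟩
      refine ⟨T.label ((T.liftSimplex i x).vert (θ 0)), ?_⟩
      beta_reduce
      rw [← point_pull, pull_liftSimplex])

/-- The set of lifts of a cell is unchanged by gluing, so it is attached to the point of the
realization. This determines the fibre without a normal form for points. -/
theorem mem_fiber (z : H.Realization) (y : G.Realization) :
    z ∈ T.fiber y ↔ F.realize z = y := by
  constructor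
  · obtain ⟨c, rfl⟩ := exists_point y
    rintro ⟨i, rfl⟩
    rw [realize_point, T.map_liftSimplex]
  · rintro rfl
    obtain ⟨c, rfl⟩ := exists_point z
    refine ⟨T.label (c.2.1.vert 0), ?_⟩
    refine congrArg (fun x => point ⟨c.1, x, c.2.2⟩) (T.simplex_ext ?_ 0 ?_)
    · rw [T.map_liftSimplex]
    · rw [T.label_liftSimplex_zero]

theorem realize_eq_point_iff (z : H.Realization) (c : G.Cells) :
    F.realize z = point c ↔ ∃ i, point ⟨c.1, T.liftSimplex i c.2.1, c.2.2⟩ = z :=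
  (T.mem_fiber z (point c)).symm

theorem realize_surjective [Nonempty I] (T : Fibration F I) : Function.Surjective F.realize := fun y => by
  obtain ⟨c, rfl⟩ := exists_point y
  exact ⟨_, (T.realize_eq_point_iff _ c).2 ⟨Classical.arbitrary I, rfl⟩⟩

/-- A cell lies over the image of V exactly when one of its lifts lies in V, and lifting cells with
a given initial label is continuous. -/
theorem isOpenMap_realize (T : Fibration F I) : IsOpenMap F.realize := by
  intro V hV
  rw [← isQuotientMap_point.isOpen_preimage]
  have : point ⁻¹' (F.realize '' V) =
      ⋃ i, (fun c : G.Cells => point ⟨c.1, T.liftSimplex i c.2.1, c.2.2⟩) ⁻¹' V := by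
    ext c
    rw [Set.mem_iUnion]
    constructor
    · rintro ⟨z, hz, h⟩
      obtain ⟨i, rfl⟩ := (T.realize_eq_point_iff z c).1 h
      exact ⟨i, hz⟩
    · rintro ⟨i, hi⟩
      exact ⟨_, hi, (T.realize_eq_point_iff _ c).2 ⟨i, rfl⟩⟩
  rw [this]
  refine isOpen_iUnion fun i => hV.preimage (continuous_sigma fun n => ?_)
  exact (continuous_point_fiber n).comp
    (((T.continuous_liftSimplex i n).comp continuous_fst).prodMk continuous_snd)

/-! #### The sheets -/

/-- The points for which the vertices labelled `i` make up more than half of `[0, d]`. -/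
def sheet (d : ℝ) (i : I) : Set H.Realization := {z | d / 2 < weight d (T.label ⁻¹' {i}) z}

theorem isOpen_sheet (d : ℝ) (i : I) : IsOpen (T.sheet d i) :=
  isOpen_lt continuous_const (continuous_weight d (T.isClopen_label i))

theorem sum_overlap_le {d : ℝ} (hd : 0 < d) {n : ℕ} (t : Fin (n + 1) → ℝ) :
    ∑ j, overlap d t j ≤ d := by
  rw [sum_overlap_lower d t Finset.univ (by simp), min_eq_left hd.le, sub_zero]
  exact min_le_right _ _

/-- If two sets of indices both carry more than half of the weight, they intersect. -/
theorem exists_common {d : ℝ} (hd : 0 < d) {n : ℕ} {t : Fin (n + 1) → ℝ} (ht : ∀ i, 0 ≤ t i)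
    {p q : Fin (n + 1) → Prop} [DecidablePred p] [DecidablePred q]
    (hp : d / 2 < ∑ j, if p j then overlap d t j else 0)
    (hq : d / 2 < ∑ j, if q j then overlap d t j else 0) : ∃ j, p j ∧ q j := by
  by_contra! h
  have : (∑ j, if p j then overlap d t j else 0) + (∑ j, if q j then overlap d t j else 0) ≤
      ∑ j, overlap d t j := by
    rw [← Finset.sum_add_distrib]
    refine Finset.sum_le_sum fun j _ => ?_
    have h0 := overlap_nonneg (d := d) ht j
    by_cases hj : p j
    · simp [hj, h j hj]
    · by_cases hj' : q j <;> simp [hj, hj', h0]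
  linarith [sum_overlap_le hd t]

theorem sheet_disjoint {d : ℝ} (hd : 0 < d) {i i' : I} {z : H.Realization} (h : z ∈ T.sheet d i)
    (h' : z ∈ T.sheet d i') : i = i' := by
  classical
  obtain ⟨c, rfl⟩ := exists_point z
  rw [sheet, Set.mem_ofPred_eq, weight_point] at h h'
  obtain ⟨j, hj, hj'⟩ := exists_common hd (stdSimplex.zero_le c.2.2) h h'
  exact hj.symm.trans hj'

/-- Two points with the same image are lifts of one cell. Both majorities are taken with the same
weights, so some vertex has the label i in both lifts, and the lifts agree by `simplex_ext`. -/
theorem sheet_injOn {d : ℝ} (hd : 0 < d) (i : I) : Set.InjOn F.realize (T.sheet d i) := by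
  classical
  intro z hz z' hz' h
  obtain ⟨c, hc⟩ := exists_point (F.realize z)
  obtain ⟨k, rfl⟩ := (T.realize_eq_point_iff z c).1 hc.symm
  obtain ⟨k', rfl⟩ := (T.realize_eq_point_iff z' c).1 (h.symm.trans hc.symm)
  rw [sheet, Set.mem_ofPred_eq, weight_point] at hz hz'
  obtain ⟨j, hj, hj'⟩ := exists_common hd (stdSimplex.zero_le c.2.2) hz hz'
  refine congrArg (fun x => point ⟨c.1, x, c.2.2⟩) (T.simplex_ext ?_ j ?_)
  · rw [T.map_liftSimplex, T.map_liftSimplex]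
  · exact (show _ = i from hj).trans (show _ = i from hj').symm

/-- Every point of the base has a scale `d` for which each of the lifts of the point lies in a
sheet, and each sheet contains a lift. -/
theorem exists_scale (c : G.Cells) : ∃ d > 0, ∃ j : Fin (c.1 + 1), ∀ i,
    point ⟨c.1, T.liftSimplex i c.2.1, c.2.2⟩ ∈
      T.sheet d (T.label ((T.liftSimplex i c.2.1).vert j)) := by
  classical
  obtain ⟨n, x, t⟩ := c
  have hne : (Finset.univ.filter fun j => 0 < t j).Nonempty := by
    by_contra h
    rw [Finset.not_nonempty_iff_eq_empty, Finset.filter_eq_empty_iff] at h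
    have := stdSimplex.sum_eq_one t
    rw [Finset.sum_eq_zero fun j hj =>
      le_antisymm (not_lt.1 (h (Finset.mem_univ j))) (stdSimplex.zero_le t j)] at this
    exact zero_ne_one this
  -- Take j to be the first vertex of positive weight and d its weight: then [0, d] is exactly the
  -- interval of j, and in every lift the label of j alone carries the full weight d.
  let j := Finset.min' _ hne
  have hj : 0 < t j := (Finset.mem_filter.1 (Finset.min'_mem _ hne)).2
  have hlt : ∀ i < j, t i = 0 := fun i hi => by
    refine le_antisymm (not_lt.1 fun h => ?_) (stdSimplex.zero_le t i)
    exact (Finset.min'_le _ i (Finset.mem_filter.2 ⟨Finset.mem_univ _, h⟩)).not_gt hi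
  refine ⟨t j, hj, j, fun i => ?_⟩
  rw [sheet, Set.mem_ofPred_eq, weight_point]
  have hov : overlap (t j) t j = t j := by
    have h0 : ∑ i ∈ Finset.Iio j, t i = 0 :=
      Finset.sum_eq_zero fun i hi => hlt i (Finset.mem_Iio.1 hi)
    rw [overlap, ← Finset.Iio_insert, Finset.sum_insert (by simp), h0, add_zero, min_self,
      min_eq_left hj.le, sub_zero]
  have hmem : (T.liftSimplex i x).vert j ∈
      T.label ⁻¹' {T.label ((T.liftSimplex i x).vert j)} := rfl
  calc t j / 2 < t j := half_lt_self hj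
    _ = if (T.liftSimplex i x).vert j ∈
          T.label ⁻¹' {T.label ((T.liftSimplex i x).vert j)} then overlap (t j) t j else 0 := by
        rw [if_pos hmem, hov]
    _ ≤ _ := Finset.single_le_sum (f := fun k => if (T.liftSimplex i x).vert k ∈
          T.label ⁻¹' {T.label ((T.liftSimplex i x).vert j)} then overlap (t j) t k else 0)
          (fun k _ => by
            split_ifs
            · exact overlap_nonneg (stdSimplex.zero_le t) k
            · exact le_rfl) (Finset.mem_univ j)

/-- If two lifts define the same point, that point lies in the sheets of both labels at the vertex
j; the labels agree, hence so do the lifts. -/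
theorem point_liftSimplex_injective (c : G.Cells) :
    Function.Injective fun i => point ⟨c.1, T.liftSimplex i c.2.1, c.2.2⟩ := by
  intro i i' h
  obtain ⟨d, hd, j, H⟩ := T.exists_scale c
  have h' : point ⟨c.1, T.liftSimplex i c.2.1, c.2.2⟩ = point ⟨c.1, T.liftSimplex i' c.2.1, c.2.2⟩ := h
  have h1 := H i
  rw [h'] at h1
  have h2 := T.sheet_disjoint hd h1 (H i')
  have h3 := T.simplex_ext ((T.map_liftSimplex i c.2.1).trans (T.map_liftSimplex i' c.2.1).symm) j h2
  rw [← T.label_liftSimplex_zero i c.2.1, h3, T.label_liftSimplex_zero]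

/-- The fibre over a point of the realization is in bijection with the set of labels. -/
noncomputable def fiberEquiv (c : G.Cells) : I ≃ F.realize ⁻¹' {point c} :=
  Equiv.ofBijective
    (fun i => ⟨point ⟨c.1, T.liftSimplex i c.2.1, c.2.2⟩, (T.realize_eq_point_iff _ c).2 ⟨i, rfl⟩⟩)
    ⟨fun _ _ h => T.point_liftSimplex_injective c (congrArg Subtype.val h), fun ⟨z, hz⟩ => by
      obtain ⟨i, hi⟩ := (T.realize_eq_point_iff z c).1 hz
      exact ⟨i, Subtype.ext hi⟩⟩

/-- Over the set U of points met by every sheet, a point is determined by its image and the label of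
its sheet, and this trivializes the map. For infinitely many labels U need not be open for general
reasons, hence the two hypotheses; they are checked separately for finite label sets and for skew
products. -/
theorem isCoveringMap_of_sheets
    (hopen : ∀ d > 0, IsOpen (⋂ i, F.realize '' T.sheet d i))
    (hcover : ∀ d > 0, ∀ z, F.realize z ∈ ⋂ i, F.realize '' T.sheet d i → ∃ i, z ∈ T.sheet d i) :
    IsCoveringMap F.realize := by
  intro y
  obtain ⟨c, rfl⟩ := exists_point y
  obtain ⟨d, hd, j, hj⟩ := T.exists_scale c
  let U := ⋂ i, F.realize '' T.sheet d i
  have hyU : point c ∈ U := Set.mem_iInter.2 fun i => by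
    obtain ⟨i', rfl⟩ := T.exists_label_liftSimplex i c.2.1 j
    exact ⟨_, hj i', (T.realize_eq_point_iff _ c).2 ⟨i', rfl⟩⟩
  let _ : TopologicalSpace I := ⊥
  have : DiscreteTopology I := ⟨rfl⟩
  have hcont := continuous_realize F
  choose lab hlab using fun z : F.realize ⁻¹' U => hcover d hd z.1 z.2
  let f : F.realize ⁻¹' U → U × I := fun z => (⟨F.realize z.1, z.2⟩, lab z)
  have hlabc : Continuous lab := by
    refine (IsLocallyConstant.iff_isOpen_fiber.2 fun i => ?_).continuous
    have : lab ⁻¹' {i} = Subtype.val ⁻¹' T.sheet d i := by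
      ext z
      exact ⟨fun h => h ▸ hlab z, fun h => T.sheet_disjoint hd (hlab z) h⟩
    rw [this]
    exact (T.isOpen_sheet d i).preimage continuous_subtype_val
  have hfc : Continuous f :=
    ((hcont.comp continuous_subtype_val).subtype_mk _).prodMk hlabc
  have hfi : Function.Injective f := fun z z' h => by
    have h1 : F.realize z.1 = F.realize z'.1 := congrArg (fun p => p.1.1) h
    have h2 : lab z = lab z' := congrArg Prod.snd h
    exact Subtype.ext (T.sheet_injOn hd _ (hlab z) (h2 ▸ hlab z') h1)
  have hfs : Function.Surjective f := fun ⟨⟨y, hy⟩, i⟩ => by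
    obtain ⟨z, hz, rfl⟩ := Set.mem_iInter.1 hy i
    exact ⟨⟨z, hy⟩, Prod.ext rfl (T.sheet_disjoint hd (hlab ⟨z, hy⟩) hz)⟩
  have hfo : IsOpenMap f := by
    intro V hV
    obtain ⟨V', hV', rfl⟩ := isOpen_induced_iff.1 hV
    have : f '' (Subtype.val ⁻¹' V') =
        ⋃ i, (Subtype.val ⁻¹' (F.realize '' (V' ∩ T.sheet d i))) ×ˢ {i} := by
      ext ⟨y, i⟩
      rw [Set.mem_iUnion]
      constructor
      · rintro ⟨z, hz, h⟩
        obtain ⟨rfl, rfl⟩ := Prod.ext_iff.1 h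
        exact ⟨lab z, ⟨z.1, ⟨hz, hlab z⟩, rfl⟩, rfl⟩
      · rintro ⟨i', ⟨z, ⟨hz, hzi⟩, hzy⟩, rfl⟩
        have hzU : F.realize z ∈ U := hzy ▸ y.2
        exact ⟨⟨z, hzU⟩, hz, Prod.ext (Subtype.ext hzy) (T.sheet_disjoint hd (hlab ⟨z, hzU⟩) hzi)⟩
    rw [this]
    exact isOpen_iUnion fun i => ((T.isOpenMap_realize _ (hV'.inter (T.isOpen_sheet d i))).preimage
      continuous_subtype_val).prod (isOpen_discrete _)
  exact IsEvenlyCovered.to_isEvenlyCovered_preimage (I := I)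
    ⟨inferInstance, U, hyU, hopen d hd, (hopen d hd).preimage hcont,
      (Equiv.ofBijective f ⟨hfi, hfs⟩).toHomeomorphOfContinuousOpen hfc hfo, fun _ => rfl⟩

theorem isCoveringMap_of_finite [Finite I] (T : Fibration F I) : IsCoveringMap F.realize := by
  refine T.isCoveringMap_of_sheets
    (fun d _ => isOpen_iInter_of_finite fun i => T.isOpenMap_realize _ (T.isOpen_sheet d i))
    fun d hd z hz => ?_
  obtain ⟨c, hc⟩ := exists_point (F.realize z)
  have h : ∀ i, ∃ k, point ⟨c.1, T.liftSimplex k c.2.1, c.2.2⟩ ∈ T.sheet d i := fun i => by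
    obtain ⟨w, hw, hwz⟩ := Set.mem_iInter.1 hz i
    obtain ⟨k, rfl⟩ := (T.realize_eq_point_iff w c).1 (hwz.trans hc.symm)
    exact ⟨k, hw⟩
  choose k hk using h
  -- Pigeonhole: disjoint sheets pick distinct lifts, and there are as many lifts as sheets, so
  -- every lift is picked.
  have hinj : Function.Injective k := fun i i' h =>
    T.sheet_disjoint hd (hk i) (by rw [h]; exact hk i')
  obtain ⟨l, rfl⟩ := (T.realize_eq_point_iff z c).1 hc.symm
  obtain ⟨i, rfl⟩ := (Finite.injective_iff_surjective.1 hinj) l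
  exact ⟨i, hk i⟩

end Fibration

end TopGroupoid

instance {A : Type u} {Q : Type v} (M : Automaton A Q) : TopologicalSpace M.group := ⊥

instance {A : Type u} {Q : Type v} (M : Automaton A Q) : DiscreteTopology M.group := ⟨rfl⟩

namespace TopGroupoid

open Realization

/-! ### Skew products -/

/-- A locally constant cocycle on a topological groupoid, with values in a group. -/
structure Cocycle (G : TopGroupoid.{u}) (Γ : Type u) [Group Γ] [TopologicalSpace Γ] where
  val : G.Mor → Γ
  continuous_val : Continuous val
  val_mul : ∀ g h e, val (G.mul g h e) = val h * val g

variable {G : TopGroupoid.{u}} {Γ : Type u} [Group Γ] [TopologicalSpace Γ] [DiscreteTopology Γ]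

namespace Cocycle

theorem val_one (c : Cocycle G Γ) (x : G.Obj) : c.val (G.one x) = 1 := by
  have h := c.val_mul (G.one x) (G.one x) ((G.tgt_one x).trans (G.src_one x).symm)
  rw [one_mul' _ _ (G.src_one x)] at h
  exact left_eq_mul.1 h

theorem val_inv (c : Cocycle G Γ) (g : G.Mor) : c.val (G.inv g) = (c.val g)⁻¹ := by
  rw [eq_inv_iff_mul_eq_one, ← c.val_mul g (G.inv g) (G.src_inv g).symm, G.mul_inv, c.val_one]

/-- The skew product of a groupoid and a group: the covering groupoid defined by a cocycle. -/
def skew (c : Cocycle G Γ) : TopGroupoid.{u} where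
  Obj := G.Obj × Γ
  Mor := G.Mor × Γ
  src p := (G.src p.1, p.2)
  tgt p := (G.tgt p.1, c.val p.1 * p.2)
  one p := (G.one p.1, p.2)
  inv p := (G.inv p.1, c.val p.1 * p.2)
  mul p q e := (G.mul p.1 q.1 (congrArg Prod.fst e), p.2)
  src_one p := Prod.ext (G.src_one _) rfl
  tgt_one p := Prod.ext (G.tgt_one _) (by simp [c.val_one])
  src_inv p := Prod.ext (G.src_inv _) rfl
  tgt_inv p := Prod.ext (G.tgt_inv _) (by simp [c.val_inv])
  src_mul p q e := Prod.ext (G.src_mul _ _ _) rfl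
  tgt_mul p q e := Prod.ext (G.tgt_mul _ _ _) (by
    have h : c.val p.1 * p.2 = q.2 := congrArg Prod.snd e
    simp only [c.val_mul, _root_.mul_assoc, h])
  mul_assoc p q r e e' := Prod.ext (G.mul_assoc _ _ _ _ _) rfl
  one_mul p := Prod.ext (G.one_mul _) rfl
  mul_one p := Prod.ext (G.mul_one _) rfl
  mul_inv p := Prod.ext (G.mul_inv _) rfl
  inv_mul p := Prod.ext (G.inv_mul _) rfl
  continuous_src := (G.continuous_src.comp continuous_fst).prodMk continuous_snd
  continuous_tgt := (G.continuous_tgt.comp continuous_fst).prodMk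
    ((continuous_of_discreteTopology (f := fun p : Γ × Γ => p.1 * p.2)).comp
      ((c.continuous_val.comp continuous_fst).prodMk continuous_snd))
  continuous_one := (G.continuous_one.comp continuous_fst).prodMk continuous_snd
  continuous_inv := (G.continuous_inv.comp continuous_fst).prodMk
    ((continuous_of_discreteTopology (f := fun p : Γ × Γ => p.1 * p.2)).comp
      ((c.continuous_val.comp continuous_fst).prodMk continuous_snd))
  continuous_mul := by
    refine Continuous.prodMk ?_
      (continuous_snd.comp (continuous_fst.comp continuous_subtype_val))
    exact G.continuous_mul.comp (f := fun p : {p : (G.Mor × Γ) × (G.Mor × Γ) //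
        ((G.tgt p.1.1, c.val p.1.1 * p.1.2) : G.Obj × Γ) = (G.src p.2.1, p.2.2)} =>
        (⟨(p.1.1.1, p.1.2.1), congrArg Prod.fst p.2⟩ :
          {p : G.Mor × G.Mor // G.tgt p.1 = G.src p.2}))
      (Continuous.subtype_mk
        ((continuous_fst.comp (continuous_fst.comp continuous_subtype_val)).prodMk
          (continuous_fst.comp (continuous_snd.comp continuous_subtype_val))) _)

variable (c : Cocycle G Γ)

/-- The projection of a skew product. -/
def proj : Hom c.skew G where
  obj := Prod.fst
  mor := Prod.fst
  continuous_obj := continuous_fst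
  continuous_mor := continuous_fst
  src_mor _ := rfl
  tgt_mor _ := rfl
  map_one _ := rfl
  map_inv _ := rfl
  map_mul _ _ _ := rfl

/-- The right translation of a skew product. -/
def translate (γ : Γ) : Hom c.skew c.skew where
  obj p := (p.1, p.2 * γ)
  mor p := (p.1, p.2 * γ)
  continuous_obj := continuous_fst.prodMk
    ((continuous_of_discreteTopology (f := fun x : Γ => x * γ)).comp continuous_snd)
  continuous_mor := continuous_fst.prodMk
    ((continuous_of_discreteTopology (f := fun x : Γ => x * γ)).comp continuous_snd)
  src_mor _ := rfl
  tgt_mor _ := Prod.ext rfl (_root_.mul_assoc _ _ _).symm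
  map_one _ := rfl
  map_inv _ := Prod.ext rfl (_root_.mul_assoc _ _ _)
  map_mul _ _ _ := rfl

/-- The projection of a skew product is a discrete fibration. -/
def fibration : Fibration c.proj (Γ) where
  label := Prod.snd
  obj γ x := (x, γ)
  mor γ g := (g, γ)
  isOpen_label i := (isOpen_discrete {i}).preimage continuous_snd
  continuous_mor γ := Continuous.prodMk_left γ
  F_obj _ _ := rfl
  label_obj _ _ := rfl
  obj_label _ := rfl
  F_mor _ _ := rfl
  label_mor _ _ := rfl
  mor_label _ := rfl

theorem proj_translate (γ : Γ) (z : c.skew.Realization) :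
    c.proj.realize ((c.translate γ).realize z) = c.proj.realize z :=
  realize_realize (F'' := c.proj) (fun _ => rfl) (fun _ => rfl) z

theorem translate_mem_sheet (d : ℝ) (γ δ : Γ) {z : c.skew.Realization}
    (hz : z ∈ c.fibration.sheet d γ) :
    (c.translate δ).realize z ∈ c.fibration.sheet d (γ * δ) := by
  classical
  obtain ⟨x, rfl⟩ := exists_point z
  rw [realize_point]
  rw [Fibration.sheet, Set.mem_ofPred_eq, weight_point] at hz ⊢
  refine hz.trans_eq (Finset.sum_congr rfl fun j _ => if_congr ?_ rfl rfl)
  change (x.2.1.vert j).2 = γ ↔ (x.2.1.vert j).2 * δ = γ * δ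
  exact (mul_left_injective δ).eq_iff.symm

theorem translate_point_liftSimplex (γ δ : Γ) (x : G.Cells) :
    (c.translate δ).realize (point ⟨x.1, c.fibration.liftSimplex γ x.2.1, x.2.2⟩) =
      point ⟨x.1, c.fibration.liftSimplex (γ * δ) x.2.1, x.2.2⟩ := by
  rw [realize_point]
  have e : (c.fibration.liftSimplex γ x.2.1).map (c.translate δ) =
      c.fibration.liftSimplex (γ * δ) x.2.1 := by
    apply c.fibration.simplex_ext _ 0
    · rw [c.fibration.label_liftSimplex_zero]
      change c.fibration.label ((c.fibration.liftSimplex γ x.2.1).vert 0) * δ = γ * δ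
      rw [c.fibration.label_liftSimplex_zero]
    · rw [c.fibration.map_liftSimplex]
      exact c.fibration.map_liftSimplex γ x.2.1
  simp only [e]

theorem translate_one (z : c.skew.Realization) : (c.translate 1).realize z = z := by
  obtain ⟨x, hx⟩ := exists_point (c.proj.realize z)
  obtain ⟨γ, rfl⟩ := (c.fibration.realize_eq_point_iff z x).1 hx.symm
  rw [translate_point_liftSimplex, _root_.mul_one]

theorem translate_injective (z : c.skew.Realization) :
    Function.Injective fun γ : Γ => (c.translate γ).realize z := by
  obtain ⟨x, hx⟩ := exists_point (c.proj.realize z)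
  obtain ⟨γ, rfl⟩ := (c.fibration.realize_eq_point_iff z x).1 hx.symm
  intro δ δ' h
  simp only [translate_point_liftSimplex] at h
  exact mul_left_cancel (c.fibration.point_liftSimplex_injective x h)

theorem exists_translate {z w : c.skew.Realization} (h : c.proj.realize z = c.proj.realize w) :
    ∃ γ : Γ, (c.translate γ).realize z = w := by
  obtain ⟨x, hx⟩ := exists_point (c.proj.realize z)
  obtain ⟨γ, rfl⟩ := (c.fibration.realize_eq_point_iff z x).1 hx.symm
  obtain ⟨δ, rfl⟩ := (c.fibration.realize_eq_point_iff w x).1 (h.symm.trans hx.symm)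
  exact ⟨γ⁻¹ * δ, by rw [translate_point_liftSimplex, mul_inv_cancel_left]⟩

/-- The realization of a skew product is a covering of the realization of the base. -/
theorem isCoveringMap_proj : IsCoveringMap c.proj.realize := by
  -- Translations permute the sheets transitively and preserve fibres, so all sheets have the same
  -- image and the infinite intersection is a single open set.
  have key : ∀ d (γ δ : Γ),
      c.proj.realize '' c.fibration.sheet d γ ⊆ c.proj.realize '' c.fibration.sheet d δ := by
    rintro d γ δ _ ⟨z, hz, rfl⟩
    have h := c.translate_mem_sheet d γ (γ⁻¹ * δ) hz
    rw [mul_inv_cancel_left] at h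
    exact ⟨_, h, c.proj_translate _ z⟩
  have hI : ∀ d, ⋂ γ, c.proj.realize '' c.fibration.sheet d γ =
      c.proj.realize '' c.fibration.sheet d 1 := fun d =>
    Set.Subset.antisymm (Set.iInter_subset _ _) (Set.subset_iInter fun γ => key d 1 γ)
  refine c.fibration.isCoveringMap_of_sheets (fun d _ => ?_) fun d hd z hz => ?_
  · rw [hI]
    exact c.fibration.isOpenMap_realize _ (c.fibration.isOpen_sheet d 1)
  · rw [hI] at hz
    obtain ⟨w, hw, hwz⟩ := hz
    obtain ⟨γ, rfl⟩ := c.exists_translate hwz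
    exact ⟨1 * γ, c.translate_mem_sheet d 1 γ hw⟩

end Cocycle

end TopGroupoid

/-! ### The limit space -/

/-- Append a letter to a left-infinite sequence. -/
def LimObj.snoc {A : Type u} (α : LimObj A) (a : A) : LimObj A := fun k => Nat.casesOn k a α

namespace LimMor

open Transducer

variable {A : Type u} {Q : Type v} {M : Automaton A Q}

/-- The section of the last entry of an arrow at the last letter of its source. -/
noncomputable def hol (g : LimMor M) : M.group := sec (g.1.2 0) (g.1.1 0)

theorem continuous_hol : Continuous (hol : LimMor M → M.group) := by
  let _ : TopologicalSpace A := ⊥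
  have : DiscreteTopology A := ⟨rfl⟩
  have h := continuous_iff.1 (continuous_id (X := LimMor M))
  exact (continuous_of_discreteTopology
    (f := fun p : M.group × A => sec p.1 p.2)).comp ((h.2 0).prodMk (h.1 0))

variable [hM : Fact M.Invertible]

theorem hol_mul (g h : LimMor M) (e : g.tgt = h.src) : hol (mul g h e) = hol h * hol g := by
  have e0 : letter (g.1.2 0).1 (g.1.1 0) = h.1.1 0 := congrFun e 0
  change sec (h.1.2 0 * g.1.2 0) (g.1.1 0) = _
  rw [sec_mul, e0]
  rfl

variable (M) in
/-- The cocycle `hol`. -/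
noncomputable def holCocycle : TopGroupoid.Cocycle (limitSpace M) M.group where
  val := hol
  continuous_val := continuous_hol
  val_mul := hol_mul

/-- Append a letter to an arrow. -/
noncomputable def snoc (g : LimMor M) (a : A) : LimMor M :=
  ⟨(g.src.snoc a, fun k => Nat.casesOn k (hol g) g.1.2),
    (g.2.1.insert (hol g)).subset (by
      rintro _ ⟨k, rfl⟩
      cases k with
      | zero => exact .inl rfl
      | succ k => exact .inr ⟨k, rfl⟩), fun k => by
    cases k with
    | zero => exact isSection_sec _ _
    | succ k => exact g.2.2 k⟩

theorem tgt_snoc (g : LimMor M) (a : A) :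
    (g.snoc a).tgt = g.tgt.snoc (letter (hol g).1 a) := by
  funext k
  cases k <;> rfl

theorem hol_shift (g : LimMor M) : hol g.shift = g.1.2 0 := sec_eq (g.2.2 0)

theorem snoc_shift (g : LimMor M) : g.shift.snoc (g.src 0) = g := by
  refine ext (fun k => ?_) fun k => ?_
  · cases k <;> rfl
  · cases k with
    | zero => exact hol_shift g
    | succ k => rfl

theorem snoc_one (α : LimObj A) (a : A) : (one α : LimMor M).snoc a = one (α.snoc a) := by
  refine ext (fun k => rfl) fun k => ?_
  cases k with
  | zero => exact sec_one _
  | succ k => rfl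

theorem snoc_mul (g h : LimMor M) (e : g.tgt = h.src) (a b : A)  (e' : (g.snoc a).tgt = (h.snoc b).src) :
    (g.mul h e).snoc a = (g.snoc a).mul (h.snoc b) e' := by
  refine ext (fun k => ?_) fun k => ?_
  · cases k <;> rfl
  · cases k with
    | zero => exact hol_mul g h e
    | succ k => rfl

theorem hol_one (α : LimObj A) : hol (one α : LimMor M) = 1 := sec_one _

theorem hol_inv (g : LimMor M) : hol g.inv = (hol g)⁻¹ := (holCocycle M).val_inv g

theorem snoc_inv (g : LimMor M) (a : A) :
    g.inv.snoc (letter (hol g).1 a) = (g.snoc a).inv := by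
  refine ext (fun k => ?_) fun k => ?_
  · cases k <;> rfl
  · cases k with
    | zero => exact hol_inv g
    | succ k => rfl

theorem continuous_snoc (a : A) : Continuous fun g : LimMor M => g.snoc a := by
  let _ : TopologicalSpace A := ⊥
  have h := continuous_iff.1 (continuous_id (X := LimMor M))
  refine continuous_iff.2 ⟨fun k => ?_, fun k => ?_⟩
  · cases k with
    | zero => exact continuous_const
    | succ k => exact h.1 k
  · cases k with
    | zero => exact continuous_hol
    | succ k => exact h.2 k

end LimMor

theorem LimObj.continuous_snoc {A : Type u} (a : A) : Continuous fun α : LimObj A => α.snoc a := by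
  let _ : TopologicalSpace A := ⊥
  refine continuous_pi fun k => ?_
  cases k with
  | zero => exact continuous_const
  | succ k => exact continuous_apply (A := fun _ : ℕ => A) k

theorem LimObj.isOpen_last {A : Type u} (a : A) : IsOpen {α : LimObj A | α 0 = a} := by
  let _ : TopologicalSpace A := ⊥
  have : DiscreteTopology A := ⟨rfl⟩
  exact (isOpen_discrete {a}).preimage (continuous_apply (A := fun _ : ℕ => A) 0)

namespace Limit

open TopGroupoid Transducer

variable {A : Type u} {Q : Type v} (M : Automaton A Q) [hM : Fact M.Invertible]

/-- The shift of the limit space is a discrete fibration. -/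
noncomputable def shiftFibration : Fibration (limitShift M) A where
  label (α : LimObj A) := α 0
  obj a (α : LimObj A) := α.snoc a
  mor a g := LimMor.snoc g a
  isOpen_label i := LimObj.isOpen_last i
  continuous_mor a := LimMor.continuous_snoc a
  F_obj _ _ := rfl
  label_obj _ _ := rfl
  obj_label α := by
    funext k
    cases k <;> rfl
  F_mor _ _ := rfl
  label_mor _ _ := rfl
  mor_label g := LimMor.snoc_shift g

theorem isCoveringMap_shift [Finite A] : IsCoveringMap (limitShift M).realize := by
  exact (shiftFibration M).isCoveringMap_of_finite

theorem finite_fiber_shift [Finite A] (x : (limitSpace M).Realization) :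
    ((limitShift M).realize ⁻¹' {x}).Finite := by
  obtain ⟨c, rfl⟩ := Realization.exists_point x
  exact Finite.of_equiv _ ((shiftFibration M).fiberEquiv c)

theorem ncard_fiber_shift (x : (limitSpace M).Realization) :
    ((limitShift M).realize ⁻¹' {x}).ncard = Nat.card A := by
  obtain ⟨c, rfl⟩ := Realization.exists_point x
  exact (Nat.card_congr ((shiftFibration M).fiberEquiv c)).symm

/-- The covering of the limit space by the skew product with the group of the automaton. -/
noncomputable abbrev frames : TopGroupoid.{u} := (LimMor.holCocycle M).skew

variable {M}

/-- The endomorphism of the skew product that appends a letter. -/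
noncomputable def frameSnoc (a : A) : Hom (frames M) (frames M) where
  obj p := (LimObj.snoc p.1 (letter p.2.1 a), sec (M := M) p.2 a)
  mor p := (LimMor.snoc p.1 (letter p.2.1 a), sec (M := M) p.2 a)
  continuous_obj := by
    have h : ∀ g : M.group, Continuous fun α : LimObj A => α.snoc (letter g.1 a) :=
      fun g => LimObj.continuous_snoc _
    exact (continuous_prod_of_discrete_right.2 h).prodMk
      ((continuous_of_discreteTopology (f := fun g : M.group => sec g a)).comp continuous_snd)
  continuous_mor := by
    have h : ∀ g : M.group, Continuous fun α : LimMor M => α.snoc (letter g.1 a) :=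
      fun g => LimMor.continuous_snoc _
    exact (continuous_prod_of_discrete_right.2 h).prodMk
      ((continuous_of_discreteTopology (f := fun g : M.group => sec g a)).comp continuous_snd)
  src_mor p := rfl
  -- For an arrow of holonomy h from (α, g) to (β, hg), the letter g(a) appended at the source is
  -- sent to h(g(a)) = (hg)(a), and the section of h at g(a) times that of g at a is the section of
  -- hg at a.
  tgt_mor p := Prod.ext
    ((LimMor.tgt_snoc _ _).trans (congrArg (LimObj.snoc _) (letter_mul' _ _ _).symm))
    (sec_mul (M := M) _ _ _).symm
  map_one p := Prod.ext (LimMor.snoc_one _ _) rfl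
  map_inv p := Prod.ext
    ((congrArg (LimMor.snoc _) (letter_mul' _ _ _)).trans (LimMor.snoc_inv _ _))
    (sec_mul (M := M) _ _ _)
  map_mul p q e := by
    have h1 : LimMor.tgt p.1 = LimMor.src q.1 := congrArg Prod.fst e
    have h2 : LimMor.hol p.1 * p.2 = q.2 := congrArg Prod.snd e
    refine Prod.ext (LimMor.snoc_mul p.1 q.1 h1 _ _ ?_) rfl
    exact (LimMor.tgt_snoc _ _).trans (congr (congrArg LimObj.snoc h1)
      ((letter_mul' _ _ _).symm.trans (congrArg (fun g : M.group => letter g.1 a) h2)))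

end Limit

end AutLim

/-! ### Expansions of real numbers -/

namespace Real

theorem ofDigits_mul_base {b : ℕ} (e : ℕ → Fin b) :
    ofDigits e * b = (e 0 : ℕ) + ofDigits fun k => e (k + 1) := by
  have hb : (b : ℝ) ≠ 0 := by
    have := Fin.pos (e 0)
    positivity
  rw [ofDigits_eq_sum_add_ofDigits e 1]
  simp only [Finset.sum_range_one, ofDigitsTerm, zero_add, pow_one]
  field_simp

theorem eq_zero_of_ofDigits_eq_zero {b : ℕ} {e : ℕ → Fin b} (h : ofDigits e = 0) (k : ℕ) :
    (e k : ℕ) = 0 := by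
  have hr := ofDigits_mul_base e
  have h1 := ofDigits_nonneg fun k => e (k + 1)
  have h0 : (0 : ℝ) ≤ (e 0 : ℕ) := Nat.cast_nonneg _
  rw [h, zero_mul] at hr
  induction k generalizing e with
  | zero => exact_mod_cast (by linarith : ((e 0 : ℕ) : ℝ) = 0)
  | succ k ih =>
    refine ih (e := fun k => e (k + 1)) (by linarith) ?_ (ofDigits_nonneg _) (Nat.cast_nonneg _)
    rw [← ofDigits_mul_base fun k => e (k + 1)]
    rw [show ofDigits (fun k => e (k + 1)) = 0 by linarith, zero_mul]

theorem eq_last_of_ofDigits_eq_one {b : ℕ} {e : ℕ → Fin b} (h : ofDigits e = 1) (k : ℕ) :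
    (e k : ℕ) + 1 = b := by
  have step : ∀ e : ℕ → Fin b, ofDigits e = 1 →
      (e 0 : ℕ) + 1 = b ∧ ofDigits (fun k => e (k + 1)) = 1 := fun e h => by
    have hr := ofDigits_mul_base e
    have h1 := ofDigits_le_one fun k => e (k + 1)
    have h0 : ((e 0 : ℕ) : ℝ) + 1 ≤ b := by exact_mod_cast (e 0).2
    rw [h, one_mul] at hr
    exact ⟨by exact_mod_cast (by linarith : ((e 0 : ℕ) : ℝ) + 1 = b), by linarith⟩
  induction k generalizing e with
  | zero => exact (step e h).1
  | succ k ih => exact ih (step e h).2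

theorem ofDigits_tail_eq {b : ℕ} {d d' : ℕ → Fin b} (h : ofDigits d = ofDigits d')
    (h0 : d 0 = d' 0) : (ofDigits fun k => d (k + 1)) = ofDigits fun k => d' (k + 1) := by
  have h1 := ofDigits_mul_base d
  have h2 := ofDigits_mul_base d'
  rw [h, h0] at h1
  linarith

/-- The first digits differ by at least 1 and the tails by at most 1, so both differences are 1 and
the tails take the extreme values. -/
theorem digits_of_ofDigits_eq {b : ℕ} {d d' : ℕ → Fin b} (h : ofDigits d = ofDigits d')
    (h0 : d 0 < d' 0) : (d' 0 : ℕ) = d 0 + 1 ∧ (ofDigits fun k => d (k + 1)) = 1 ∧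
      (ofDigits fun k => d' (k + 1)) = 0 := by
  have h1 := ofDigits_mul_base d
  have h2 := ofDigits_mul_base d'
  have h3 := ofDigits_le_one fun k => d (k + 1)
  have h4 := ofDigits_nonneg fun k => d' (k + 1)
  have h5 : ((d 0 : ℕ) : ℝ) + 1 ≤ (d' 0 : ℕ) := by exact_mod_cast h0
  rw [h] at h1
  refine ⟨?_, by linarith, by linarith⟩
  exact_mod_cast (by linarith : ((d' 0 : ℕ) : ℝ) = (d 0 : ℕ) + 1)

end Real

namespace AutLim

/-! ### Paths of trivial holonomy in the frame space. -/

namespace Limit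

open TopGroupoid Transducer Realization unitInterval

variable {A : Type u} {Q : Type v}

section Frames

variable {M : Automaton A Q} [hM : Fact M.Invertible]

/-- The object `(α, g)` of the skew product. -/
def frameObj (α : LimObj A) (g : M.group) : (frames M).Obj := (α, g)

/-- The arrow `(φ, g)` of the skew product. -/
def frameMor (φ : LimMor M) (g : M.group) : (frames M).Mor := (φ, g)

theorem src_frameMor (φ : LimMor M) (g : M.group) :
    (frames M).src (frameMor φ g) = frameObj φ.src g := rfl

theorem tgt_frameMor (φ : LimMor M) (g : M.group) :
    (frames M).tgt (frameMor φ g) = frameObj φ.tgt (LimMor.hol φ * g) := rfl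

theorem frameSnoc_obj (a : A) (α : LimObj A) (g : M.group) :
    (frameSnoc a).obj (frameObj α g) = frameObj (α.snoc (letter g.1 a)) (sec g a) := rfl

theorem frameSnoc_mor (a : A) (φ : LimMor M) (g : M.group) :
    (frameSnoc a).mor (frameMor φ g) = frameMor (φ.snoc (letter g.1 a)) (sec g a) := rfl

end Frames

/-- Chains of `m + 2` arrows of the limit space with trivial holonomy that join the sequences
`e` and `x`, up to the last letters being equal between consecutive arrows. -/
structure ChainSystem (M : Automaton A Q) where
  m : ℕ
  values : Set M.group
  arr : LimObj A × LimObj A → ℕ → LimMor M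
  finite_values : values.Finite
  one_mem : 1 ∈ values
  arr_mem : ∀ p i k, (arr p i).1.2 k ∈ values
  arr_zero : ∀ p, arr p 0 = LimMor.one p.1
  arr_last : ∀ p, arr p (m + 1) = LimMor.one p.2
  hol_arr : ∀ p i, LimMor.hol (arr p i) = 1
  last_eq : ∀ p i, i ≤ m → (arr p i).tgt 0 = (arr p (i + 1)).src 0

/-- Surjectivity of τ provides, for each state, a letter and a state leading to it, so the sequence
of states continues indefinitely to the left; the last letter remains free. -/
theorem exists_limMor {M : Automaton A Q} [hM : Fact M.Invertible] [Finite Q]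
    (hs : Function.Surjective fun p : A × Q => M.next p.1 p.2) (q : Q) (a : A) :
    ∃ g : LimMor M, (∀ k, g.1.2 k ∈ Set.range M.gen) ∧ g.1.1 0 = a ∧ g.1.2 0 = M.gen q := by
  choose f hf using hs
  let s : ℕ → Q := fun k => Nat.rec q (fun _ r => (f r).2) k
  refine ⟨⟨(fun k => Nat.casesOn k a fun k => (f (s k)).1, fun k => M.gen (s k)),
    (Set.finite_range M.gen).subset (by rintro _ ⟨k, rfl⟩; exact ⟨_, rfl⟩), fun k => ?_⟩,
    fun k => ⟨_, rfl⟩, rfl, rfl⟩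
  have := isSection_sec (M.gen (s (k + 1))) (f (s k)).1
  rw [sec_gen] at this
  have h : M.next (f (s k)).1 (s (k + 1)) = s k := hf (s k)
  rwa [h] at this

/-- An edge of the graph on A, given by a state with section ε at a letter, extends to the left to
an arrow of trivial holonomy. A path in the graph thus becomes a chain of arrows in which only the
last letters match. -/
theorem exists_chainSystem {M : Automaton A Q} [hM : Fact M.Invertible] [Finite A] [Finite Q]
    (hinj : Function.Injective M.act) (hs : M.Smooth) : Nonempty (ChainSystem M) := by
  obtain ⟨hsurj, ε, hε, hconn⟩ := hs
  have hgen : M.gen ε = 1 := Subtype.ext (DFunLike.coe_injective hε)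
  have hnext : ∀ a, M.next a ε = ε := fun a => by
    apply gen_injective hinj
    rw [← sec_gen, hgen, sec_one]
  have hout : ∀ a, M.out a ε = a := fun a => by
    rw [← letter_gen, hgen]
    rfl
  -- Every letter has a loop, given by ε itself. Paths can therefore be prolonged to any greater
  -- length, and one m serves all pairs of letters.
  have paths : ∀ a b : A, ∃ n : ℕ, ∀ m ≥ n, ∃ c : ℕ → A, c 0 = a ∧ c m = b ∧
      ∀ i, ∃ q, M.out (c i) q = c (i + 1) ∧ M.next (c i) q = ε := by
    intro a b
    induction hconn a b with
    | refl => exact ⟨0, fun m _ => ⟨fun _ => a, rfl, rfl, fun _ => ⟨ε, hout a, hnext a⟩⟩⟩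
    | @tail b b' _ h ih =>
      obtain ⟨n, hn⟩ := ih
      refine ⟨n + 1, fun m hm => ?_⟩
      obtain ⟨c, h0, h1, h2⟩ := hn (m - 1) (by omega)
      refine ⟨fun i => if i ≤ m - 1 then c i else b', by simp [h0],
        by simp only [show ¬ m ≤ m - 1 by omega, if_false], fun i => ?_⟩
      rcases lt_trichotomy i (m - 1) with hi | rfl | hi
      · simp only [hi.le, show i + 1 ≤ m - 1 by omega, if_true]
        exact h2 i
      · simp only [le_refl, show ¬ m - 1 + 1 ≤ m - 1 by omega, if_true, if_false, h1]
        exact h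
      · simp only [show ¬ i ≤ m - 1 by omega, show ¬ i + 1 ≤ m - 1 by omega, if_false]
        exact ⟨ε, hout _, hnext _⟩
  choose n hn using paths
  obtain ⟨m, hm⟩ := (Set.finite_range fun p : A × A => n p.1 p.2).bddAbove
  choose c hc0 hcm q hcq hcε using fun a b => hn a b m (hm ⟨(a, b), rfl⟩)
  choose g hgm hg0 hgq using exists_limMor (M := M) hsurj
  -- For 1 ≤ i ≤ m the i-th arrow realizes the edge from `c (i - 1)` to `c i`; the positions 0 and m
  -- + 1 hold the identities of the two sequences to be joined.
  refine ⟨⟨m, Set.range M.gen, fun p i =>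
    if i = 0 then LimMor.one p.1 else if i ≤ m then
      g (q (p.1 0) (p.2 0) (i - 1)) (c (p.1 0) (p.2 0) (i - 1)) else LimMor.one p.2,
    Set.finite_range _, ⟨ε, hgen⟩, fun p i k => ?_, fun p => if_pos rfl, fun p => by simp,
    fun p i => ?_, fun p i hi => ?_⟩⟩
  · split_ifs
    · exact ⟨ε, hgen⟩
    · exact hgm _ _ _
    · exact ⟨ε, hgen⟩
  · split_ifs
    · exact LimMor.hol_one _
    · rw [LimMor.hol, hg0, hgq, sec_gen, hcε, hgen]
    · exact LimMor.hol_one _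
  · have h1 : (if i = 0 then LimMor.one p.1 else if i ≤ m then
        g (q (p.1 0) (p.2 0) (i - 1)) (c (p.1 0) (p.2 0) (i - 1)) else LimMor.one p.2).tgt 0 =
        c (p.1 0) (p.2 0) i := by
      rcases i with _ | i
      · rw [hc0]
        rfl
      · rw [if_neg (Nat.succ_ne_zero i), if_pos hi]
        change letter _ _ = _
        rw [hg0, hgq, letter_gen]
        exact hcq _ _ _
    rw [h1, if_neg (Nat.succ_ne_zero i)]
    split_ifs with h
    · exact (hg0 _ _).symm
    · obtain rfl : i = m := by omega
      exact hcm _ _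

namespace ChainSystem

variable {M : Automaton A Q} [hM : Fact M.Invertible] (C : ChainSystem M)

/-- The pair of sequences to be joined inside the `i`-th tile of a chain. -/
def child (p : LimObj A × LimObj A) (i : ℕ) : LimObj A × LimObj A :=
  (fun k => (C.arr p i).tgt (k + 1), fun k => (C.arr p (i + 1)).src (k + 1))

/-- The entries of the arrow with an address: an even digit `2 i` denotes the `i`-th arrow of the
chain, and an odd digit `2 i + 1` the tile that follows it. -/
noncomputable def coord {b : ℕ} : ℕ → LimObj A × LimObj A → (ℕ → Fin b) → A × M.group
  | 0, p, d => if Even (d 0 : ℕ) then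
      ((C.arr p ((d 0 : ℕ) / 2)).1.1 0, (C.arr p ((d 0 : ℕ) / 2)).1.2 0)
    else ((C.arr p ((d 0 : ℕ) / 2)).tgt 0, 1)
  | k + 1, p, d => if Even (d 0 : ℕ) then
      ((C.arr p ((d 0 : ℕ) / 2)).1.1 (k + 1), (C.arr p ((d 0 : ℕ) / 2)).1.2 (k + 1))
    else coord k (C.child p ((d 0 : ℕ) / 2)) fun n => d (n + 1)

variable {b : ℕ} (p : LimObj A × LimObj A) (d : ℕ → Fin b)

theorem coord_even (h : Even (d 0 : ℕ)) (k : ℕ) : C.coord k p d =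
    ((C.arr p ((d 0 : ℕ) / 2)).1.1 k, (C.arr p ((d 0 : ℕ) / 2)).1.2 k) := by
  cases k <;> exact if_pos h

theorem coord_odd_zero (h : ¬ Even (d 0 : ℕ)) :
    C.coord 0 p d = ((C.arr p ((d 0 : ℕ) / 2)).tgt 0, 1) := if_neg h

theorem coord_odd_succ (h : ¬ Even (d 0 : ℕ)) (k : ℕ) :
    C.coord (k + 1) p d = C.coord k (C.child p ((d 0 : ℕ) / 2)) fun n => d (n + 1) := if_neg h

/-- Arrows with an address have trivial holonomy, so appending a letter to one puts the identity in
the new last place. This makes the entries of the recursion fit together. -/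
theorem sec_coord_zero : sec (C.coord 0 p d).2 (C.coord 0 p d).1 = 1 := by
  by_cases h : Even (d 0 : ℕ)
  · rw [C.coord_even p d h]
    exact C.hol_arr _ _
  · rw [C.coord_odd_zero p d h]
    exact sec_one _

theorem coord_mem (k : ℕ) : (C.coord k p d).2 ∈ C.values := by
  induction k generalizing p d with
  | zero =>
    by_cases h : Even (d 0 : ℕ)
    · rw [C.coord_even p d h]
      exact C.arr_mem _ _ _
    · rw [C.coord_odd_zero p d h]
      exact C.one_mem
  | succ k ih =>
    by_cases h : Even (d 0 : ℕ)
    · rw [C.coord_even p d h]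
      exact C.arr_mem _ _ _
    · rw [C.coord_odd_succ p d h]
      exact ih _ _

theorem isSection_coord (k : ℕ) :
    IsSection (C.coord (k + 1) p d).2.1 [(C.coord (k + 1) p d).1] (C.coord k p d).2.1 := by
  induction k generalizing p d with
  | zero =>
    by_cases h : Even (d 0 : ℕ)
    · rw [C.coord_even p d h, C.coord_even p d h]
      exact (C.arr p ((d 0 : ℕ) / 2)).2.2 0
    · rw [C.coord_odd_succ p d h, C.coord_odd_zero p d h, ← C.sec_coord_zero]
      exact isSection_sec _ _
  | succ k ih =>
    by_cases h : Even (d 0 : ℕ)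
    · rw [C.coord_even p d h, C.coord_even p d h]
      exact (C.arr p ((d 0 : ℕ) / 2)).2.2 (k + 1)
    · rw [C.coord_odd_succ p d h, C.coord_odd_succ p d h]
      exact ih _ _

theorem coord_congr {d d' : ℕ → Fin b} (k : ℕ) (h : ∀ i ≤ k, d i = d' i) :
    C.coord k p d = C.coord k p d' := by
  induction k generalizing p d d' with
  | zero => simp only [coord, h 0 le_rfl]
  | succ k ih =>
    simp only [coord, h 0 (Nat.zero_le _)]
    rw [ih _ fun i hi => h (i + 1) (by omega)]

/-- The arrow with an address. -/
noncomputable def arrow : LimMor M :=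
  ⟨(fun k => (C.coord k p d).1, fun k => (C.coord k p d).2),
    C.finite_values.subset (by rintro _ ⟨k, rfl⟩; exact C.coord_mem p d k),
    C.isSection_coord p d⟩

theorem arrow_even (h : Even (d 0 : ℕ)) : C.arrow p d = C.arr p ((d 0 : ℕ) / 2) :=
  LimMor.ext (fun k => congrArg Prod.fst (C.coord_even p d h k))
    fun k => congrArg Prod.snd (C.coord_even p d h k)

theorem arrow_odd (h : ¬ Even (d 0 : ℕ)) : C.arrow p d =
    (C.arrow (C.child p ((d 0 : ℕ) / 2)) fun n => d (n + 1)).snoc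
      ((C.arr p ((d 0 : ℕ) / 2)).tgt 0) := by
  refine LimMor.ext (fun k => ?_) fun k => ?_
  · cases k with
    | zero => exact congrArg Prod.fst (C.coord_odd_zero p d h)
    | succ k => exact congrArg Prod.fst (C.coord_odd_succ p d h k)
  · cases k with
    | zero =>
      refine (congrArg Prod.snd (C.coord_odd_zero p d h)).trans ?_
      exact (C.sec_coord_zero _ _).symm
    | succ k => exact congrArg Prod.snd (C.coord_odd_succ p d h k)

/-- These addresses never reach an arrow of a chain, only ever smaller tiles. The corresponding edge
is collapsed to a vertex, so the value of `param` there is immaterial. -/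
theorem arrow_eq_one (h : ∀ k, ¬ Even (d k : ℕ)) :
    C.arrow p d = LimMor.one (C.arrow p d).src := by
  refine LimMor.ext (fun k => rfl) fun k => ?_
  change (C.coord k p d).2 = 1
  induction k generalizing p d with
  | zero => rw [C.coord_odd_zero p d (h 0)]
  | succ k ih => rw [C.coord_odd_succ p d (h 0), ih _ _ fun k => h (k + 1)]

/-- The entry number k depends on the digits 0, …, k only. -/
theorem continuous_arrow : Continuous (C.arrow p : (ℕ → Fin b) → LimMor M) := by
  have key : ∀ {X : Type u} [TopologicalSpace X] (k : ℕ) (f : A × M.group → X),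
      Continuous fun d : ℕ → Fin b => f (C.coord k p d) := fun k f => by
    refine continuous_iff_continuousAt.2 fun d => ?_
    have : ∀ᶠ d' in nhds d, ∀ i ∈ Finset.Iic k, d i = d' i := by
      refine (Filter.eventually_all_finset _).2 fun i _ => ?_
      filter_upwards [((isOpen_discrete {x | d i = x}).preimage (continuous_apply i)).mem_nhds
        (show d ∈ _ from rfl)] with d' h
      exact h
    refine (continuousAt_const (y := f (C.coord k p d))).congr ?_
    filter_upwards [this] with d' h
    rw [C.coord_congr p k fun i hi => h i (Finset.mem_Iic.2 hi)]
  let _ : TopologicalSpace A := ⊥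
  exact LimMor.continuous_iff.2 ⟨fun k => key k Prod.fst, fun k => key k Prod.snd⟩

/-- The coordinate on the arrow with an address: the expansion that follows the first even digit. -/
noncomputable def param : I :=
  open Classical in
  if h : ∃ n, Even (d n : ℕ) then
    ⟨Real.ofDigits fun k => d (k + (Nat.find h + 1)), Real.ofDigits_nonneg _, Real.ofDigits_le_one _⟩
  else 0

theorem param_even (h : Even (d 0 : ℕ)) :
    param d = ⟨Real.ofDigits fun k => d (k + 1), Real.ofDigits_nonneg _, Real.ofDigits_le_one _⟩ := by
  classical
  have h' : ∃ n, Even (d n : ℕ) := ⟨0, h⟩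
  have h0 : Nat.find h' = 0 := (Nat.find_eq_zero h').2 h
  rw [param, dif_pos h']
  simp only [h0, zero_add]

theorem param_odd (h : ¬ Even (d 0 : ℕ)) : param d = param fun n => d (n + 1) := by
  classical
  by_cases h' : ∃ n, Even (d (n + 1) : ℕ)
  · have h1 : ∃ n, Even (d n : ℕ) := h'.imp' _ fun _ h => h
    rw [param, param, dif_pos h1, dif_pos h']
    simp only [Nat.find_comp_succ h1 h' h, add_assoc]
  · have h1 : ¬ ∃ n, Even (d n : ℕ) := by
      rintro ⟨n, hn⟩
      cases n with
      | zero => exact h hn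
      | succ n => exact h' ⟨n, hn⟩
    rw [param, param, dif_neg h1, dif_neg h']

/-- The point of the skew product with an address. -/
noncomputable def address : (frames M).Realization :=
  edge (frameMor (C.arrow p d) 1, param d)

theorem address_even (h : Even (d 0 : ℕ)) : C.address p d =
    edge (frameMor (C.arr p ((d 0 : ℕ) / 2)) 1,
      ⟨Real.ofDigits fun k => d (k + 1), Real.ofDigits_nonneg _, Real.ofDigits_le_one _⟩) := by
  rw [address, C.arrow_even p d h, param_even d h]

theorem address_odd (h : ¬ Even (d 0 : ℕ)) : C.address p d =
    (frameSnoc ((C.arr p ((d 0 : ℕ) / 2)).tgt 0)).realize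
      (C.address (C.child p ((d 0 : ℕ) / 2)) fun n => d (n + 1)) := by
  rw [address, address, realize_edge, C.arrow_odd p d h, param_odd d h, frameSnoc_mor, sec_one]
  rfl

theorem continuous_tail : Continuous fun (d : ℕ → Fin b) n => d (n + 1) :=
  continuous_pi fun n => continuous_apply (n + 1)

theorem continuous_address : Continuous (C.address p : (ℕ → Fin b) → _) := by
  have hd : ∀ d : ℕ → Fin b, ∀ᶠ d' in nhds d, d' 0 = d 0 := fun d =>
    ((isOpen_discrete {x | x = d 0}).preimage (continuous_apply (A := fun _ => Fin b) 0)).mem_nhds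
      (show d ∈ _ from rfl)
  -- Once an even digit occurs, nearby addresses share the arrow and vary only in the coordinate
  -- along it; the odd digits before it are peeled off by `address_odd`.
  have key : ∀ n p (d : ℕ → Fin b), Even (d n : ℕ) → ContinuousAt (C.address p) d := by
    intro n
    have base : ∀ p (d : ℕ → Fin b), Even (d 0 : ℕ) → ContinuousAt (C.address p) d := by
      intro p d h
      have hc : Continuous fun d' : ℕ → Fin b => edge
          (frameMor (C.arr p ((d 0 : ℕ) / 2)) 1, ⟨Real.ofDigits fun k => d' (k + 1),
            Real.ofDigits_nonneg _, Real.ofDigits_le_one _⟩) :=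
        continuous_edge.comp (continuous_const.prodMk
          ((Real.continuous_ofDigits.comp continuous_tail).subtype_mk _))
      refine hc.continuousAt.congr ?_
      filter_upwards [hd d] with d' h'
      rw [C.address_even p d' (h' ▸ h), h']
    induction n with
    | zero => exact base
    | succ n ih =>
      intro p d h
      by_cases h0 : Even (d 0 : ℕ)
      · exact base p d h0
      · have hc : ContinuousAt (fun d' : ℕ → Fin b =>
            (frameSnoc ((C.arr p ((d 0 : ℕ) / 2)).tgt 0)).realize
              (C.address (C.child p ((d 0 : ℕ) / 2)) fun n => d' (n + 1))) d :=
          (continuous_realize _).continuousAt.comp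
            ((ih (C.child p ((d 0 : ℕ) / 2)) (fun n => d (n + 1)) h).comp
              (f := fun (d' : ℕ → Fin b) n => d' (n + 1)) continuous_tail.continuousAt)
        refine hc.congr ?_
        filter_upwards [hd d] with d' h'
        rw [C.address_odd p d' (h' ▸ h0), h']
  refine continuous_iff_continuousAt.2 fun d => ?_
  by_cases h : ∃ n, Even (d n : ℕ)
  · obtain ⟨n, hn⟩ := h
    exact key n p d hn
  · have hone : frameMor (C.arrow p d) 1 = (frames M).one (frameObj (C.arrow p d).src 1) :=
      congrArg (frameMor · 1) (C.arrow_eq_one p d fun n hn => h ⟨n, hn⟩)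
    -- Here `param` may be discontinuous. Since the whole edge over the identity arrow is one point
    -- and I is compact, the tube lemma gives a neighbourhood of that arrow whose edges lie entirely
    -- in V.
    intro U hU
    obtain ⟨V, hVU, hV, hdV⟩ := mem_nhds_iff.1 hU
    have hsub : {frameMor (C.arrow p d) 1} ×ˢ (Set.univ : Set I) ⊆
        edge (G := frames M) ⁻¹' V := by
      rintro ⟨g, s⟩ ⟨hg, -⟩
      obtain rfl : g = _ := hg
      change edge _ ∈ V
      rw [address, hone, edge_one] at hdV
      rwa [hone, edge_one]
    obtain ⟨u, w, hu, -, hgu, hw, huw⟩ := generalized_tube_lemma isCompact_singleton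
      (isCompact_univ (X := I)) (hV.preimage continuous_edge) hsub
    have hc : Continuous fun d' : ℕ → Fin b => frameMor (C.arrow p d') 1 :=
      (C.continuous_arrow p).prodMk continuous_const
    have hdu : frameMor (C.arrow p d) 1 ∈ u := hgu rfl
    refine Filter.mem_map.2 ?_
    filter_upwards [(hu.preimage hc).mem_nhds hdu] with d' hd'
    exact hVU (huw ⟨hd', hw (Set.mem_univ _)⟩)

theorem address_zero (h : Real.ofDigits d = 0) :
    C.address p d = vertex (frameObj p.1 (1 : M.group)) := by
  have h0 := Real.eq_zero_of_ofDigits_eq_zero h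
  rw [C.address_even p d (by rw [h0]; exact Even.zero), h0, Nat.zero_div, C.arr_zero]
  exact edge_one (frameObj p.1 (1 : M.group)) _

theorem address_one {d : ℕ → Fin (2 * C.m + 3)} (h : Real.ofDigits d = 1) :
    C.address p d = vertex (frameObj p.2 (1 : M.group)) := by
  -- The base 2m + 3 is odd, so its largest digit is even and denotes the last arrow, which is an
  -- identity.
  have h0 : (d 0 : ℕ) = 2 * (C.m + 1) := by
    have := Real.eq_last_of_ofDigits_eq_one h 0
    omega
  rw [C.address_even p d (by rw [h0]; exact even_two_mul _), h0,
    Nat.mul_div_cancel_left _ two_pos, C.arr_last]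
  exact edge_one (frameObj p.2 (1 : M.group)) _

theorem snoc_tail (α : LimObj A) (a : A) (h : α 0 = a) :
    LimObj.snoc (fun k => α (k + 1)) a = α := by
  subst h
  funext k
  cases k <;> rfl

theorem frameSnoc_vertex (α : LimObj A) (a : A) (h : α 0 = a) :
    (frameSnoc (M := M) a).realize (vertex (frameObj (fun k => α (k + 1)) (1 : M.group))) =
      vertex (frameObj α (1 : M.group)) := by
  rw [realize_vertex]
  refine congrArg vertex ((frameSnoc_obj _ _ _).trans ?_)
  rw [sec_one]
  exact congrArg (frameObj · (1 : M.group)) (snoc_tail α a h)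

/-- The first digits are consecutive, so the point is the junction of an arrow and an adjacent tile.
Either description gives the vertex at the common end: the target of the arrow before the tile, or
the source of the arrow after it. -/
theorem address_eq_of_lt {d d' : ℕ → Fin (2 * C.m + 3)} (h : Real.ofDigits d = Real.ofDigits d')
    (h0 : d 0 < d' 0) : C.address p d = C.address p d' := by
  obtain ⟨h1, h2, h3⟩ := Real.digits_of_ofDigits_eq h h0
  rcases Nat.even_or_odd' (d 0 : ℕ) with ⟨i, hi | hi⟩
  · have hi' : (d' 0 : ℕ) / 2 = i := by omega
    rw [C.address_even p d (by rw [hi]; exact even_two_mul _),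
      C.address_odd p d' (by rw [h1, hi, Nat.not_even_iff_odd]; exact odd_two_mul_add_one _),
      C.address_zero _ _ h3, hi, hi', Nat.mul_div_cancel_left _ two_pos]
    refine Eq.trans ?_ (frameSnoc_vertex (M := M) (C.arr p i).tgt _ rfl).symm
    have e1 : (⟨Real.ofDigits fun k => d (k + 1), Real.ofDigits_nonneg _,
      Real.ofDigits_le_one _⟩ : I) = 1 := Subtype.ext h2
    rw [e1, edge_right, tgt_frameMor, C.hol_arr, _root_.mul_one]
  · have hi0 : (d 0 : ℕ) / 2 = i := by omega
    have hi' : (d' 0 : ℕ) / 2 = i + 1 := by omega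
    have him : i ≤ C.m := by
      have := (d' 0).2
      omega
    rw [C.address_odd p d (by rw [hi, Nat.not_even_iff_odd]; exact odd_two_mul_add_one _),
      C.address_even p d' (by rw [h1, hi]; exact ⟨i + 1, by ring⟩),
      C.address_one _ h2, hi0, hi']
    refine (frameSnoc_vertex (M := M) (C.arr p (i + 1)).src _ (C.last_eq p i him).symm).trans ?_
    have e1 : (⟨Real.ofDigits fun k => d' (k + 1), Real.ofDigits_nonneg _,
      Real.ofDigits_le_one _⟩ : I) = 0 := Subtype.ext h3
    rw [e1, edge_left]
    rfl

theorem address_eq {d d' : ℕ → Fin (2 * C.m + 3)} (h : Real.ofDigits d = Real.ofDigits d') :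
    C.address p d = C.address p d' := by
  by_cases hdd : d = d'
  · rw [hdd]
  obtain ⟨n, hn⟩ := Function.ne_iff.1 hdd
  clear hdd
  induction n generalizing p d d' with
  | zero =>
    rcases lt_or_gt_of_ne hn with h' | h'
    · exact C.address_eq_of_lt p h h'
    · exact (C.address_eq_of_lt p h.symm h').symm
  | succ n ih =>
    rcases lt_trichotomy (d 0) (d' 0) with h' | h' | h'
    · exact C.address_eq_of_lt p h h'
    · have ht := Real.ofDigits_tail_eq h h'
      by_cases he : Even (d 0 : ℕ)
      · rw [C.address_even p d he, C.address_even p d' (h' ▸ he), h']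
        simp only [ht]
      · rw [C.address_odd p d he, C.address_odd p d' (h' ▸ he), h',
          ih (C.child p ((d' 0 : ℕ) / 2)) ht hn]
    · exact (C.address_eq_of_lt p h.symm h').symm

/-- Any two sequences are joined by a path with trivial holonomy. -/
theorem joined (C : ChainSystem M) (α β : LimObj A) :
    Joined (vertex (frameObj α (1 : M.group))) (vertex (frameObj β (1 : M.group))) := by
  have hb : 1 < 2 * C.m + 3 := by omega
  let f : (ℕ → Fin (2 * C.m + 3)) → I := fun d =>
    ⟨Real.ofDigits d, Real.ofDigits_nonneg _, Real.ofDigits_le_one _⟩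
  have hf : Continuous f := Real.continuous_ofDigits.subtype_mk _
  have hs : Function.Surjective f := fun s => by
    obtain ⟨d, -, hd⟩ := Real.ofDigits_SurjOn hb s.2
    exact ⟨d, Subtype.ext hd⟩
  -- A continuous map from a compact space onto a Hausdorff space is a quotient map, so a continuous
  -- function of the digits that is independent of the expansion is continuous on I.
  have hq : Topology.IsQuotientMap f := hf.isClosedMap.isQuotientMap hf hs
  choose s hfs using hs
  have hlift : ∀ d, C.address (α, β) (s (f d)) = C.address (α, β) d := fun d =>
    C.address_eq _ (congrArg Subtype.val (hfs (f d)))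
  refine ⟨⟨⟨fun t => C.address (α, β) (s t), hq.continuous_iff.2 ?_⟩, ?_, ?_⟩⟩
  · exact (C.continuous_address (α, β)).congr fun d => (hlift d).symm
  · exact C.address_zero _ _ (congrArg Subtype.val (hfs 0))
  · exact C.address_one _ (congrArg Subtype.val (hfs 1))

end ChainSystem

end Limit

namespace TopGroupoid

variable {G H K : TopGroupoid.{u}}

/-- The composition of morphisms of groupoids. -/
def Hom.comp (F' : Hom H K) (F : Hom G H) : Hom G K where
  obj x := F'.obj (F.obj x)
  mor g := F'.mor (F.mor g)
  continuous_obj := F'.continuous_obj.comp F.continuous_obj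
  continuous_mor := F'.continuous_mor.comp F.continuous_mor
  src_mor g := by rw [F'.src_mor, F.src_mor]
  tgt_mor g := by rw [F'.tgt_mor, F.tgt_mor]
  map_one x := by rw [F.map_one, F'.map_one]
  map_inv g := by rw [F.map_inv, F'.map_inv]
  map_mul g h e := by rw [← F'.map_mul, F.map_mul]

theorem Hom.realize_comp (F' : Hom H K) (F : Hom G H) (z : G.Realization) :
    (F'.comp F).realize z = F'.realize (F.realize z) :=
  (Realization.realize_realize (F'' := F'.comp F) (fun _ => rfl) (fun _ => rfl) z).symm

end TopGroupoid

/-! ### Monodromy -/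

section Covering

variable {E E' X : Type*} [TopologicalSpace E] [TopologicalSpace E'] [TopologicalSpace X]
  {p : E → X} {p' : E' → X} {f : X → X}

/-- A map over X carries lifts of a path to lifts of the same path, and lifts are unique. -/
theorem monodromy_comp (cov : IsCoveringMap p) (cov' : IsCoveringMap p') (F : C(E, E'))
    (h : ∀ e, p' (F e) = p e) {x y : X} (γ : Path.Homotopic.Quotient x y) (e : p ⁻¹' {x})
    (e' : p' ⁻¹' {x}) (he : e'.1 = F e.1) :
    (cov'.monodromy γ e').1 = F (cov.monodromy γ e).1 := by
  obtain ⟨γ⟩ := γ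
  have h0 : γ 0 = p e.1 := γ.source.trans e.2.symm
  have h1 : γ 0 = p' e'.1 := γ.source.trans e'.2.symm
  have key : F.comp (cov.liftPath γ e.1 h0) = cov'.liftPath γ e'.1 h1 := by
    refine (cov'.eq_liftPath_iff' h1).2 ⟨?_, ?_⟩
    · exact funext fun t => (h _).trans (congrFun (cov.liftPath_lifts γ e.1 h0) t)
    · rw [he, ContinuousMap.comp_apply, cov.liftPath_zero]
  exact (congrArg (fun Γ : C(unitInterval, E') => Γ 1) key).symm

/-- If Γ lifts γ through p, then p ∘ F ∘ Γ lifts γ through f, so F ∘ Γ is the lift through p of the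
lift of γ through f. -/
theorem monodromy_liftPathQuotient (cov : IsCoveringMap f) (covp : IsCoveringMap p) (F : C(E, E))
    (h : ∀ e, f (p (F e)) = p e) {x y : X} (γ : Path.Homotopic.Quotient x y) (e : p ⁻¹' {x})
    (b : f ⁻¹' {x}) (u : p ⁻¹' {b.1}) (hu : u.1 = F e.1) :
    (covp.monodromy (cov.liftPathQuotient γ b) u).1 = F (covp.monodromy γ e).1 := by
  obtain ⟨γ⟩ := γ
  have h0 : γ 0 = p e.1 := γ.source.trans e.2.symm
  have h1 : γ 0 = f b.1 := γ.source.trans b.2.symm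
  have h2 : cov.liftPath γ b.1 h1 0 = p u.1 := (cov.liftPath_zero _ _ _).trans u.2.symm
  have hb : p (F e.1) = b.1 := (congrArg p hu.symm).trans u.2
  have key : (⟨p, covp.continuous⟩ : C(E, X)).comp (F.comp (covp.liftPath γ e.1 h0)) =
      cov.liftPath γ b.1 h1 := by
    refine (cov.eq_liftPath_iff' h1).2 ⟨?_, ?_⟩
    · exact funext fun t => (h _).trans (congrFun (covp.liftPath_lifts γ e.1 h0) t)
    · rw [← hb, ContinuousMap.comp_apply, ContinuousMap.comp_apply, covp.liftPath_zero]
      rfl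
  have key' : F.comp (covp.liftPath γ e.1 h0) = covp.liftPath (cov.liftPath γ b.1 h1) u.1 h2 := by
    refine (covp.eq_liftPath_iff' h2).2 ⟨congrArg DFunLike.coe key, ?_⟩
    rw [hu, ContinuousMap.comp_apply, covp.liftPath_zero]
  exact (congrArg (fun Γ : C(unitInterval, E) => Γ 1) key').symm

theorem monodromy_mk_symm (cov : IsCoveringMap p) {x y : X} (γ : Path.Homotopic.Quotient x y)
    {e : p ⁻¹' {x}} {e' : p ⁻¹' {y}} (h : cov.monodromy γ e = e') :
    cov.monodromy γ.symm e' = e := by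
  have : γ.trans γ.symm = Path.Homotopic.Quotient.refl x := by
    obtain ⟨γ, rfl⟩ := Path.Homotopic.Quotient.mk_surjective γ
    rw [← Path.Homotopic.Quotient.mk_symm, ← Path.Homotopic.Quotient.mk_trans,
      ← Path.Homotopic.Quotient.mk_refl]
    exact (Path.Homotopic.Quotient.eq.2 ⟨.reflTransSymm _⟩).symm
  rw [← h, ← cov.monodromy_trans_apply, this, cov.monodromy_refl, id]

theorem monodromy_mk_map (cov : IsCoveringMap p) {e e' : E} (γ : Path e e') {x y : X}
    (δ : Path x y) (hx : p e = x) (hy : p e' = y) (h : ∀ t, δ t = p (γ t)) :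
    cov.monodromy (.mk δ) ⟨e, hx⟩ = ⟨e', hy⟩ := by
  subst hx hy
  obtain rfl : δ = γ.map cov.continuous := Path.ext (funext h)
  exact cov.monodromy_map (.mk γ)

end Covering

/-! ### The frame space and the tree of iterated preimages. -/

namespace Limit

open TopGroupoid Transducer Realization

variable {A : Type u} {Q : Type v} (M : Automaton A Q) [hM : Fact M.Invertible]

/-- The total space of the covering `|L(M)| ← |frames M|`. -/
abbrev FrameSpace : Type u := (frames M).Realization

/-- The covering `|frames M| → |L(M)|`. -/
noncomputable def frameProj : FrameSpace M → (limitSpace M).Realization :=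
  (LimMor.holCocycle M).proj.realize

theorem isCoveringMap_frameProj : IsCoveringMap (frameProj M) :=
  (LimMor.holCocycle M).isCoveringMap_proj

variable {M}

/-- The right action of the group on the frame space. -/
noncomputable def translate (g : M.group) : C(FrameSpace M, FrameSpace M) :=
  ⟨((LimMor.holCocycle M).translate g).realize, continuous_realize _⟩

/-- The self-map of the frame space that appends a letter. -/
noncomputable def extend (a : A) : C(FrameSpace M, FrameSpace M) :=
  ⟨(frameSnoc a).realize, continuous_realize _⟩

theorem frameProj_translate (g : M.group) (e : FrameSpace M) :
    frameProj M (translate g e) = frameProj M e :=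
  (LimMor.holCocycle M).proj_translate g e

theorem translate_translate (g h : M.group) (e : FrameSpace M) :
    translate g (translate h e) = translate (h * g) e :=
  realize_realize (fun _ => Prod.ext rfl (_root_.mul_assoc _ _ _))
    (fun _ => Prod.ext rfl (_root_.mul_assoc _ _ _)) e

theorem translate_vertex (g h : M.group) (α : LimObj A) :
    translate g (vertex (frameObj α h)) = vertex (frameObj α (h * g)) :=
  realize_vertex _ _

theorem shift_frameProj_extend (a : A) (e : FrameSpace M) :
    (limitShift M).realize (frameProj M (extend a e)) = frameProj M e :=
  (Hom.realize_comp _ _ _).symm.trans <| realize_realize (F := frameSnoc a)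
    (F' := (limitShift M).comp (LimMor.holCocycle M).proj) (F'' := (LimMor.holCocycle M).proj)
    (fun _ => rfl) (fun _ => rfl) e

/-- This is the recursion of the automaton in geometric form: letters are permuted by g, and the
frame changes by the section of g. -/
theorem extend_translate (a : A) (g : M.group) (e : FrameSpace M) :
    extend a (translate g e) = translate (sec g a) (extend (letter g.1 a) e) := by
  refine Eq.trans ?_ (Hom.realize_comp ((LimMor.holCocycle M).translate (sec g a))
    (frameSnoc (letter g.1 a)) e)
  refine realize_realize (F := (LimMor.holCocycle M).translate g) (F' := frameSnoc a)
    (fun p => ?_) (fun p => ?_) e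
  · exact Prod.ext (congrArg (LimObj.snoc p.1) (letter_mul' _ _ _)) (sec_mul (M := M) _ _ _)
  · exact Prod.ext (congrArg (LimMor.snoc p.1) (letter_mul' _ _ _)) (sec_mul (M := M) _ _ _)

theorem exists_translate {e e' : FrameSpace M} (h : frameProj M e = frameProj M e') :
    ∃ g : M.group, translate g e = e' :=
  (LimMor.holCocycle M).exists_translate h

theorem translate_injective (e : FrameSpace M) :
    Function.Injective fun g : M.group => translate g e :=
  (LimMor.holCocycle M).translate_injective e

theorem translate_one (e : FrameSpace M) : translate 1 e = e :=
  (LimMor.holCocycle M).translate_one e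

theorem frameProj_surjective : Function.Surjective (frameProj M) :=
  (LimMor.holCocycle M).fibration.realize_surjective

/-- If e is the lift with initial label g of a cell, appending a and projecting gives the lift of
that cell through the shift with label g(a). The letters thus correspond to the fibre through the
permutation induced by g. -/
theorem extend_bijective (x : (limitSpace M).Realization) (e : frameProj M ⁻¹' {x}) :
    Function.Bijective fun a : A => (⟨frameProj M (extend a e.1),
      (shift_frameProj_extend a e.1).trans e.2⟩ : (limitShift M).realize ⁻¹' {x}) := by
  obtain ⟨e, he⟩ := e
  obtain ⟨c, rfl⟩ := exists_point x
  let T := (LimMor.holCocycle M).fibration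
  obtain ⟨g, rfl⟩ := (T.realize_eq_point_iff e c).1 he
  convert ((shiftFibration M).fiberEquiv c).bijective.comp (letter_bijective g) using 1
  funext a
  refine Subtype.ext ?_
  refine (congrArg (frameProj M) (realize_point (frameSnoc a) _)).trans ?_
  refine (realize_point (LimMor.holCocycle M).proj _).trans ?_
  refine congrArg (fun y => point ⟨c.1, y, c.2.2⟩) ((shiftFibration M).simplex_ext ?_ 0 ?_)
  · rw [(shiftFibration M).map_liftSimplex]
    exact T.map_liftSimplex g c.2.1
  · rw [(shiftFibration M).label_liftSimplex_zero]
    exact congrArg (fun g : M.group => letter g.1 a) (T.label_liftSimplex_zero g c.2.1)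

/-- The letters as the points of a fibre of the shift. -/
noncomputable def letterEquiv {x : (limitSpace M).Realization} (e : frameProj M ⁻¹' {x}) :
    A ≃ (limitShift M).realize ⁻¹' {x} :=
  Equiv.ofBijective _ (extend_bijective x e)

/-- The self-map of the frame space that appends a word. -/
noncomputable def extendWord : List A → C(FrameSpace M, FrameSpace M)
  | [] => ContinuousMap.id _
  | a :: w => (extendWord w).comp (extend a)

theorem extendWord_cons (a : A) (w : List A) (e : FrameSpace M) :
    extendWord (a :: w) e = extendWord w (extend a e) := rfl

/-- Changing the frame by g changes the identification of the tree of preimages with A^* by g.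
Sections are absorbed one letter at a time, and the last one vanishes in the projection. -/
theorem frameProj_extendWord_translate (v : List A) (g : M.group) (e : FrameSpace M) :
    frameProj M (extendWord v (translate g e)) = frameProj M (extendWord (g.1 v) e) := by
  induction v generalizing g e with
  | nil =>
    rw [apply_nil]
    exact frameProj_translate g e
  | cons a w ih => rw [extendWord_cons, extend_translate, ih, apply_cons, extendWord_cons]

theorem iterate_shift_extendWord (v : List A) (e : FrameSpace M) :
    (limitShift M).realize^[v.length] (frameProj M (extendWord v e)) = frameProj M e := by
  induction v generalizing e with
  | nil => rfl
  | cons a w ih =>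
    rw [List.length_cons, Function.iterate_succ_apply', extendWord_cons, ih,
      shift_frameProj_extend]

theorem extendWord_injective {v w : List A} (hl : v.length = w.length) (e : FrameSpace M)
    (h : frameProj M (extendWord v e) = frameProj M (extendWord w e)) : v = w := by
  induction v generalizing w e with
  | nil => exact (List.length_eq_zero_iff.1 hl.symm).symm
  | cons a v ih =>
    obtain _ | ⟨b, w⟩ := w
    · cases hl
    have hl' : v.length = w.length := Nat.succ_injective hl
    rw [extendWord_cons, extendWord_cons] at h
    have hab : frameProj M (extend a e) = frameProj M (extend b e) := by
      rw [← iterate_shift_extendWord v (extend a e), ← iterate_shift_extendWord w (extend b e), h, hl']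
    obtain rfl : a = b := (extend_bijective _ ⟨e, rfl⟩).1 (Subtype.ext hab)
    rw [ih hl' _ h]

theorem exists_extendWord (n : ℕ) (e : FrameSpace M) {z : (limitSpace M).Realization}
    (h : (limitShift M).realize^[n] z = frameProj M e) :
    ∃ v : List A, v.length = n ∧ frameProj M (extendWord v e) = z := by
  induction n generalizing e with
  | zero => exact ⟨[], rfl, h.symm⟩
  | succ n ih =>
    rw [Function.iterate_succ_apply'] at h
    obtain ⟨a, ha⟩ := (extend_bijective _ ⟨e, rfl⟩).2 ⟨_, h⟩
    obtain ⟨v, rfl, hv⟩ := ih (extend a e) (congrArg Subtype.val ha).symm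
    exact ⟨a :: v, rfl, hv⟩

/-! ### Holonomy -/

section Holonomy

variable {x y : (limitSpace M).Realization}

theorem monodromy_translate (γ : Path.Homotopic.Quotient x y) (g : M.group)
    (e u : frameProj M ⁻¹' {x}) (hu : u.1 = translate g e.1) :
    ((isCoveringMap_frameProj M).monodromy γ u).1 =
      translate g ((isCoveringMap_frameProj M).monodromy γ e).1 :=
  monodromy_comp _ _ (translate g) (frameProj_translate g) γ e u hu

theorem exists_holonomy (e : frameProj M ⁻¹' {x}) (γ : Path.Homotopic.Quotient x x) :
    ∃ g : M.group, translate g e.1 = ((isCoveringMap_frameProj M).monodromy γ e).1 :=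
  exists_translate (e.2.trans ((isCoveringMap_frameProj M).monodromy γ e).2.symm)

/-- The holonomy of the covering by the frame space. -/
noncomputable def holonomy (e : frameProj M ⁻¹' {x}) :
    FundamentalGroup (limitSpace M).Realization x →* M.group :=
  MonoidHom.mk' (fun γ => (exists_holonomy e γ.toPath).choose) fun γ δ => by
    apply translate_injective e.1
    simp only
    rw [(exists_holonomy e (γ * δ).toPath).choose_spec, ← translate_translate,
      (exists_holonomy e γ.toPath).choose_spec]
    -- The product γ * δ of loop classes runs along δ first; as monodromy commutes with translation,
    -- the holonomies multiply in the order of composition of maps.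
    refine (congrArg Subtype.val
      ((isCoveringMap_frameProj M).monodromy_trans_apply δ.toPath γ.toPath e)).trans ?_
    have := monodromy_translate γ.toPath _ e _ (exists_holonomy e δ.toPath).choose_spec.symm
    exact this

theorem translate_holonomy (e : frameProj M ⁻¹' {x})
    (γ : FundamentalGroup (limitSpace M).Realization x) :
    translate (holonomy e γ) e.1 = ((isCoveringMap_frameProj M).monodromy γ.toPath e).1 :=
  (exists_holonomy e γ.toPath).choose_spec

theorem holonomy_eq (e : frameProj M ⁻¹' {x})
    {γ : FundamentalGroup (limitSpace M).Realization x} {g : M.group}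
    (h : ((isCoveringMap_frameProj M).monodromy γ.toPath e).1 = translate g e.1) :
    holonomy e γ = g :=
  translate_injective e.1 ((translate_holonomy e γ).trans h)

variable [Finite A]

/-- The monodromy of the frame space translates e by the holonomy. Appending v and projecting is a
map of coverings, so it carries this translation over to the fibre of the iterated shift. -/
theorem monodromy_extendWord (e : frameProj M ⁻¹' {x})
    (γ : FundamentalGroup (limitSpace M).Realization x) (v : List A)
    (b : (limitShift M).realize^[v.length] ⁻¹' {x}) (hb : b.1 = frameProj M (extendWord v e.1)) :
    ((isCoveringMap_iterate (isCoveringMap_shift M) (finite_fiber_shift M) v.length).monodromy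
      γ.toPath b).1 = frameProj M (extendWord ((holonomy e γ).1 v) e.1) := by
  rw [← frameProj_extendWord_translate, translate_holonomy]
  exact monodromy_comp (isCoveringMap_frameProj M) _
    ((⟨frameProj M, (isCoveringMap_frameProj M).continuous⟩ : C(_, _)).comp (extendWord v))
    (iterate_shift_extendWord v) γ.toPath e b hb

theorem monodromy_letterEquiv (e : frameProj M ⁻¹' {x})
    (γ : FundamentalGroup (limitSpace M).Realization x) (a : A) :
    (isCoveringMap_shift M).monodromy γ.toPath (letterEquiv e a) =
      letterEquiv e (letter (holonomy e γ).1 a) := by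
  refine Subtype.ext ?_
  have h := monodromy_comp (isCoveringMap_frameProj M) (isCoveringMap_shift M)
    ((⟨frameProj M, (isCoveringMap_frameProj M).continuous⟩ : C(_, _)).comp (extend a))
    (shift_frameProj_extend a) γ.toPath e (letterEquiv e a) rfl
  refine h.trans ?_
  rw [← translate_holonomy]
  change frameProj M (extend a (translate (holonomy e γ) e.1)) = frameProj M (extend _ e.1)
  rw [extend_translate, frameProj_translate]

/-- Each point of an iterated fibre comes from exactly one word, and the loop moves words by its
holonomy. It fixes them all only if the holonomy, being a permutation of A^*, is trivial. -/
theorem mem_monodromyKernel_iff (e : frameProj M ⁻¹' {x})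
    (γ : FundamentalGroup (limitSpace M).Realization x) :
    γ ∈ monodromyKernel (isCoveringMap_shift M) (finite_fiber_shift M) x ↔ holonomy e γ = 1 := by
  have he : frameProj M e.1 = x := e.2
  rw [monodromyKernel, Subgroup.mem_iInf]
  constructor
  · intro h
    refine Subtype.ext (Equiv.ext fun v => ?_)
    have hv : (limitShift M).realize^[v.length] (frameProj M (extendWord v e.1)) = x :=
      (iterate_shift_extendWord v e.1).trans he
    have h1 := congrArg (fun g : Equiv.Perm _ => (g ⟨_, hv⟩).1) (h v.length)
    have h2 := monodromy_extendWord e γ v ⟨_, hv⟩ rfl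
    exact extendWord_injective (length_of_mem_group (holonomy e γ).2 v) e.1 (h2.symm.trans h1)
  · intro h n
    refine Equiv.ext fun z => Subtype.ext ?_
    obtain ⟨v, rfl, hv⟩ := exists_extendWord n e.1 (z.2.trans he.symm)
    have h2 := monodromy_extendWord e γ v z hv.symm
    rw [h] at h2
    exact h2.trans hv

theorem mk_eq_mk_iff (e : frameProj M ⁻¹' {x})
    (γ δ : FundamentalGroup (limitSpace M).Realization x) :
    (QuotientGroup.mk γ : FundamentalGroup (limitSpace M).Realization x ⧸
      monodromyKernel (isCoveringMap_shift M) (finite_fiber_shift M) x) = QuotientGroup.mk δ ↔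
      holonomy e γ = holonomy e δ := by
  rw [QuotientGroup.eq, mem_monodromyKernel_iff e, map_mul, map_inv, inv_mul_eq_one]

/-- Follow e along the three pieces: ℓ leads to the translate of `extend a e` by `k a`; the lift of
γ replaces e by its translate by g, which `extend_translate` turns into the section at a over the
letter g(a); the return path for that letter removes its own k. -/
theorem holonomy_transfer (e : frameProj M ⁻¹' {x})
    (ℓ : ∀ b : (limitShift M).realize ⁻¹' {x}, Path x b.1) (k : A → M.group)
    (hk : ∀ a, ((isCoveringMap_frameProj M).monodromy (.mk (ℓ (letterEquiv e a))) e).1 =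
      translate (k a) (extend a e.1))
    (a : A) (γ : FundamentalGroup (limitSpace M).Realization x) :
    holonomy e (transfer (isCoveringMap_shift M) ℓ (letterEquiv e a) γ) =
      (k (letter (holonomy e γ).1 a))⁻¹ * sec (holonomy e γ) a * k a := by
  let cov := isCoveringMap_frameProj M
  -- The point b is kept as a variable, since the end of the lifted loop equals `letterEquiv e a`
  -- only propositionally and its type depends on it.
  have back : ∀ (a : A) (b) (_ : b = letterEquiv e a) (g : M.group) (u : frameProj M ⁻¹' {b.1})
      (_ : u.1 = translate g (extend a e.1)),
      (cov.monodromy (Path.Homotopic.Quotient.mk (ℓ b)).symm u).1 =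
        translate ((k a)⁻¹ * g) e.1 := by
    rintro a _ rfl g u hu
    have he : frameProj M (translate ((k a)⁻¹ * g) e.1) = x :=
      (frameProj_translate _ _).trans e.2
    refine congrArg Subtype.val (monodromy_mk_symm cov _ (e := ⟨_, he⟩) (Subtype.ext ?_))
    rw [monodromy_translate _ _ e ⟨_, he⟩ rfl, hk, translate_translate, mul_inv_cancel_left, hu]
  apply holonomy_eq
  have h1 := cov.monodromy_trans_apply ((Path.Homotopic.Quotient.mk (ℓ (letterEquiv e a))).trans
    ((isCoveringMap_shift M).liftPathQuotient γ.toPath (letterEquiv e a)))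
    (Path.Homotopic.Quotient.mk
      (ℓ ((isCoveringMap_shift M).monodromy γ.toPath (letterEquiv e a)))).symm e
  refine (congrArg Subtype.val h1).trans ?_
  rw [_root_.mul_assoc]
  refine back _ _ (monodromy_letterEquiv e γ a) _ _ ?_
  rw [cov.monodromy_trans_apply]
  have hb : frameProj M (extend a e.1) = (letterEquiv e a).1 := rfl
  rw [monodromy_translate _ (k a) ⟨_, hb⟩ _ (hk a)]
  rw [monodromy_liftPathQuotient (isCoveringMap_shift M) cov (extend a) (shift_frameProj_extend a)
    γ.toPath e (letterEquiv e a) ⟨_, hb⟩ rfl, ← translate_holonomy, extend_translate,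
    translate_translate]

end Holonomy

/-! ### Path connectedness -/

/-- Chains move the sequence while fixing the group coordinate. Arrows with prescribed holonomy move
that coordinate by a generator, and right translation carries such paths to all of G. -/
theorem pathConnectedSpace_frameSpace [Finite A] [Finite Q] (hinj : Function.Injective M.act)
    (hs : M.Smooth) : PathConnectedSpace (FrameSpace M) := by
  obtain ⟨C⟩ := exists_chainSystem hinj hs
  obtain ⟨a₀⟩ : Nonempty A := by
    obtain ⟨-, ε, -⟩ := id hs
    exact ⟨(hs.1 ε).choose.1⟩
  let α₀ : LimObj A := fun _ => a₀
  have h1 : ∀ (α β : LimObj A) (g : M.group),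
      Joined (vertex (frameObj α g)) (vertex (frameObj β g)) := fun α β g => by
    have := (C.joined α β).map (translate g).continuous
    rwa [translate_vertex, translate_vertex, _root_.one_mul] at this
  have h2 : ∀ g h k : M.group, Joined (vertex (frameObj α₀ g)) (vertex (frameObj α₀ h)) →
      Joined (vertex (frameObj α₀ (g * k))) (vertex (frameObj α₀ (h * k))) := fun g h k H => by
    have := H.map (translate k).continuous
    rwa [translate_vertex, translate_vertex] at this
  have h3 : ∀ g : M.group, Joined (vertex (frameObj α₀ (1 : M.group))) (vertex (frameObj α₀ g)) :=
    fun g => by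
    have hg : g ∈ Subgroup.closure (Set.range M.gen) := closure_range_gen (M := M) ▸ trivial
    induction hg using Subgroup.closure_induction with
    | mem _ h =>
      obtain ⟨q, rfl⟩ := h
      -- The state q is the section of some state r at a letter a, so an arrow with last entry r and
      -- last source letter a has holonomy q.
      obtain ⟨⟨a, r⟩, rfl⟩ := hs.1 q
      obtain ⟨φ, -, h0, hr⟩ := exists_limMor hs.1 r a
      have := joined_edge (frameMor φ 1)
      rw [src_frameMor, tgt_frameMor, LimMor.hol, h0, hr, sec_gen, _root_.mul_one] at this
      exact ((h1 _ _ _).trans this).trans (h1 _ _ _)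
    | one => exact .refl _
    | mul g h _ _ hg hh =>
      have := h2 _ _ h hg
      rw [_root_.one_mul] at this
      exact hh.trans this
    | inv g _ hg =>
      have := h2 _ _ g⁻¹ hg
      rw [_root_.one_mul, mul_inv_cancel] at this
      exact this.symm
  have h4 : ∀ z : FrameSpace M, Joined (vertex (frameObj α₀ (1 : M.group))) z := fun z => by
    obtain ⟨⟨α, g⟩, h⟩ := exists_joined_vertex z
    exact ((h3 g).trans (h1 α₀ α g)).trans h.symm
  exact ⟨⟨vertex (frameObj α₀ (1 : M.group))⟩, fun z w => (h4 z).symm.trans (h4 w)⟩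

theorem exists_path [PathConnectedSpace (FrameSpace M)] {x y : (limitSpace M).Realization}
    (e : frameProj M ⁻¹' {x}) (u : frameProj M ⁻¹' {y}) :
    ∃ γ : Path x y, (isCoveringMap_frameProj M).monodromy (.mk γ) e = u := by
  let γ := PathConnectedSpace.somePath e.1 u.1
  let γ' := (γ.map (isCoveringMap_frameProj M).continuous).cast
    (show x = frameProj M e.1 from e.2.symm) (show y = frameProj M u.1 from u.2.symm)
  exact ⟨γ', monodromy_mk_map _ γ γ' e.2 u.2 fun _ => rfl⟩

theorem holonomy_surjective [PathConnectedSpace (FrameSpace M)]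
    {x : (limitSpace M).Realization} (e : frameProj M ⁻¹' {x}) :
    Function.Surjective (holonomy e) := fun g => by
  obtain ⟨γ, h⟩ := exists_path e ⟨translate g e.1, (frameProj_translate g e.1).trans e.2⟩
  exact ⟨FundamentalGroup.fromPath (.mk γ), holonomy_eq e (congrArg Subtype.val h)⟩

/-! ### Comparison of automata -/

section Comparison

variable [Finite A] [PathConnectedSpace (FrameSpace M)]

/-- The elements k(a) measure how far the given paths are from lifting to `extend a e`. By
`holonomy_transfer` the holonomies of the states obey the twisted recursion with multipliers `(k
a)⁻¹`, and they generate the group because holonomy is onto with kernel K. -/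
theorem equivalent_monodromyAutomaton (hc : M.Contracting)
    (D : MonodromyData (isCoveringMap_shift M) (finite_fiber_shift M)) :
    M.Equivalent D.automaton := by
  obtain ⟨e, he⟩ := frameProj_surjective (M := M) D.base
  let e : frameProj M ⁻¹' {D.base} := ⟨e, he⟩
  have hk : ∀ a, ∃ k : M.group, translate k (extend a e.1) = ((isCoveringMap_frameProj M).monodromy
      (.mk (D.path (letterEquiv e a))) e).1 := fun a =>
    exists_translate ((isCoveringMap_frameProj M).monodromy
      (.mk (D.path (letterEquiv e a))) e).2.symm
  choose k hk using hk
  refine equivalent_of_twist hc D.automaton (letterEquiv e) (fun a => (k a)⁻¹)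
    (fun q => holonomy e q.1) ?_ (fun a q => monodromy_letterEquiv e q.1 a) fun a q => ?_
  · have h1 : Set.range (fun q : D.states => holonomy e q.1) = holonomy e '' D.states := by
      rw [Set.image_eq_range]
    rw [h1, ← MonoidHom.map_closure, eq_top_iff]
    intro g _
    obtain ⟨γ, rfl⟩ := holonomy_surjective e g
    have h2 : QuotientGroup.mk γ ∈ Subgroup.closure ((QuotientGroup.mk : _ →
        FundamentalGroup _ D.base ⧸ monodromyKernel (isCoveringMap_shift M) (finite_fiber_shift M)
          D.base) '' D.states) := D.generates ▸ trivial
    rw [← QuotientGroup.coe_mk', ← MonoidHom.map_closure] at h2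
    obtain ⟨δ, hδ, h⟩ := h2
    exact ⟨δ, hδ, (mk_eq_mk_iff e δ γ).1 h⟩
  · rw [_root_.inv_inv]
    exact ((mk_eq_mk_iff e _ _).1 (D.next_spec (letterEquiv e a) q)).trans
      (holonomy_transfer e D.path k (fun a => (hk a).symm) a q.1)

/-- A path connected frame space allows paths ℓ with k = 1 and loops with any prescribed holonomy.
The recursion for the loops chosen for the states is then untwisted. -/
theorem exists_sameAs_monodromyAutomaton (hinj : Function.Injective M.act) :
    ∃ D : MonodromyData (isCoveringMap_shift M) (finite_fiber_shift M),
      M.SameAs D.automaton := by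
  obtain ⟨e₀⟩ := PathConnectedSpace.nonempty (X := FrameSpace M)
  let x := frameProj M e₀
  let e : frameProj M ⁻¹' {x} := ⟨e₀, rfl⟩
  have hℓ : ∀ b : (limitShift M).realize ⁻¹' {x}, ∃ γ : Path x b.1,
      ((isCoveringMap_frameProj M).monodromy (.mk γ) e).1 =
        extend ((letterEquiv e).symm b) e.1 := fun b => by
    have hb : frameProj M (extend ((letterEquiv e).symm b) e.1) = b.1 :=
      congrArg Subtype.val ((letterEquiv e).apply_symm_apply b)
    obtain ⟨γ, h⟩ := exists_path e ⟨_, hb⟩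
    exact ⟨γ, congrArg Subtype.val h⟩
  choose ℓ hℓ using hℓ
  choose γ hγ using fun q => holonomy_surjective e (M.gen q)
  -- Distinct states induce distinct transformations, so their loops are distinct and can serve as
  -- the set of states.
  have hγi : Function.Injective γ := fun q q' h => gen_injective hinj (by rw [← hγ, ← hγ, h])
  let eQ : Q ≃ Set.range γ := Equiv.ofInjective γ hγi
  have hT : ∀ a q, holonomy e (transfer (isCoveringMap_shift M) ℓ (letterEquiv e a) (γ q)) =
      M.gen (M.next a q) := fun a q => by
    rw [holonomy_transfer e ℓ (fun _ => 1) fun a => ?_, hγ, sec_gen, inv_one, _root_.one_mul, _root_.mul_one]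
    rw [hℓ, translate_one, Equiv.symm_apply_apply]
  let D : MonodromyData (isCoveringMap_shift M) (finite_fiber_shift M) :=
    { base := x
      path := ℓ
      states := Set.range γ
      next b q := eQ (M.next ((letterEquiv e).symm b) (eQ.symm q))
      generates := by
        rw [eq_top_iff]
        rintro ⟨δ⟩ -
        have h1 : holonomy e δ ∈ Subgroup.closure (Set.range M.gen) :=
          closure_range_gen (M := M) ▸ trivial
        have h2 : Set.range M.gen = holonomy e '' Set.range γ := by
          rw [← Set.range_comp]
          exact congrArg Set.range (funext fun q => (hγ q).symm)
        rw [h2, ← MonoidHom.map_closure] at h1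
        obtain ⟨δ', hδ', h⟩ := h1
        rw [← QuotientGroup.coe_mk', ← MonoidHom.map_closure]
        exact ⟨δ', hδ', (mk_eq_mk_iff e δ' δ).2 h⟩
      next_spec b q := by
        obtain ⟨a, rfl⟩ := (letterEquiv e).surjective b
        obtain ⟨q, rfl⟩ := eQ.surjective q
        refine (mk_eq_mk_iff e _ _).2 ?_
        rw [Equiv.symm_apply_apply, Equiv.symm_apply_apply]
        exact (hγ _).trans (hT a q).symm }
  refine ⟨D, letterEquiv e, eQ, fun a q => ⟨?_, ?_⟩⟩
  · refine (monodromy_letterEquiv e (γ q) a).trans ?_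
    rw [hγ, letter_gen]
  · change eQ (M.next ((letterEquiv e).symm (letterEquiv e a)) (eQ.symm (eQ q))) = _
    rw [Equiv.symm_apply_apply, Equiv.symm_apply_apply]

end Comparison

end Limit

end AutLim

/-! ### The main theorem. -/

theorem mainTheorem1 {A : Type*} {Q : Type*} [Finite A] (M : AutLim.Automaton A Q)
    (hinv : M.Invertible) (hnuc : M.Nuclear) (hsmooth : M.Smooth) :
    PathConnectedSpace (AutLim.limitSpace M).Realization ∧
    ∃ (cov : IsCoveringMap (AutLim.limitShift M).realize)
      (fin : ∀ x, ((AutLim.limitShift M).realize ⁻¹' {x}).Finite),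
      (∀ x, ((AutLim.limitShift M).realize ⁻¹' {x}).ncard = Nat.card A) ∧
      (∀ D : AutLim.MonodromyData cov fin, M.Equivalent D.automaton) ∧
      ∃ D : AutLim.MonodromyData cov fin, M.SameAs D.automaton := by
  have : Fact M.Invertible := ⟨hinv⟩
  have : Finite Q := hnuc.finite_states
  have := AutLim.Limit.pathConnectedSpace_frameSpace hnuc.2.1 hsmooth
  exact ⟨AutLim.Limit.frameProj_surjective.pathConnectedSpace
      (AutLim.Limit.isCoveringMap_frameProj M).continuous,
    AutLim.Limit.isCoveringMap_shift M, AutLim.Limit.finite_fiber_shift M,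
    AutLim.Limit.ncard_fiber_shift M, AutLim.Limit.equivalent_monodromyAutomaton hnuc.1,
    AutLim.Limit.exists_sameAs_monodromyAutomaton hnuc.2.1⟩
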